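/- **Setting.** A *system* $\mathcal P=(P,d\mu,d\sigma)$ of dimension $n$ consists of a simple polytope $P$ in an $n$-dimensional real vector space (compact, with non-empty interior, a finite intersection of closed half spaces, every vertex lying on exactly $n$ facets), a translation invariant measure $d\mu$ (a positive multiple of Lebesgue measure) restricted to $P$, and a measure $d\sigma$ on $\partial P$ whose restriction to each facet is a positive multiple of Lebesgue measure of its affine span. For $p\ge1$ let $\mathcal M^{p}(P)$ be the set of lower semicontinuous log convex $u:P\to(0,\infty]$ with $\int_P u\,d\mu=\int_P d\mu$ and $\int_P u^p\,d\mu<\infty$; elements of $\mathcal M^{1}(P)$ are called *states*. Put $$S_{\mathcal P}(u)=-\frac{1}{\int_P d\mu}\int_P u\log u\,d\mu\in[-\infty,0],\qquad U_{\mathcal P}(u)=\frac{1}{\int_P d\mu}\int_{\partial P}u\,d\sigma\in[0,\infty],$$ and $F_{\mathcal P}(T,u)=U_{\mathcal P}(u)-T\,S_{\mathcal P}(u)$ if $S_{\mathcal P}(u)>-\infty$, $F_{\mathcal P}(T,u)=\infty$ otherwise. The *$\mu$-canonical distribution* of temperature $T\ge0$ is the state minimizing $F_{\mathcal P}(T,\cdot)$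 and, if $T=0$, maximizing $S_{\mathcal P}$ among all minimizers of $F_{\mathcal P}(0,\cdot)$. The *equilibrium of internal $\mu$-energy* $U\in\mathbb R$ is the state $u$ with $U_{\mathcal P}(u)=U$ that maximizes $S_{\mathcal P}$ among all states of energy $U$. $\mathcal P$ is *K-unstable* if $\mathrm{DF}(q)=\frac{2\pi}{\int_P d\mu}\Big(\int_{\partial P}q\,d\sigma-\frac{\int_{\partial P}d\sigma}{\int_P d\mu}\int_P q\,d\mu\Big)<0$ for some convex $q:P\to\mathbb R$. Let $\mathfrak U^*_{\mathcal P}=[\min U_{\mathcal P},U_{\mathcal P}(1_P))$, where $1_P$ is the constant state $1$; let $S^{\mathrm{eq}}_{\mathcal P}(U)=\sup\{S_{\mathcal P}(u): u \text{ a state},\,U_{\mathcal P}(u)=U\}$ (with $\sup\emptyset=-\infty$), and let $\mathbb T^{\mathrm{eq}}_{\mathcal P}(U)=[1/\partial_{U-}S^{\mathrm{eq}}_{\mathcal P}(U),\,1/\partial_{U+}S^{\mathrm{eq}}_{\mathcal P}(U)]$ with one-sided derivatives in $[-\infty,\infty]$ and $1/\infty=0$. A K-unstable system is *mild* if $\mathbb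 T^{\mathrm{eq}}_{\mathcal P}(U)$ has exactly one element for every $U\in\mathfrak U^*_{\mathcal P}$. For a K-unstable system and $T\ge0$, $U^{\mathrm{can}}_{\mathcal P}(T)$ is the unique $U\in\mathfrak U^*_{\mathcal P}$ with $T\in\mathbb T^{\mathrm{eq}}_{\mathcal P}(U)$, and $S^{\mathrm{can}}_{\mathcal P}(T)=S^{\mathrm{eq}}_{\mathcal P}(U^{\mathrm{can}}_{\mathcal P}(T))$. The composite of two systems is $\mathcal P_1\times\mathcal P_2=(P_1\times P_2,\ d\mu_1\times d\mu_2,\ d\sigma_1\times d\mu_2+d\mu_1\times d\sigma_2)$, and $\mathcal P^{\times N}$ is the $N$-fold composite. **Theorem.** Let $\mathcal P$ be a K-unstable system of dimension $n$, $\mathcal P_R$ a mild K-unstable system, $U\in\mathfrak U_{\mathcal P}^*$ and $T_R\in[0,\infty)$. For $N\in\mathbb N$ put $\tilde{\mathcal P}_N=\mathcal P\times\mathcal P_R^{\times N}$. The $\mu$-canonical distribution $u_\infty$ of temperature $T_R$ on $\mathcal P$, the equilibrium $\tilde u_N$ of internal $\mu$-energy $U+N\,U^{\mathrm{can}}_{\mathcal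 P_R}(T_R)$ on $\tilde{\mathcal P}_N$ and the equilibrium $u_R^{\times N}$ of internal $\mu$-energy $N\,U^{\mathrm{can}}_{\mathcal P_R}(T_R)$ on $\mathcal P_R^{\times N}$ exist for all $N$, and the following hold. 1. The marginals $$u_N=\frac{1}{\int_{P_R^{\times N}}d\mu_{P_R}^{\times N}}\int_{P_R^{\times N}}\tilde u_N\,d\mu_{P_R}^{\times N}$$ are equilibria on $\mathcal P$ (each for some internal $\mu$-energy). For every real $p\ge1$ with $p(n-1)<n$, i.e. $p\in[1,\frac n{n-1})$, all $u_N$ and $u_\infty$ lie in $\mathcal M^{p}(P)$ and $u_N\to u_\infty$ in $L^p(P,d\mu)$ as $N\to\infty$. 2. Assume moreover that $(\mathcal P_R,T_R)$ has positive heat capacity: $T_R>0$, $S^{\mathrm{can}}_{\mathcal P_R}$ is differentiable at $T_R$, and $\partial_TS^{\mathrm{can}}_{\mathcal P_R}(T_R)>0$. Then for every state $u$ on $\mathcal P$ with $U_{\mathcal P}(u)=U$, the numbers $F_{\mathcal P}(T_R,u_\infty)$ and $F_{\mathcal P}(T_R,u)$ are finite and $$S_{\tilde{\mathcal P}_N}(\tilde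 u_N)-S_{\tilde{\mathcal P}_N}(u\times u_R^{\times N})\ \longrightarrow\ -\frac1{T_R}\bigl(F_{\mathcal P}(T_R,u_\infty)-F_{\mathcal P}(T_R,u)\bigr)\qquad(N\to\infty).$$ -/

import Mathlib

open MeasureTheory Filter Topology
open scoped ENNReal

noncomputable section

namespace NAHam

/-- The faces of a set `P`: the sets `P ∩ {ℓ = 0}` for a non-constant affine function `ℓ` with
`P ⊆ {ℓ ≥ 0}`. -/
def IsFace {V : Type*} [NormedAddCommGroup V] [NormedSpace ℝ V] (P F : Set V) : Prop :=
  ∃ ℓ : V →ᵃ[ℝ] ℝ, ℓ.linear ≠ 0 ∧ (∀ x ∈ P, 0 ≤ ℓ x) ∧ F = {x ∈ P | ℓ x = 0}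

/-- The facets: the nonempty faces whose affine span has codimension one. -/
def IsFacet {V : Type*} [NormedAddCommGroup V] [NormedSpace ℝ V] (P F : Set V) : Prop :=
  IsFace P F ∧ F.Nonempty ∧
    Module.finrank ℝ (affineSpan ℝ F).direction + 1 = Module.finrank ℝ V

/-- A polytope: compact, with nonempty interior, a finite intersection of half spaces. -/
def IsPolytope {V : Type*} [NormedAddCommGroup V] [NormedSpace ℝ V] (P : Set V) : Prop :=
  IsCompact P ∧ (interior P).Nonempty ∧
    ∃ s : Finset (V →ᵃ[ℝ] ℝ), (∀ ℓ ∈ s, ℓ.linear ≠ 0) ∧ P = {x | ∀ ℓ ∈ s, 0 ≤ ℓ x}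

/-- A simple polytope: every vertex lies on exactly `n = dim V` facets. -/
def IsSimplePolytope {V : Type*} [NormedAddCommGroup V] [NormedSpace ℝ V] (P : Set V) : Prop :=
  IsPolytope P ∧
    ∀ v : V, IsFace P {v} → {F : Set V | IsFacet P F ∧ v ∈ F}.ncard = Module.finrank ℝ V

/-- The data `(P, dμ, dσ)`. Both measures are regarded as measures on the ambient space,
`vol` being carried by `P` and `bdry` by `∂P`. -/
structure Triple (V : Type*) [MeasurableSpace V] where
  body : Set V
  vol : Measure V
  bdry : Measure V

/-- `(P, dμ, dσ)` is a (simple non-archimedean Hamiltonian) system: `P` is a simple polytope,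
`dμ` is the restriction to `P` of a Haar (translation invariant) measure, and `dσ` is a measure on
`∂P` whose restriction to each facet `F` is the restriction of a translation invariant measure on
the affine span of `F`. -/
structure IsSystem {V : Type*} [NormedAddCommGroup V] [NormedSpace ℝ V] [MeasurableSpace V]
    [BorelSpace V] (A : Triple V) : Prop where
  simple : IsSimplePolytope A.body
  flat_vol : ∃ ν : Measure V, ν.IsAddHaarMeasure ∧ A.vol = ν.restrict A.body
  bdry_support : A.bdry (frontier A.body)ᶜ = 0
  flat_bdry : ∀ F : Set V, IsFacet A.body F →
    ∃ x ∈ F, ∃ ν : Measure (affineSpan ℝ F).direction, ν.IsAddHaarMeasure ∧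
      A.bdry.restrict F = (ν.map (fun w : (affineSpan ℝ F).direction => (w : V) + x)).restrict F

namespace Triple

/-- The composite `A₁ × A₂`. -/
def prod {V W : Type*} [MeasurableSpace V] [MeasurableSpace W]
    (A : Triple V) (B : Triple W) : Triple (V × W) where
  body := A.body ×ˢ B.body
  vol := A.vol.prod B.vol
  bdry := A.bdry.prod B.vol + A.vol.prod B.bdry

/-- The `N`-fold composite `B × ⋯ × B`; the boundary measure is
`∑ᵢ dμ × ⋯ × dσ × ⋯ × dμ` with `dσ` in the `i`-th place. -/
def pow {W : Type*} [MeasurableSpace W] (B : Triple W) (N : ℕ) : Triple (Fin N → W) where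
  body := Set.univ.pi fun _ => B.body
  vol := Measure.pi fun _ => B.vol
  bdry := ∑ i : Fin N, Measure.pi (Function.update (fun _ => B.vol) i B.bdry)

section

variable {V : Type*} [NormedAddCommGroup V] [NormedSpace ℝ V] [MeasurableSpace V]

/-- The space `ℳ^{exp,p}(P)`; only the values of `u` on `P` are relevant. -/
structure IsState (A : Triple V) (p : ℝ) (u : V → ℝ≥0∞) : Prop where
  lsc : LowerSemicontinuousOn u A.body
  pos : ∀ x ∈ A.body, 0 < u x
  logConvex : ∀ x ∈ A.body, ∀ y ∈ A.body, ∀ t ∈ Set.Icc (0 : ℝ) 1,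
    u ((1 - t) • x + t • y) ≤ u x ^ (1 - t) * u y ^ t
  mass : ∫⁻ x, u x ∂A.vol = A.vol Set.univ
  lp : ∫⁻ x, u x ^ p ∂A.vol < ∞

/-- The entropy `S(u) = - (∫_P dμ)⁻¹ ∫_P u log u dμ`, the integral being the difference of the
integrals of the positive and the negative part (the latter is bounded by `1/e`). -/
def entropy (A : Triple V) (u : V → ℝ≥0∞) : EReal :=
  -((((∫⁻ x, ((u x : EReal) * ENNReal.log (u x)).toENNReal ∂A.vol : ℝ≥0∞) : EReal)
      - ((∫⁻ x, (-((u x : EReal) * ENNReal.log (u x))).toENNReal ∂A.vol : ℝ≥0∞) : EReal))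
    / ((A.vol Set.univ : ℝ≥0∞) : EReal))

/-- The internal `μ`-energy `U(u) = (∫_P dμ)⁻¹ ∫_{∂P} u dσ`. -/
def energy (A : Triple V) (u : V → ℝ≥0∞) : EReal :=
  (((∫⁻ x, u x ∂A.bdry) / A.vol Set.univ : ℝ≥0∞) : EReal)

open Classical in
/-- The free `μ`-energy `F(T, u)`. -/
def freeEnergy (A : Triple V) (T : ℝ) (u : V → ℝ≥0∞) : EReal :=
  if A.entropy u = ⊥ then ⊤ else A.energy u - (T : EReal) * A.entropy u

/-- `u` is the `μ`-canonical distribution of temperature `T ≥ 0`. -/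
structure IsCanonical (A : Triple V) (T : ℝ) (u : V → ℝ≥0∞) : Prop where
  state : A.IsState 1 u
  minimizes : ∀ v, A.IsState 1 v → A.freeEnergy T u ≤ A.freeEnergy T v
  maximizes_entropy : T = 0 → ∀ v, A.IsState 1 v →
    (∀ w, A.IsState 1 w → A.freeEnergy 0 v ≤ A.freeEnergy 0 w) → A.entropy v ≤ A.entropy u

/-- `u` is the equilibrium of internal `μ`-energy `U`. -/
structure IsEquilibrium (A : Triple V) (U : ℝ) (u : V → ℝ≥0∞) : Prop where
  state : A.IsState 1 u
  energy_eq : A.energy u = (U : EReal)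
  maximizes : ∀ v, A.IsState 1 v → A.energy v = (U : EReal) → A.entropy v ≤ A.entropy u

/-- The Donaldson--Futaki invariant. -/
def donaldsonFutaki (A : Triple V) (q : V → ℝ) : ℝ :=
  2 * Real.pi / A.vol.real Set.univ *
    ((∫ x, q x ∂A.bdry)
      - A.bdry.real Set.univ / A.vol.real Set.univ * ∫ x, q x ∂A.vol)

/-- K-instability. A finite convex function on a polytope is bounded, and it is continuous on the
interior and on the relative interior of each facet, so the integrals exist. -/
def IsKUnstable (A : Triple V) : Prop :=
  ∃ q : V → ℝ, ConvexOn ℝ A.body q ∧ A.donaldsonFutaki q < 0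

/-- The interval `[min U, U(1_P))`. -/
def energyRange (A : Triple V) : Set ℝ :=
  {U : ℝ | sInf (A.energy '' {u | A.IsState 1 u}) ≤ (U : EReal) ∧
    (U : EReal) < A.energy (fun _ => 1)}

/-- `S^eq(U)`, the supremum of the entropy at internal `μ`-energy `U` (`-∞` if there is no state of
this energy). -/
def eqEntropy (A : Triple V) (U : ℝ) : EReal :=
  sSup (A.entropy '' {u | A.IsState 1 u ∧ A.energy u = (U : EReal)})

/-- `β^{eq,+}(U)`, the right derivative of `S^eq` (with values in the extended reals). -/
def betaRight (A : Triple V) (U : ℝ) : EReal :=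
  limsup (fun U' : ℝ => (A.eqEntropy U' - A.eqEntropy U) / ((U' - U : ℝ) : EReal)) (𝓝[>] U)

/-- `β^{eq,-}(U)`, the left derivative of `S^eq` (with values in the extended reals). -/
def betaLeft (A : Triple V) (U : ℝ) : EReal :=
  limsup (fun U' : ℝ => (A.eqEntropy U' - A.eqEntropy U) / ((U' - U : ℝ) : EReal)) (𝓝[<] U)

/-- The interval `[1/β^{eq,-}(U), 1/β^{eq,+}(U)]` of equilibrium temperatures, with `1/∞ = 0`. -/
def eqTemperatures (A : Triple V) (U : ℝ) : Set EReal :=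
  Set.Icc (A.betaLeft U)⁻¹ (A.betaRight U)⁻¹

/-- Mildness of a (K-unstable) system. -/
def IsMild (A : Triple V) : Prop :=
  ∀ U ∈ A.energyRange, (A.eqTemperatures U).encard = 1

open Classical in
/-- `U^can(T)` for `T ≥ 0`: the unique `U ∈ [min U, U(1_P))` having `T` as an equilibrium
temperature if the system is K-unstable, and `U(1_P)` otherwise. -/
def canEnergy (A : Triple V) (T : ℝ) : ℝ :=
  if A.IsKUnstable then
    Classical.epsilon fun U : ℝ => U ∈ A.energyRange ∧ (T : EReal) ∈ A.eqTemperatures U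
  else (A.energy fun _ => 1).toReal

/-- `S^can(T) = S^eq(U^can(T))` for `T ≥ 0`. -/
def canEntropy (A : Triple V) (T : ℝ) : ℝ := (A.eqEntropy (A.canEnergy T)).toReal

end

/-- The normalized marginal on the first factor of a function on a product whose second factor
carries the triple `B`. -/
def marginal {V W : Type*} [MeasurableSpace W] (B : Triple W) (u : V × W → ℝ≥0∞) :
    V → ℝ≥0∞ :=
  fun x => (∫⁻ y, u (x, y) ∂B.vol) / B.vol Set.univ

end Triple

/-- The product `u × v` of two functions. -/
def prodState {V W : Type*} (u : V → ℝ≥0∞) (v : W → ℝ≥0∞) : V × W → ℝ≥0∞ :=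
  fun z => u z.1 * v z.2

end NAHam

end

set_option linter.unusedSectionVars false

namespace NAHam

open InformationTheory (klFun klFun_nonneg klFun_zero klFun_one measurable_klFun continuous_klFun)

/-! ### The function `x log x - x + 1` -/

/-! Notation: `en` is the internal energy and `ent` the negative entropy, written as the normalized
integral of `u log u - u + 1`, so that both are lower semicontinuous quantities in `[0, ∞]`.

Reduction to pairs. By Fubini the energy of a state on a composite is the sum of the energies of its
marginals (`en_prod`), and by the Gibbs inequality its negative entropy is at least the sum of those
of its marginals (`ent_marginal_add_le`), with equality for products. By convexity the `N` marginals
on the reservoir copies may be replaced by their average (`exists_of_pow`). Hence the marginal of an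
equilibrium on `P × P_R^N` is the first component of a pair minimizing `ent u + N * ent v` under `en
u + N * en v = U + N * E`, where `E` is the canonical reservoir energy (`IsMinPair`).

Large reservoirs. A fixed amount of energy spread over `N` copies changes the energy of each by a
multiple of `1 / N`, so only the slope of the reservoir entropy at `E` matters. Mildness makes both
one-sided slopes equal to `1 / T`. For `T > 0` the exchange of energy `d` therefore changes the
reservoir entropy by `d / T` up to a vanishing error, and the `u_N` asymptotically minimize `en + T
* ent`. For `T = 0` the slope is infinite, so the reservoir absorbs all energy above the minimum,
and the remaining competition is for entropy.

Compactness. The midpoint inequality `ent_mix_gap` says that `ent` is uniformly convex with respect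
to the Hellinger distance. Minimizing sequences are thus Cauchy, and `exists_limit` turns them into
states without raising energy or negative entropy; all existence statements follow. The same
inequality applied to `u_N` and `u_∞` gives Hellinger convergence.

Integrability. A log convex function is dominated, along any direction, by its values at the two
boundary points of the line. A Gagliardo-Nirenberg type inequality then bounds `∫ u ^ q dμ` by a
multiple of the `q`-th power of `∫ u dσ` whenever `q (n - 1) ≤ n` (`exists_lintegral_rpow_le`). So
finite energy implies finite entropy, and interpolation upgrades Hellinger convergence to
convergence in `L^p`.

The entropy gain follows by bounding the optimal value `ent u_N + N * ent v_N` from above with the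
competitor `u_∞` and from below with the tangent of the reservoir entropy (`tendsto_ent_add`). -/

/-- The right side is the Bregman divergence `a log (a / m) - a + m`. Writing the logarithm as `2
log (√a / √m)` and using `1 - 1 / x ≤ log x` bounds it below by the squared Hellinger distance. -/
theorem sq_sqrt_sub_sqrt_le {a m : ℝ} (ha : 0 ≤ a) (hm : 0 < m) :
    (√a - √m) ^ 2 ≤ klFun a - klFun m - Real.log m * (a - m) := by
  have hm' : √m ^ 2 = m := Real.sq_sqrt hm.le
  rcases ha.eq_or_lt with rfl | ha
  · simp only [klFun, Real.sqrt_zero, zero_mul]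
    nlinarith
  · have ha' : √a ^ 2 = a := Real.sq_sqrt ha.le
    have hsa : 0 < √a := Real.sqrt_pos.2 ha
    have hsm : 0 < √m := Real.sqrt_pos.2 hm
    have h := Real.one_sub_inv_le_log_of_pos (div_pos hsa hsm)
    rw [Real.log_div hsa.ne' hsm.ne', Real.log_sqrt ha.le, Real.log_sqrt hm.le, inv_div] at h
    have h1 : a * (1 - √m / √a) = a - √m * √a := by
      have : a * (√m / √a) = √m * √a := by
        rw [mul_div_assoc', div_eq_iff hsa.ne', mul_assoc, ← sq, ha', mul_comm]
      rw [mul_sub, this, mul_one]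
    have h2 := mul_le_mul_of_nonneg_left h ha.le
    rw [h1] at h2
    simp only [klFun]
    nlinarith

/-- Average the Bregman estimates of `a` and `b` at their midpoint: the linear terms cancel, and
`(√a - √m)² + (√b - √m)² ≥ (√a - √b)² / 2`. The weight is spelled `1 - 1 / 2` to match `mix (1 /
2)`. -/
theorem klFun_midpoint_gap {a b : ℝ} (ha : 0 ≤ a) (hb : 0 ≤ b) :
    klFun ((1 - 1 / 2) * a + 1 / 2 * b) + 1 / 4 * (√a - √b) ^ 2
      ≤ (1 - 1 / 2) * klFun a + 1 / 2 * klFun b := by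
  rcases (add_nonneg ha hb).eq_or_lt with h | h
  · obtain rfl : a = 0 := by linarith
    obtain rfl : b = 0 := by linarith
    norm_num [klFun_zero]
  · have h1 := sq_sqrt_sub_sqrt_le ha (m := (1 - 1 / 2) * a + 1 / 2 * b) (by linarith)
    have h2 := sq_sqrt_sub_sqrt_le hb (m := (1 - 1 / 2) * a + 1 / 2 * b) (by linarith)
    set m := (1 - 1 / 2) * a + 1 / 2 * b with hm
    have h3 : Real.log m * (a - m) + Real.log m * (b - m) = 0 := by rw [hm]; ring
    nlinarith [sq_nonneg (√a + √b - 2 * √m)]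

/-- Makes the entropy cost of a small bounded perturbation of the constant state quadratic. -/
theorem klFun_le_sq {x : ℝ} (hx : 0 ≤ x) : klFun x ≤ (x - 1) ^ 2 := by
  rcases hx.eq_or_lt with rfl | hx
  · simp [klFun_zero]
  · have := mul_le_mul_of_nonneg_left (Real.log_le_sub_one_of_pos hx) hx.le
    simp only [klFun]
    nlinarith

/-- `x log x - x + 1` on the extended half line (with value at `∞` irrelevant). -/
noncomputable def kl (x : ℝ≥0∞) : ℝ≥0∞ := ENNReal.ofReal (klFun x.toReal)

/-- The positive part of `x log x`. -/
noncomputable def posLog (x : ℝ≥0∞) : ℝ≥0∞ := ENNReal.ofReal (x.toReal * Real.log x.toReal)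

/-- The negative part of `x log x`. -/
noncomputable def negLog (x : ℝ≥0∞) : ℝ≥0∞ := ENNReal.ofReal (-(x.toReal * Real.log x.toReal))

/-- The squared difference of square roots. -/
noncomputable def hell (x y : ℝ≥0∞) : ℝ≥0∞ := ENNReal.ofReal ((√x.toReal - √y.toReal) ^ 2)

@[fun_prop]
theorem measurable_kl : Measurable kl :=
  (measurable_klFun.comp ENNReal.measurable_toReal).ennreal_ofReal

theorem kl_one : kl 1 = 0 := by simp [kl, klFun_one]

/-- Transfers a real identity between signed terms to `ℝ≥0∞`: the negative part of each signed term
moves to the other side. -/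
theorem ofReal_sub_parts {a b c d : ℝ} (hc : 0 ≤ c) (hd : 0 ≤ d) (h : a + c = b + d) :
    ENNReal.ofReal a + ENNReal.ofReal (-b) + ENNReal.ofReal c
      = ENNReal.ofReal b + ENNReal.ofReal (-a) + ENNReal.ofReal d := by
  have key : ∀ x : ℝ, ENNReal.ofReal x = ENNReal.ofReal (max x 0) := fun x => by simp
  rw [key a, key b, key (-a), key (-b), ← ENNReal.ofReal_add, ← ENNReal.ofReal_add,
    ← ENNReal.ofReal_add, ← ENNReal.ofReal_add]
  · congr 1
    have h1 : max a 0 - max (-a) 0 = a := max_zero_sub_max_neg_zero_eq_self a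
    have h2 : max b 0 - max (-b) 0 = b := max_zero_sub_max_neg_zero_eq_self b
    linarith
  all_goals positivity

theorem posLog_add_one {x : ℝ≥0∞} (hx : x ≠ ∞) : posLog x + 1 = kl x + x + negLog x := by
  have h := ofReal_sub_parts (a := x.toReal * Real.log x.toReal) (b := 0) (c := 1)
    (d := klFun x.toReal + x.toReal) zero_le_one
    (add_nonneg (klFun_nonneg ENNReal.toReal_nonneg) ENNReal.toReal_nonneg)
    (by simp only [klFun]; ring)
  rw [ENNReal.ofReal_add (klFun_nonneg ENNReal.toReal_nonneg) ENNReal.toReal_nonneg,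
    ENNReal.ofReal_toReal hx] at h
  simp only [neg_zero, ENNReal.ofReal_zero, add_zero, zero_add, ENNReal.ofReal_one] at h
  rw [posLog, h, kl, negLog]
  ring

theorem negLog_le_one (x : ℝ≥0∞) : negLog x ≤ 1 := by
  rw [negLog, ← ENNReal.ofReal_one]
  apply ENNReal.ofReal_le_ofReal
  rcases (ENNReal.toReal_nonneg (a := x)).eq_or_lt with h | h
  · simp [← h]
  · have h1 := mul_le_mul_of_nonneg_left (Real.one_sub_inv_le_log_of_pos h) h.le
    have h2 : x.toReal * (1 - x.toReal⁻¹) = x.toReal - 1 := by field_simp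
    linarith

theorem coe_mul_log_eq {x : ℝ≥0∞} (hx : x ≠ ∞) :
    (x : EReal) * ENNReal.log x = ((x.toReal * Real.log x.toReal : ℝ) : EReal) := by
  rcases eq_or_ne x 0 with rfl | h0
  · simp
  · rw [ENNReal.log_pos_real h0 hx, EReal.coe_mul, EReal.coe_ennreal_toReal hx]

theorem toENNReal_coe_real (r : ℝ) : (r : EReal).toENNReal = ENNReal.ofReal r := by
  rw [EReal.toENNReal_of_ne_top (EReal.coe_ne_top r), EReal.toReal_coe]

/-- From `log x ≤ x ^ ε / ε` with `ε = p - 1`: a bound on `∫ u ^ p` for some `p > 1` controls the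
entropy. -/
theorem kl_le_of_le {u : ℝ≥0∞} {p : ℝ} (hp : 1 < p) (hu : u ≠ ∞) :
    kl u ≤ 1 + ENNReal.ofReal (1 / (p - 1)) * u ^ p := by
  have h0 : (0 : ℝ) ≤ u.toReal := ENNReal.toReal_nonneg
  have hp' : 0 < p - 1 := by linarith
  rw [← ENNReal.ofReal_toReal hu, ENNReal.ofReal_rpow_of_nonneg h0 (by linarith),
    ← ENNReal.ofReal_mul (by positivity), ← ENNReal.ofReal_one, ← ENNReal.ofReal_add zero_le_one
    (by positivity), kl, ENNReal.toReal_ofReal h0]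
  apply ENNReal.ofReal_le_ofReal
  have h1 : u.toReal * Real.log u.toReal ≤ 1 / (p - 1) * u.toReal ^ p := by
    have := mul_le_mul_of_nonneg_left (Real.log_le_rpow_div h0 hp') h0
    calc _ ≤ _ := this
      _ = _ := by
        rw [show p = 1 + (p - 1) by ring, Real.rpow_add_of_nonneg h0 zero_le_one hp'.le,
          Real.rpow_one]
        ring_nf
  simp only [klFun]
  linarith

/-! ### Convex combinations of extended nonnegative functions -/

/-- The convex combination `(1 - t) u + t v`. -/
noncomputable def mix {X : Type*} (t : ℝ) (u v : X → ℝ≥0∞) : X → ℝ≥0∞ :=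
  fun x => ENNReal.ofReal (1 - t) * u x + ENNReal.ofReal t * v x

theorem toReal_mix {t : ℝ} (ht : t ∈ Set.Icc (0 : ℝ) 1) {a b : ℝ≥0∞} (ha : a ≠ ∞) (hb : b ≠ ∞) :
    (ENNReal.ofReal (1 - t) * a + ENNReal.ofReal t * b).toReal
      = (1 - t) * a.toReal + t * b.toReal := by
  rw [ENNReal.toReal_add (by finiteness) (by finiteness), ENNReal.toReal_mul, ENNReal.toReal_mul,
    ENNReal.toReal_ofReal (by linarith [ht.2]), ENNReal.toReal_ofReal ht.1]

theorem kl_mix_le {t : ℝ} (ht : t ∈ Set.Icc (0 : ℝ) 1) {a b : ℝ≥0∞} (ha : a ≠ ∞) (hb : b ≠ ∞) :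
    kl (ENNReal.ofReal (1 - t) * a + ENNReal.ofReal t * b)
      ≤ ENNReal.ofReal (1 - t) * kl a + ENNReal.ofReal t * kl b := by
  have ht' : 0 ≤ 1 - t := by linarith [ht.2]
  have h0 := ht.1
  simp only [kl]
  rw [toReal_mix ht ha hb, ← ENNReal.ofReal_mul ht', ← ENNReal.ofReal_mul h0,
    ← ENNReal.ofReal_add (mul_nonneg ht' (klFun_nonneg ENNReal.toReal_nonneg))
      (mul_nonneg h0 (klFun_nonneg ENNReal.toReal_nonneg))]
  apply ENNReal.ofReal_le_ofReal
  exact InformationTheory.convexOn_klFun.2 (Set.mem_Ici.2 ENNReal.toReal_nonneg)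
    (Set.mem_Ici.2 ENNReal.toReal_nonneg) ht' h0 (by ring)

theorem kl_mix_gap {a b : ℝ≥0∞} (ha : a ≠ ∞) (hb : b ≠ ∞) :
    kl (ENNReal.ofReal (1 - 1 / 2) * a + ENNReal.ofReal (1 / 2) * b)
        + ENNReal.ofReal (1 / 4) * hell a b
      ≤ ENNReal.ofReal (1 - 1 / 2) * kl a + ENNReal.ofReal (1 / 2) * kl b := by
  simp only [kl, hell]
  rw [toReal_mix ⟨by norm_num, by norm_num⟩ ha hb, ← ENNReal.ofReal_mul (by norm_num),
    ← ENNReal.ofReal_mul (by norm_num), ← ENNReal.ofReal_mul (by norm_num),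
    ← ENNReal.ofReal_add (klFun_nonneg (by positivity)) (by positivity),
    ← ENNReal.ofReal_add (mul_nonneg (by norm_num) (klFun_nonneg ENNReal.toReal_nonneg))
      (mul_nonneg (by norm_num) (klFun_nonneg ENNReal.toReal_nonneg))]
  exact ENNReal.ofReal_le_ofReal
    (klFun_midpoint_gap ENNReal.toReal_nonneg ENNReal.toReal_nonneg)

/-- Hölder's inequality for the measure with masses `c` and `d` at two points. It makes sums of log
convex functions log convex. -/
theorem add_rpow_mul_rpow_le {p q : ℝ} (hp : 0 ≤ p) (hq : 0 ≤ q) (hpq : p + q = 1)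
    (c d a₁ a₂ b₁ b₂ : ℝ≥0∞) :
    c * (a₁ ^ p * b₁ ^ q) + d * (a₂ ^ p * b₂ ^ q)
      ≤ (c * a₁ + d * a₂) ^ p * (c * b₁ + d * b₂) ^ q := by
  have := ENNReal.lintegral_mul_norm_pow_le
    (μ := c • Measure.dirac true + d • Measure.dirac false)
    (f := fun b : Bool => if b then a₁ else a₂) (g := fun b : Bool => if b then b₁ else b₂)
    (Measurable.of_discrete.aemeasurable) (Measurable.of_discrete.aemeasurable) hp hq hpq
  simpa [lintegral_add_measure, lintegral_smul_measure, lintegral_dirac] using this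

theorem rpow_mul_rpow_le {t : ℝ} (ht : t ∈ Set.Icc (0 : ℝ) 1) (a b : ℝ≥0∞) :
    a ^ (1 - t) * b ^ t ≤ ENNReal.ofReal (1 - t) * a + ENNReal.ofReal t * b := by
  rcases ht.1.eq_or_lt with rfl | h0
  · simp
  rcases ht.2.eq_or_lt with rfl | h1
  · simp
  rcases eq_or_ne a ∞ with rfl | ha
  · have : ENNReal.ofReal (1 - t) * ∞ = ∞ := ENNReal.mul_top (by simpa using h1)
    simp [this]
  rcases eq_or_ne b ∞ with rfl | hb
  · have : ENNReal.ofReal t * ∞ = ∞ := ENNReal.mul_top (by simpa using h0)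
    simp [this]
  lift a to NNReal using ha
  lift b to NNReal using hb
  have h := Real.geom_mean_le_arith_mean2_weighted (by linarith : 0 ≤ 1 - t) h0.le
    a.coe_nonneg b.coe_nonneg (by ring)
  have h' := ENNReal.ofReal_le_ofReal h
  rwa [ENNReal.ofReal_mul (by positivity), ENNReal.ofReal_add (mul_nonneg (by linarith) (by positivity)) (by positivity),
    ENNReal.ofReal_mul (by linarith), ENNReal.ofReal_mul h0.le,
    ← ENNReal.ofReal_rpow_of_nonneg (by positivity) (by linarith),
    ← ENNReal.ofReal_rpow_of_nonneg (by positivity) h0.le, ENNReal.ofReal_coe_nnreal,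
    ENNReal.ofReal_coe_nnreal] at h'

/-! ### Lower semicontinuous functions on a closed set -/

/-- A state is controlled only on the body. After extension by zero each superlevel set is the
intersection of a closed and an open set. -/
theorem _root_.LowerSemicontinuousOn.measurable_indicator {X : Type*} [TopologicalSpace X]
    [MeasurableSpace X] [OpensMeasurableSpace X] {s : Set X} {u : X → ℝ≥0∞}
    (h : LowerSemicontinuousOn u s) (hs : IsClosed s) : Measurable (s.indicator u) := by
  apply measurable_of_Ioi
  intro c
  obtain ⟨O, hO, hO'⟩ := lowerSemicontinuousOn_iff_preimage_Ioi.1 h c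
  have : s.indicator u ⁻¹' Set.Ioi c = s ∩ u ⁻¹' Set.Ioi c := by
    ext x
    by_cases hx : x ∈ s <;> simp [hx]
  rw [this, hO']
  exact hs.measurableSet.inter hO.measurableSet

theorem _root_.LowerSemicontinuousOn.aemeasurable_of_isClosed {X : Type*} [TopologicalSpace X]
    [MeasurableSpace X] [OpensMeasurableSpace X] {s : Set X} {u : X → ℝ≥0∞} {μ : Measure X}
    (h : LowerSemicontinuousOn u s) (hs : IsClosed s) (hμ : μ sᶜ = 0) : AEMeasurable u μ := by
  refine ⟨_, h.measurable_indicator hs, ?_⟩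
  have : ∀ᵐ x ∂μ, x ∈ s := by rwa [ae_iff]
  filter_upwards [this] with x hx
  simp [hx]

theorem _root_.LowerSemicontinuousOn.const_mul_ennreal {X : Type*} [TopologicalSpace X]
    {s : Set X} {u : X → ℝ≥0∞} (h : LowerSemicontinuousOn u s) {c : ℝ≥0∞} (hc : c ≠ ∞) :
    LowerSemicontinuousOn (fun x => c * u x) s :=
  Continuous.comp_lowerSemicontinuousOn (ENNReal.continuous_const_mul hc) h
    (fun _ _ hab => mul_le_mul_right hab c)

/-! ### States and their entropy -/

namespace Triple

section Defs

variable {V : Type*} [MeasurableSpace V]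

/-- The negative of the entropy of a state, as the normalized integral of `u log u - u + 1`. -/
noncomputable def ent (A : Triple V) (u : V → ℝ≥0∞) : ℝ≥0∞ :=
  (∫⁻ x, kl (u x) ∂A.vol) / A.vol Set.univ

/-- The internal energy as an extended nonnegative number. -/
noncomputable def en (A : Triple V) (u : V → ℝ≥0∞) : ℝ≥0∞ :=
  (∫⁻ x, u x ∂A.bdry) / A.vol Set.univ

/-- The normalized squared Hellinger distance. -/
noncomputable def hdist (A : Triple V) (u v : V → ℝ≥0∞) : ℝ≥0∞ :=
  (∫⁻ x, hell (u x) (v x) ∂A.vol) / A.vol Set.univ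

/-- The measure theoretic regularity shared by systems and their composites. -/
structure IsRegular [TopologicalSpace V] (A : Triple V) : Prop where
  isClosed : IsClosed A.body
  vol_ne_zero : A.vol Set.univ ≠ 0
  finite_vol : IsFiniteMeasure A.vol
  finite_bdry : IsFiniteMeasure A.bdry
  vol_compl : A.vol A.bodyᶜ = 0
  bdry_compl : A.bdry A.bodyᶜ = 0

theorem IsRegular.vol_ne_top [TopologicalSpace V] {A : Triple V} (hA : A.IsRegular) :
    A.vol Set.univ ≠ ∞ :=
  have := hA.finite_vol
  measure_ne_top _ _

theorem IsRegular.ae_vol_mem [TopologicalSpace V] {A : Triple V} (hA : A.IsRegular) :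
    ∀ᵐ x ∂A.vol, x ∈ A.body := by
  rw [ae_iff]; exact hA.vol_compl

theorem IsRegular.ae_bdry_mem [TopologicalSpace V] {A : Triple V} (hA : A.IsRegular) :
    ∀ᵐ x ∂A.bdry, x ∈ A.body := by
  rw [ae_iff]; exact hA.bdry_compl

theorem energy_eq_en {V : Type*} [NormedAddCommGroup V] [NormedSpace ℝ V] [MeasurableSpace V]
    (A : Triple V) (u : V → ℝ≥0∞) : A.energy u = (A.en u : EReal) := rfl

end Defs

variable {V : Type*} [NormedAddCommGroup V] [NormedSpace ℝ V] [MeasurableSpace V] [BorelSpace V]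
  {A : Triple V} {u v : V → ℝ≥0∞} {p : ℝ}

theorem ae_ne_top_of_mass (hA : A.IsRegular) (hu : AEMeasurable u A.vol)
    (h : ∫⁻ x, u x ∂A.vol = A.vol Set.univ) : ∀ᵐ x ∂A.vol, u x ≠ ∞ := by
  filter_upwards [ae_lt_top' hu (by rw [h]; exact hA.vol_ne_top)] with x hx using hx.ne

theorem lintegral_negLog_ne_top (hA : A.IsRegular) (u : V → ℝ≥0∞) :
    ∫⁻ x, negLog (u x) ∂A.vol ≠ ∞ := by
  refine ne_top_of_le_ne_top hA.vol_ne_top ((lintegral_mono fun x => negLog_le_one (u x)).trans ?_)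
  simp

theorem lintegral_posLog_eq (hA : A.IsRegular) (hu : AEMeasurable u A.vol)
    (h : ∫⁻ x, u x ∂A.vol = A.vol Set.univ) :
    ∫⁻ x, posLog (u x) ∂A.vol = ∫⁻ x, kl (u x) ∂A.vol + ∫⁻ x, negLog (u x) ∂A.vol := by
  have h1 : ∫⁻ x, (posLog (u x) + 1) ∂A.vol = ∫⁻ x, (kl (u x) + u x + negLog (u x)) ∂A.vol := by
    apply lintegral_congr_ae
    filter_upwards [ae_ne_top_of_mass hA hu h] with x hx using posLog_add_one hx
  rw [lintegral_add_right _ measurable_const, lintegral_add_left' (by fun_prop),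
    lintegral_add_left' (by fun_prop), h, lintegral_one, add_right_comm] at h1
  exact (ENNReal.add_left_inj hA.vol_ne_top).1 h1

theorem coe_div_eq (a : ℝ≥0∞) {b : ℝ≥0∞} (h0 : b ≠ 0) (hb : b ≠ ∞) :
    ((a / b : ℝ≥0∞) : EReal) = (a : EReal) / (b : EReal) := by
  lift b to NNReal using hb
  have hb : b ≠ 0 := by simpa using h0
  rw [div_eq_mul_inv, EReal.coe_ennreal_mul, div_eq_mul_inv, ← ENNReal.coe_inv hb]
  congr 1

/-- The mass condition makes `-u + 1` integrate to zero, and the integral of the negative part of `u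
log u` is finite and can be cancelled. -/
theorem entropy_eq (hA : A.IsRegular) (hu : AEMeasurable u A.vol)
    (h : ∫⁻ x, u x ∂A.vol = A.vol Set.univ) : A.entropy u = -(A.ent u : EReal) := by
  have h1 : ∫⁻ x, ((u x : EReal) * ENNReal.log (u x)).toENNReal ∂A.vol
      = ∫⁻ x, posLog (u x) ∂A.vol := by
    apply lintegral_congr_ae
    filter_upwards [ae_ne_top_of_mass hA hu h] with x hx
    rw [coe_mul_log_eq hx, toENNReal_coe_real, posLog]
  have h2 : ∫⁻ x, (-((u x : EReal) * ENNReal.log (u x))).toENNReal ∂A.vol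
      = ∫⁻ x, negLog (u x) ∂A.vol := by
    apply lintegral_congr_ae
    filter_upwards [ae_ne_top_of_mass hA hu h] with x hx
    rw [coe_mul_log_eq hx, ← EReal.coe_neg, toENNReal_coe_real, negLog]
  rw [entropy, h1, h2, lintegral_posLog_eq hA hu h, EReal.coe_ennreal_add, ent,
    coe_div_eq _ hA.vol_ne_zero hA.vol_ne_top]
  congr 2
  have hne := lintegral_negLog_ne_top hA u
  lift ∫⁻ x, negLog (u x) ∂A.vol to NNReal using hne with b
  exact EReal.add_sub_cancel_right

namespace IsState

theorem aemeasurable_vol (hA : A.IsRegular) (hu : A.IsState p u) : AEMeasurable u A.vol :=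
  hu.lsc.aemeasurable_of_isClosed hA.isClosed hA.vol_compl

theorem aemeasurable_bdry (hA : A.IsRegular) (hu : A.IsState p u) : AEMeasurable u A.bdry :=
  hu.lsc.aemeasurable_of_isClosed hA.isClosed hA.bdry_compl

theorem ae_ne_top (hA : A.IsRegular) (hu : A.IsState p u) : ∀ᵐ x ∂A.vol, u x ≠ ∞ :=
  ae_ne_top_of_mass hA (hu.aemeasurable_vol hA) hu.mass

theorem entropy_eq (hA : A.IsRegular) (hu : A.IsState p u) : A.entropy u = -(A.ent u : EReal) :=
  Triple.entropy_eq hA (hu.aemeasurable_vol hA) hu.mass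

theorem mk' (hA : A.IsRegular) (lsc : LowerSemicontinuousOn u A.body)
    (pos : ∀ x ∈ A.body, 0 < u x)
    (logConvex : ∀ x ∈ A.body, ∀ y ∈ A.body, ∀ t ∈ Set.Icc (0 : ℝ) 1,
      u ((1 - t) • x + t • y) ≤ u x ^ (1 - t) * u y ^ t)
    (mass : ∫⁻ x, u x ∂A.vol = A.vol Set.univ) : A.IsState 1 u :=
  ⟨lsc, pos, logConvex, mass, by simpa [mass] using hA.vol_ne_top.lt_top⟩

theorem one (hA : A.IsRegular) : A.IsState 1 (fun _ => 1) := by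
  refine mk' hA (fun x _ => lowerSemicontinuousWithinAt_const) (by simp) ?_ (by simp)
  simp

theorem mix {t : ℝ} (ht : t ∈ Set.Icc (0 : ℝ) 1) (hA : A.IsRegular) (hu : A.IsState 1 u)
    (hv : A.IsState 1 v) : A.IsState 1 (mix t u v) := by
  refine mk' hA ?_ ?_ ?_ ?_
  · exact (hu.lsc.const_mul_ennreal ENNReal.ofReal_ne_top).add
      (hv.lsc.const_mul_ennreal ENNReal.ofReal_ne_top)
  · intro x hx
    rcases ht.1.eq_or_lt with rfl | h0
    · simpa [NAHam.mix] using hu.pos x hx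
    · exact (ENNReal.mul_pos (by simpa using h0) (hv.pos x hx).ne').trans_le le_add_self
  · intro x hx y hy s hs
    refine le_trans ?_ (add_rpow_mul_rpow_le (by linarith [hs.2]) hs.1 (by ring) _ _ _ _ _ _)
    exact add_le_add (mul_le_mul_right (hu.logConvex x hx y hy s hs) _)
      (mul_le_mul_right (hv.logConvex x hx y hy s hs) _)
  · simp only [NAHam.mix]
    have hu' := hu.aemeasurable_vol hA
    have hv' := hv.aemeasurable_vol hA
    rw [lintegral_add_left' (by fun_prop), lintegral_const_mul'' _ hu', lintegral_const_mul'' _ hv',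
      hu.mass, hv.mass, ← add_mul, ← ENNReal.ofReal_add (by linarith [ht.2]) ht.1]
    simp

end IsState

theorem ent_one : A.ent (fun _ => 1) = 0 := by simp [ent, kl_one]

theorem en_one_ne_top (hA : A.IsRegular) : A.en (fun _ => 1) ≠ ∞ := by
  have := hA.finite_bdry
  rw [en]
  exact ENNReal.div_ne_top (by simp) hA.vol_ne_zero

theorem en_mix (hA : A.IsRegular) (hu : A.IsState 1 u) (hv : A.IsState 1 v) (t : ℝ) :
    A.en (mix t u v) = ENNReal.ofReal (1 - t) * A.en u + ENNReal.ofReal t * A.en v := by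
  have hu' := hu.aemeasurable_bdry hA
  have hv' := hv.aemeasurable_bdry hA
  simp only [en, mix]
  rw [lintegral_add_left' (by fun_prop), lintegral_const_mul'' _ hu', lintegral_const_mul'' _ hv',
    ENNReal.add_div, mul_div_assoc, mul_div_assoc]

theorem ent_mix_le {t : ℝ} (ht : t ∈ Set.Icc (0 : ℝ) 1) (hA : A.IsRegular) (hu : A.IsState 1 u)
    (hv : A.IsState 1 v) :
    A.ent (mix t u v) ≤ ENNReal.ofReal (1 - t) * A.ent u + ENNReal.ofReal t * A.ent v := by
  have hu' := hu.aemeasurable_vol hA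
  have hv' := hv.aemeasurable_vol hA
  simp only [ent, ← mul_div_assoc]
  rw [← ENNReal.add_div, ← lintegral_const_mul'' _ (by fun_prop),
    ← lintegral_const_mul'' _ (by fun_prop), ← lintegral_add_left' (by fun_prop)]
  refine ENNReal.div_le_div_right (lintegral_mono_ae ?_) _
  filter_upwards [hu.ae_ne_top hA, hv.ae_ne_top hA] with x hx hy using kl_mix_le ht hx hy

/-- Uniform convexity of the negative entropy. This one inequality supplies the compactness of
minimizing sequences and the convergence of the marginals. -/
theorem ent_mix_gap (hA : A.IsRegular) (hu : A.IsState 1 u) (hv : A.IsState 1 v) :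
    A.ent (mix (1 / 2) u v) + ENNReal.ofReal (1 / 4) * A.hdist u v
      ≤ ENNReal.ofReal (1 - 1 / 2) * A.ent u + ENNReal.ofReal (1 / 2) * A.ent v := by
  have hu' := hu.aemeasurable_vol hA
  have hv' := hv.aemeasurable_vol hA
  have hu'' : AEMeasurable (fun x => kl (u x)) A.vol := by fun_prop
  have hv'' : AEMeasurable (fun x => kl (v x)) A.vol := by fun_prop
  have hh : AEMeasurable (fun x => hell (u x) (v x)) A.vol := by unfold hell; fun_prop
  simp only [ent, hdist, ← mul_div_assoc]
  rw [← ENNReal.add_div, ← ENNReal.add_div, ← lintegral_const_mul'' _ hh,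
    ← lintegral_const_mul'' _ hu'', ← lintegral_const_mul'' _ hv'',
    ← lintegral_add_left' (hu''.const_mul _), ← lintegral_add_right' _ (hh.const_mul _)]
  refine ENNReal.div_le_div_right (lintegral_mono_ae ?_) _
  filter_upwards [hu.ae_ne_top hA, hv.ae_ne_top hA] with x hx hy using kl_mix_gap hx hy

end Triple

/-! ### Composites: the pointwise inequalities -/

theorem mul_ofReal_log_eq_posLog {s : ℝ≥0∞} (hs : s ≠ ∞) :
    s * ENNReal.ofReal (Real.log s.toReal) = posLog s := by
  rw [posLog, ENNReal.ofReal_mul ENNReal.toReal_nonneg, ENNReal.ofReal_toReal hs]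

theorem mul_ofReal_neg_log_eq_negLog {s : ℝ≥0∞} (hs : s ≠ ∞) :
    s * ENNReal.ofReal (-Real.log s.toReal) = negLog s := by
  rw [negLog, ← mul_neg, ENNReal.ofReal_mul ENNReal.toReal_nonneg, ENNReal.ofReal_toReal hs]

theorem ofReal_eq_toReal_mul {r : ℝ≥0∞} (hr : r ≠ ∞) (x : ℝ) :
    r * ENNReal.ofReal x = ENNReal.ofReal (r.toReal * x) := by
  rw [ENNReal.ofReal_mul ENNReal.toReal_nonneg, ENNReal.ofReal_toReal hr]

theorem ofReal_eq_ofReal_max (x : ℝ) : ENNReal.ofReal x = ENNReal.ofReal (max x 0) := by simp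

/-- This is `r log (s t) ≤ r log r - r + s t`, that is `log x ≤ x - 1` at `x = s t / r`, with each
logarithm split into positive and negative parts so that both sides can be integrated in `ℝ≥0∞`. -/
theorem gibbs_le {r s t : ℝ≥0∞} (hr : r ≠ ∞) (hs : s ≠ ∞) (ht : t ≠ ∞) (hs0 : s ≠ 0)
    (ht0 : t ≠ 0) :
    1 + r * ENNReal.ofReal (Real.log s.toReal) + r * ENNReal.ofReal (Real.log t.toReal)
      ≤ kl r + s * t + r * ENNReal.ofReal (-Real.log s.toReal)
        + r * ENNReal.ofReal (-Real.log t.toReal) := by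
  have hk : 0 ≤ InformationTheory.klFun r.toReal :=
    InformationTheory.klFun_nonneg ENNReal.toReal_nonneg
  have hst : 0 ≤ s.toReal * t.toReal := by positivity
  rw [ofReal_eq_toReal_mul hr, ofReal_eq_toReal_mul hr, ofReal_eq_toReal_mul hr,
    ofReal_eq_toReal_mul hr, kl, ← ENNReal.ofReal_one, mul_neg, mul_neg]
  have hst' : s * t = ENNReal.ofReal (s.toReal * t.toReal) := by
    rw [← ENNReal.toReal_mul, ENNReal.ofReal_toReal (by finiteness)]
  set x := r.toReal * Real.log s.toReal
  set y := r.toReal * Real.log t.toReal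
  rw [hst', ofReal_eq_ofReal_max x, ofReal_eq_ofReal_max y, ofReal_eq_ofReal_max (-x),
    ofReal_eq_ofReal_max (-y), ← ENNReal.ofReal_add (by positivity) (by positivity),
    ← ENNReal.ofReal_add (by positivity) (by positivity), ← ENNReal.ofReal_add hk hst,
    ← ENNReal.ofReal_add (by positivity) (by positivity),
    ← ENNReal.ofReal_add (by positivity) (by positivity)]
  apply ENNReal.ofReal_le_ofReal
  have h1 : max x 0 - max (-x) 0 = x := max_zero_sub_max_neg_zero_eq_self x
  have h2 : max y 0 - max (-y) 0 = y := max_zero_sub_max_neg_zero_eq_self y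
  have hs1 : 0 < s.toReal := ENNReal.toReal_pos hs0 hs
  have ht1 : 0 < t.toReal := ENNReal.toReal_pos ht0 ht
  have key : x + y ≤ r.toReal * Real.log r.toReal - r.toReal + s.toReal * t.toReal := by
    have hxy : x + y = r.toReal * Real.log (s.toReal * t.toReal) := by
      rw [Real.log_mul hs1.ne' ht1.ne', mul_add]
    rw [hxy]
    rcases (ENNReal.toReal_nonneg (a := r)).eq_or_lt with h | h
    · rw [← h]; simp; positivity
    · have h3 := mul_le_mul_of_nonneg_left
        (Real.log_le_sub_one_of_pos (div_pos (mul_pos hs1 ht1) h)) h.le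
      rw [Real.log_div (mul_pos hs1 ht1).ne' h.ne', mul_sub, mul_sub, mul_div_cancel₀ _ h.ne'] at h3
      linarith
  simp only [InformationTheory.klFun]
  linarith

/-- The case `r = s t`, where the Gibbs inequality is sharp; it gives additivity of the entropy on
products. -/
theorem gibbs_eq {s t : ℝ≥0∞} (hs : s ≠ ∞) (ht : t ≠ ∞) (hs0 : s ≠ 0) (ht0 : t ≠ 0) :
    1 + s * t * ENNReal.ofReal (Real.log s.toReal) + s * t * ENNReal.ofReal (Real.log t.toReal)
      = kl (s * t) + s * t + s * t * ENNReal.ofReal (-Real.log s.toReal)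
        + s * t * ENNReal.ofReal (-Real.log t.toReal) := by
  have hst' : s * t ≠ ∞ := by finiteness
  have hk : 0 ≤ InformationTheory.klFun (s * t).toReal :=
    InformationTheory.klFun_nonneg ENNReal.toReal_nonneg
  rw [ofReal_eq_toReal_mul hst', ofReal_eq_toReal_mul hst', ofReal_eq_toReal_mul hst',
    ofReal_eq_toReal_mul hst', kl, ← ENNReal.ofReal_one, mul_neg, mul_neg]
  nth_rw 4 [← ENNReal.ofReal_toReal hst']
  set x := (s * t).toReal * Real.log s.toReal with hx
  set y := (s * t).toReal * Real.log t.toReal with hy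
  rw [ofReal_eq_ofReal_max x, ofReal_eq_ofReal_max y, ofReal_eq_ofReal_max (-x),
    ofReal_eq_ofReal_max (-y), ← ENNReal.ofReal_add (by positivity) (by positivity),
    ← ENNReal.ofReal_add (by positivity) (by positivity), ← ENNReal.ofReal_add hk (by positivity),
    ← ENNReal.ofReal_add (by positivity) (by positivity),
    ← ENNReal.ofReal_add (by positivity) (by positivity)]
  congr 1
  have h1 : max x 0 - max (-x) 0 = x := max_zero_sub_max_neg_zero_eq_self x
  have h2 : max y 0 - max (-y) 0 = y := max_zero_sub_max_neg_zero_eq_self y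
  have hs1 : 0 < s.toReal := ENNReal.toReal_pos hs0 hs
  have ht1 : 0 < t.toReal := ENNReal.toReal_pos ht0 ht
  have key : x + y = (s * t).toReal * Real.log (s * t).toReal := by
    rw [hx, hy, ENNReal.toReal_mul, Real.log_mul hs1.ne' ht1.ne', mul_add]
  simp only [InformationTheory.klFun]
  linarith

theorem measure_prod_compl_eq_zero {X Y : Type*} [MeasurableSpace X] [MeasurableSpace Y]
    {μ : Measure X} {ν : Measure Y} [SFinite ν] {s : Set X} {t : Set Y}
    (hs : μ sᶜ = 0) (ht : ν tᶜ = 0) : (μ.prod ν) (s ×ˢ t)ᶜ = 0 := by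
  rw [Set.compl_prod_eq_union]
  exact measure_union_null (by simp [hs]) (by simp [ht])

theorem _root_.LowerSemicontinuousOn.mul_ennreal {X : Type*} [TopologicalSpace X] {s : Set X}
    {f g : X → ℝ≥0∞} (hf : LowerSemicontinuousOn f s) (hg : LowerSemicontinuousOn g s) :
    LowerSemicontinuousOn (fun x => f x * g x) s := by
  rw [lowerSemicontinuousOn_iff_le_liminf] at *
  intro x hx
  exact (mul_le_mul' (hf x hx) (hg x hx)).trans ENNReal.le_liminf_mul

namespace Triple

/-! ### Composites of two triples -/

section Prod

variable {V W : Type*} [NormedAddCommGroup V] [NormedSpace ℝ V] [MeasurableSpace V] [BorelSpace V]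
  [SecondCountableTopology V] [NormedAddCommGroup W] [NormedSpace ℝ W] [MeasurableSpace W]
  [BorelSpace W] [SecondCountableTopology W] {A : Triple V} {B : Triple W} {u : V → ℝ≥0∞}
  {v : W → ℝ≥0∞} {w : V × W → ℝ≥0∞}

theorem IsRegular.prod (hA : A.IsRegular) (hB : B.IsRegular) : (A.prod B).IsRegular := by
  have := hA.finite_vol
  have := hB.finite_vol
  have := hA.finite_bdry
  have := hB.finite_bdry
  refine ⟨hA.isClosed.prod hB.isClosed, ?_, ?_, ?_, ?_, ?_⟩
  · simp only [Triple.prod]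
    rw [← Set.univ_prod_univ, Measure.prod_prod]
    exact mul_ne_zero hA.vol_ne_zero hB.vol_ne_zero
  · simp only [Triple.prod]; infer_instance
  · simp only [Triple.prod]; infer_instance
  · exact measure_prod_compl_eq_zero hA.vol_compl hB.vol_compl
  · simp only [Triple.prod, Measure.add_apply]
    rw [measure_prod_compl_eq_zero hA.bdry_compl hB.vol_compl,
      measure_prod_compl_eq_zero hA.vol_compl hB.bdry_compl, add_zero]

theorem prod_vol_univ (hB : B.IsRegular) :
    (A.prod B).vol Set.univ = A.vol Set.univ * B.vol Set.univ := by
  have := hB.finite_vol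
  rw [← Measure.prod_prod, Set.univ_prod_univ, Triple.prod]

/-- The normalized marginal on the second factor. -/
noncomputable def marginalSnd {V W : Type*} [MeasurableSpace V] (A : Triple V)
    (w : V × W → ℝ≥0∞) : W → ℝ≥0∞ :=
  A.marginal (w ∘ Prod.swap)

theorem marginal_mul (hB : B.IsRegular) (x : V) :
    B.marginal w x * B.vol Set.univ = ∫⁻ y, w (x, y) ∂B.vol :=
  ENNReal.div_mul_cancel hB.vol_ne_zero hB.vol_ne_top

theorem IsState.section_aemeasurable {p : ℝ} (hB : B.IsRegular) (hw : (A.prod B).IsState p w)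
    {x : V} (hx : x ∈ A.body) : AEMeasurable (fun y => w (x, y)) B.vol := by
  refine LowerSemicontinuousOn.aemeasurable_of_isClosed (s := B.body) ?_ hB.isClosed hB.vol_compl
  exact hw.lsc.comp (Continuous.continuousOn (by fun_prop)) fun y hy => ⟨hx, hy⟩

/-- Lower semicontinuity is Fatou's lemma, log convexity is Hölder's inequality in the integrated
variable, and the mass is Fubini. -/
theorem IsState.marginal (hA : A.IsRegular) (hB : B.IsRegular) (hw : (A.prod B).IsState 1 w) :
    A.IsState 1 (B.marginal w) := by
  have := hA.finite_vol
  have := hB.finite_vol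
  have hcongr : ∀ x, ∫⁻ y, w (x, y) ∂B.vol = ∫⁻ y, B.body.indicator (fun y => w (x, y)) y ∂B.vol := by
    intro x
    apply lintegral_congr_ae
    filter_upwards [hB.ae_vol_mem] with y hy
    simp [hy]
  have hind : ∀ x ∈ A.body, AEMeasurable (B.body.indicator fun y => w (x, y)) B.vol := fun x hx =>
    (hw.section_aemeasurable hB hx).indicator hB.isClosed.measurableSet
  refine IsState.mk' hA ?_ ?_ ?_ ?_
  · have hl : LowerSemicontinuousOn (fun x => ∫⁻ y, w (x, y) ∂B.vol) A.body := by
      rw [lowerSemicontinuousOn_iff_le_liminf]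
      intro x hx
      -- Fatou's lemma, for the functions made measurable off the body
      set g : V → W → ℝ≥0∞ := fun x' => (A.body ×ˢ B.body).indicator w ∘ Prod.mk x' with hg
      have hgm : ∀ x', AEMeasurable (g x') B.vol := by
        intro x'
        by_cases hx' : x' ∈ A.body
        · convert hind x' hx' using 1
          ext y
          by_cases hy : y ∈ B.body <;> simp [hg, hx', hy]
        · convert aemeasurable_const (b := (0 : ℝ≥0∞)) using 1
          ext y
          simp [hg, hx']
      have hgw : ∀ x' ∈ A.body, ∫⁻ y, w (x', y) ∂B.vol = ∫⁻ y, g x' y ∂B.vol := by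
        intro x' hx'
        rw [hcongr]
        apply lintegral_congr
        intro y
        by_cases hy : y ∈ B.body <;> simp [hg, hx', hy]
      calc ∫⁻ y, w (x, y) ∂B.vol ≤ ∫⁻ y, liminf (fun x' => g x' y) (𝓝[A.body] x) ∂B.vol := by
            apply lintegral_mono_ae
            filter_upwards [hB.ae_vol_mem] with y hy
            have h1 : LowerSemicontinuousOn (fun x' => w (x', y)) A.body :=
              hw.lsc.comp (Continuous.continuousOn (by fun_prop)) fun x' hx' => ⟨hx', hy⟩
            refine (h1.le_liminf x hx).trans (le_of_eq (liminf_congr ?_))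
            filter_upwards [self_mem_nhdsWithin] with x' hx'
            simp [hg, hx', hy]
        _ ≤ liminf (fun x' => ∫⁻ y, g x' y ∂B.vol) (𝓝[A.body] x) := lintegral_liminf_le' hgm
        _ = _ := by
            refine liminf_congr ?_
            filter_upwards [self_mem_nhdsWithin] with x' hx' using (hgw x' hx').symm
    have := hl.const_mul_ennreal (c := (B.vol Set.univ)⁻¹) (ENNReal.inv_ne_top.2 hB.vol_ne_zero)
    change LowerSemicontinuousOn (fun x => (∫⁻ y, w (x, y) ∂B.vol) / B.vol Set.univ) A.body
    simpa only [div_eq_mul_inv, mul_comm] using this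
  · intro x hx
    refine ENNReal.div_pos ?_ hB.vol_ne_top
    rw [Ne, lintegral_eq_zero_iff' (hw.section_aemeasurable hB hx)]
    intro h0
    have : ∀ᵐ y ∂B.vol, False := by
      filter_upwards [h0, hB.ae_vol_mem] with y hy hy'
      exact (hw.pos (x, y) ⟨hx, hy'⟩).ne' hy
    simp only [ae_iff, not_false_eq_true, Set.ofPred_true] at this
    exact hB.vol_ne_zero this
  · intro x hx y hy t ht
    have ht' : 0 ≤ 1 - t := by linarith [ht.2]
    simp only [Triple.marginal, div_eq_mul_inv]
    -- The normalizing factor is split so that each part joins one of the two factors in Hölder's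
    -- inequality.
    have hb : (B.vol Set.univ)⁻¹ = ((B.vol Set.univ)⁻¹) ^ (1 - t) * ((B.vol Set.univ)⁻¹) ^ t := by
      rw [← ENNReal.rpow_add _ _ (ENNReal.inv_ne_zero.2 hB.vol_ne_top)
        (ENNReal.inv_ne_top.2 hB.vol_ne_zero)]
      simp
    rw [ENNReal.mul_rpow_of_nonneg _ _ ht', ENNReal.mul_rpow_of_nonneg _ _ ht.1]
    nth_rw 1 [hb]
    rw [mul_mul_mul_comm]
    refine mul_le_mul_left ?_ _
    refine le_trans ?_ (ENNReal.lintegral_mul_norm_pow_le (hw.section_aemeasurable hB hx)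
      (hw.section_aemeasurable hB hy) ht' ht.1 (by ring))
    apply lintegral_mono_ae
    filter_upwards [hB.ae_vol_mem] with z hz
    have := hw.logConvex (x, z) ⟨hx, hz⟩ (y, z) ⟨hy, hz⟩ t ht
    rwa [Prod.smul_mk, Prod.smul_mk, Prod.mk_add_mk, ← add_smul, sub_add_cancel, one_smul] at this
  · have h1 := hw.mass
    rw [prod_vol_univ hB, Triple.prod, lintegral_prod _ (hw.aemeasurable_vol (hA.prod hB))] at h1
    simp only [Triple.marginal, div_eq_mul_inv]
    rw [lintegral_mul_const' _ _ (ENNReal.inv_ne_top.2 hB.vol_ne_zero), h1, mul_assoc,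
      ENNReal.mul_inv_cancel hB.vol_ne_zero hB.vol_ne_top, mul_one]

end Prod

/-! ### Transport along linear isomorphisms -/

section Transport

variable {V W : Type*} [NormedAddCommGroup V] [NormedSpace ℝ V] [MeasurableSpace V] [BorelSpace V]
  [NormedAddCommGroup W] [NormedSpace ℝ W] [MeasurableSpace W] [BorelSpace W]
  {A : Triple V} {B : Triple W} {e : V ≃L[ℝ] W} {u : W → ℝ≥0∞} {v : V → ℝ≥0∞}

/-- The linear isomorphism `e` identifies the triples `A` and `B`. -/
structure Iso (A : Triple V) (B : Triple W) (e : V ≃L[ℝ] W) : Prop where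
  body : ∀ x, e x ∈ B.body ↔ x ∈ A.body
  vol : B.vol = A.vol.map e
  bdry : B.bdry = A.bdry.map e

theorem lintegral_map_clequiv (e : V ≃L[ℝ] W) (μ : Measure V) (f : W → ℝ≥0∞) :
    ∫⁻ y, f y ∂(μ.map e) = ∫⁻ x, f (e x) ∂μ :=
  lintegral_map_equiv f e.toHomeomorph.toMeasurableEquiv

theorem map_clequiv_apply (e : V ≃L[ℝ] W) (μ : Measure V) (s : Set W) :
    μ.map e s = μ (e ⁻¹' s) :=
  e.toHomeomorph.toMeasurableEquiv.map_apply s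

namespace Iso

theorem symm (h : Iso A B e) : Iso B A e.symm := by
  refine ⟨fun x => ?_, ?_, ?_⟩
  · rw [← h.body]; simp
  · rw [h.vol]
    exact (e.toHomeomorph.toMeasurableEquiv.map_symm_map (μ := A.vol)).symm
  · rw [h.bdry]
    exact (e.toHomeomorph.toMeasurableEquiv.map_symm_map (μ := A.bdry)).symm

theorem vol_univ (h : Iso A B e) : B.vol Set.univ = A.vol Set.univ := by
  rw [h.vol, map_clequiv_apply, Set.preimage_univ]

theorem en (h : Iso A B e) : B.en u = A.en (u ∘ e) := by
  rw [Triple.en, Triple.en, h.vol_univ, h.bdry, lintegral_map_clequiv]; rfl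

theorem ent (h : Iso A B e) : B.ent u = A.ent (u ∘ e) := by
  rw [Triple.ent, Triple.ent, h.vol_univ, h.vol, lintegral_map_clequiv]; rfl

theorem isState {p : ℝ} (h : Iso A B e) (hu : B.IsState p u) : A.IsState p (u ∘ e) := by
  refine ⟨?_, ?_, ?_, ?_, ?_⟩
  · exact hu.lsc.comp e.continuous.continuousOn fun x hx => (h.body x).2 hx
  · exact fun x hx => hu.pos _ ((h.body x).2 hx)
  · intro x hx y hy t ht
    simpa using hu.logConvex _ ((h.body x).2 hx) _ ((h.body y).2 hy) t ht
  · have := hu.mass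
    rwa [h.vol_univ, h.vol, lintegral_map_clequiv] at this
  · have := hu.lp
    rwa [h.vol, lintegral_map_clequiv] at this

theorem isRegular (h : Iso A B e) (hA : A.IsRegular) : B.IsRegular := by
  have := hA.finite_vol
  have := hA.finite_bdry
  have hc : B.bodyᶜ = e '' A.bodyᶜ := by
    ext y
    obtain ⟨x, rfl⟩ := e.surjective y
    simp [h.body]
  have hb : e ⁻¹' B.bodyᶜ = A.bodyᶜ := by ext x; simp [h.body]
  refine ⟨?_, ?_, ?_, ?_, ?_, ?_⟩
  · have : B.body = e '' A.body := by
      ext y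
      obtain ⟨x, rfl⟩ := e.surjective y
      simp [h.body]
    rw [this]
    exact e.toHomeomorph.isClosedMap _ hA.isClosed
  · rw [h.vol_univ]; exact hA.vol_ne_zero
  · rw [h.vol]; infer_instance
  · rw [h.bdry]; infer_instance
  · rw [h.vol, map_clequiv_apply, hb, hA.vol_compl]
  · rw [h.bdry, map_clequiv_apply, hb, hA.bdry_compl]

end Iso

end Transport

/-! ### Additivity of the energy and subadditivity of the entropy on composites. -/

section Prod

variable {V W : Type*} [NormedAddCommGroup V] [NormedSpace ℝ V] [MeasurableSpace V] [BorelSpace V]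
  [SecondCountableTopology V] [NormedAddCommGroup W] [NormedSpace ℝ W] [MeasurableSpace W]
  [BorelSpace W] [SecondCountableTopology W] {A : Triple V} {B : Triple W} {u : V → ℝ≥0∞}
  {v : W → ℝ≥0∞} {w : V × W → ℝ≥0∞}

theorem iso_swap (hA : A.IsRegular) (hB : B.IsRegular) :
    Iso (A.prod B) (B.prod A) (ContinuousLinearEquiv.prodComm ℝ V W) := by
  have := hA.finite_vol
  have := hB.finite_vol
  have := hA.finite_bdry
  have := hB.finite_bdry
  refine ⟨fun x => And.comm, ?_, ?_⟩
  · exact Measure.prod_swap.symm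
  · have : (⇑(ContinuousLinearEquiv.prodComm ℝ V W) : V × W → W × V) = Prod.swap := rfl
    simp only [Triple.prod]
    rw [this, Measure.map_add _ _ measurable_swap, Measure.prod_swap, Measure.prod_swap, add_comm]

theorem IsState.marginalSnd (hA : A.IsRegular) (hB : B.IsRegular) (hw : (A.prod B).IsState 1 w) :
    B.IsState 1 (A.marginalSnd w) :=
  IsState.marginal hB hA ((iso_swap hA hB).symm.isState hw)

theorem lintegral_mul_fst (hA : A.IsRegular) (hB : B.IsRegular) (hw : (A.prod B).IsState 1 w)
    {g : V → ℝ≥0∞} (hg : AEMeasurable g A.vol) (hg' : ∀ x, g x ≠ ∞) :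
    ∫⁻ z, w z * g z.1 ∂(A.prod B).vol
      = B.vol Set.univ * ∫⁻ x, B.marginal w x * g x ∂A.vol := by
  have := hA.finite_vol
  have := hB.finite_vol
  have h1 : AEMeasurable (fun z : V × W => w z * g z.1) (A.vol.prod B.vol) :=
    (hw.aemeasurable_vol (hA.prod hB)).mul hg.comp_fst
  simp only [Triple.prod]
  rw [lintegral_prod _ h1, ← lintegral_const_mul' _ _ hB.vol_ne_top]
  apply lintegral_congr
  intro x
  rw [lintegral_mul_const' _ _ (hg' x), ← marginal_mul hB]
  ring

theorem lintegral_mul_snd (hA : A.IsRegular) (hB : B.IsRegular) (hw : (A.prod B).IsState 1 w)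
    {g : W → ℝ≥0∞} (hg : AEMeasurable g B.vol) (hg' : ∀ x, g x ≠ ∞) :
    ∫⁻ z, w z * g z.2 ∂(A.prod B).vol
      = A.vol Set.univ * ∫⁻ y, A.marginalSnd w y * g y ∂B.vol := by
  have h := lintegral_mul_fst hB hA ((iso_swap hA hB).symm.isState hw) hg hg'
  rw [(iso_swap hA hB).vol, lintegral_map_clequiv] at h
  exact h

/-- Fubini for each summand of the boundary measure, integrating first over the factor that carries
the volume measure. -/
theorem en_prod (hA : A.IsRegular) (hB : B.IsRegular) (hw : (A.prod B).IsState 1 w) :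
    (A.prod B).en w = A.en (B.marginal w) + B.en (A.marginalSnd w) := by
  have := hA.finite_vol
  have := hB.finite_vol
  have := hA.finite_bdry
  have := hB.finite_bdry
  have hm := hw.aemeasurable_bdry (hA.prod hB)
  have hm' : AEMeasurable w (A.bdry.prod B.vol + A.vol.prod B.bdry) := hm
  obtain ⟨hm1, hm2⟩ := aemeasurable_add_measure_iff.1 hm'
  simp only [en]
  rw [prod_vol_univ hB]
  simp only [Triple.prod]
  rw [lintegral_add_measure, lintegral_prod _ hm1, lintegral_prod_symm _ hm2]
  simp_rw [← marginal_mul hB]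
  have h2 : ∀ y, ∫⁻ x, w (x, y) ∂A.vol = A.marginalSnd w y * A.vol Set.univ :=
    fun y => (marginal_mul (w := w ∘ Prod.swap) hA y).symm
  simp_rw [h2]
  rw [lintegral_mul_const' _ _ hA.vol_ne_top, lintegral_mul_const' _ _ hB.vol_ne_top,
    ENNReal.add_div, ENNReal.mul_div_mul_right _ _ hB.vol_ne_zero hB.vol_ne_top,
    mul_comm (A.vol _), ENNReal.mul_div_mul_right _ _ hA.vol_ne_zero hA.vol_ne_top]

theorem IsState.ae_ne_zero {p : ℝ} (hA : A.IsRegular) (hu : A.IsState p u) :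
    ∀ᵐ x ∂A.vol, u x ≠ 0 := by
  filter_upwards [hA.ae_vol_mem] with x hx using (hu.pos x hx).ne'

theorem ae_prod_fst {P : V → Prop} (hB : B.IsRegular) (h : ∀ᵐ x ∂A.vol, P x) :
    ∀ᵐ z ∂(A.prod B).vol, P z.1 := by
  have := hB.finite_vol
  exact Measure.quasiMeasurePreserving_fst.ae h

theorem ae_prod_snd {P : W → Prop} (hB : B.IsRegular) (h : ∀ᵐ x ∂B.vol, P x) :
    ∀ᵐ z ∂(A.prod B).vol, P z.2 := by
  have := hB.finite_vol
  exact Measure.quasiMeasurePreserving_snd.ae h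

theorem lintegral_marginal_mul_marginal (hA : A.IsRegular) (hB : B.IsRegular) (hu : A.IsState 1 u)
    (hv : B.IsState 1 v) :
    ∫⁻ z, u z.1 * v z.2 ∂(A.prod B).vol = A.vol Set.univ * B.vol Set.univ := by
  have := hB.finite_vol
  simp only [Triple.prod]
  rw [lintegral_prod_mul (hu.aemeasurable_vol hA) (hv.aemeasurable_vol hB), hu.mass, hv.mass]

/-- The two integrated sides of the Gibbs inequality for a state on the composite. -/
theorem lintegral_gibbs (hA : A.IsRegular) (hB : B.IsRegular) (hw : (A.prod B).IsState 1 w) :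
    ∫⁻ z, (1 + w z * ENNReal.ofReal (Real.log (B.marginal w z.1).toReal)
        + w z * ENNReal.ofReal (Real.log (A.marginalSnd w z.2).toReal)) ∂(A.prod B).vol
      = (A.prod B).vol Set.univ
        + B.vol Set.univ * (∫⁻ x, kl (B.marginal w x) ∂A.vol + ∫⁻ x, negLog (B.marginal w x) ∂A.vol)
        + A.vol Set.univ *
          (∫⁻ y, kl (A.marginalSnd w y) ∂B.vol + ∫⁻ y, negLog (A.marginalSnd w y) ∂B.vol)
    ∧ ∫⁻ z, (kl (w z) + B.marginal w z.1 * A.marginalSnd w z.2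
        + w z * ENNReal.ofReal (-Real.log (B.marginal w z.1).toReal)
        + w z * ENNReal.ofReal (-Real.log (A.marginalSnd w z.2).toReal)) ∂(A.prod B).vol
      = ∫⁻ z, kl (w z) ∂(A.prod B).vol + (A.prod B).vol Set.univ
        + B.vol Set.univ * ∫⁻ x, negLog (B.marginal w x) ∂A.vol
        + A.vol Set.univ * ∫⁻ y, negLog (A.marginalSnd w y) ∂B.vol := by
  have := hA.finite_vol
  have := hB.finite_vol
  have h1 := hw.marginal hA hB
  have h2 := hw.marginalSnd hA hB
  have hw' := hw.aemeasurable_vol (hA.prod hB)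
  have m1 := h1.aemeasurable_vol hA
  have m2 := h2.aemeasurable_vol hB
  have m1' : AEMeasurable (fun z : V × W => B.marginal w z.1) (A.prod B).vol := m1.comp_fst
  have m2' : AEMeasurable (fun z : V × W => A.marginalSnd w z.2) (A.prod B).vol := m2.comp_snd
  have e1 : ∫⁻ x, B.marginal w x * ENNReal.ofReal (Real.log (B.marginal w x).toReal) ∂A.vol
      = ∫⁻ x, posLog (B.marginal w x) ∂A.vol := by
    apply lintegral_congr_ae
    filter_upwards [h1.ae_ne_top hA] with x hx using mul_ofReal_log_eq_posLog hx
  have e2 : ∫⁻ x, A.marginalSnd w x * ENNReal.ofReal (Real.log (A.marginalSnd w x).toReal) ∂B.vol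
      = ∫⁻ x, posLog (A.marginalSnd w x) ∂B.vol := by
    apply lintegral_congr_ae
    filter_upwards [h2.ae_ne_top hB] with x hx using mul_ofReal_log_eq_posLog hx
  have e3 : ∫⁻ x, B.marginal w x * ENNReal.ofReal (-Real.log (B.marginal w x).toReal) ∂A.vol
      = ∫⁻ x, negLog (B.marginal w x) ∂A.vol := by
    apply lintegral_congr_ae
    filter_upwards [h1.ae_ne_top hA] with x hx using mul_ofReal_neg_log_eq_negLog hx
  have e4 : ∫⁻ x, A.marginalSnd w x * ENNReal.ofReal (-Real.log (A.marginalSnd w x).toReal) ∂B.vol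
      = ∫⁻ x, negLog (A.marginalSnd w x) ∂B.vol := by
    apply lintegral_congr_ae
    filter_upwards [h2.ae_ne_top hB] with x hx using mul_ofReal_neg_log_eq_negLog hx
  constructor
  · rw [lintegral_add_left' (by fun_prop), lintegral_add_left' (by fun_prop),
      lintegral_mul_fst hA hB hw (g := fun x => ENNReal.ofReal (Real.log (B.marginal w x).toReal))
        (by fun_prop) (by simp),
      lintegral_mul_snd hA hB hw
        (g := fun x => ENNReal.ofReal (Real.log (A.marginalSnd w x).toReal))
        (by fun_prop) (by simp), e1, e2, lintegral_posLog_eq hA m1 h1.mass,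
      lintegral_posLog_eq hB m2 h2.mass, lintegral_one]
  · rw [lintegral_add_left' (by fun_prop), lintegral_add_left' (by fun_prop),
      lintegral_add_left' (by fun_prop),
      lintegral_mul_fst hA hB hw (g := fun x => ENNReal.ofReal (-Real.log (B.marginal w x).toReal))
        (by fun_prop) (by simp),
      lintegral_mul_snd hA hB hw
        (g := fun x => ENNReal.ofReal (-Real.log (A.marginalSnd w x).toReal))
        (by fun_prop) (by simp), e3, e4, lintegral_marginal_mul_marginal hA hB h1 h2,
      prod_vol_univ hB]

theorem ent_add_ent_eq (hA : A.IsRegular) (hB : B.IsRegular) (u : V → ℝ≥0∞) (v : W → ℝ≥0∞) :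
    A.ent u + B.ent v
      = (B.vol Set.univ * ∫⁻ x, kl (u x) ∂A.vol + A.vol Set.univ * ∫⁻ y, kl (v y) ∂B.vol)
        / (A.prod B).vol Set.univ := by
  rw [prod_vol_univ hB, ent, ent, ENNReal.add_div, mul_comm (A.vol _) (B.vol _),
    ENNReal.mul_div_mul_left _ _ hB.vol_ne_zero hB.vol_ne_top, mul_comm (B.vol _) (A.vol _),
    ENNReal.mul_div_mul_left _ _ hA.vol_ne_zero hA.vol_ne_top]

/-- The entropy is subadditive. -/
theorem ent_marginal_add_le (hA : A.IsRegular) (hB : B.IsRegular)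
    (hw : (A.prod B).IsState 1 w) :
    A.ent (B.marginal w) + B.ent (A.marginalSnd w) ≤ (A.prod B).ent w := by
  have hle := lintegral_mono_ae (μ := (A.prod B).vol) (f := fun z =>
      1 + w z * ENNReal.ofReal (Real.log (B.marginal w z.1).toReal)
        + w z * ENNReal.ofReal (Real.log (A.marginalSnd w z.2).toReal))
      (g := fun z => kl (w z) + B.marginal w z.1 * A.marginalSnd w z.2
        + w z * ENNReal.ofReal (-Real.log (B.marginal w z.1).toReal)
        + w z * ENNReal.ofReal (-Real.log (A.marginalSnd w z.2).toReal)) (by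
    filter_upwards [hw.ae_ne_top (hA.prod hB),
      ae_prod_fst hB ((hw.marginal hA hB).ae_ne_top hA),
      ae_prod_snd hB ((hw.marginalSnd hA hB).ae_ne_top hB),
      ae_prod_fst hB ((hw.marginal hA hB).ae_ne_zero hA),
      ae_prod_snd hB ((hw.marginalSnd hA hB).ae_ne_zero hB)] with z h1 h2 h3 h4 h5
      using gibbs_le h1 h2 h3 h4 h5)
  obtain ⟨e1, e2⟩ := lintegral_gibbs hA hB hw
  rw [e1, e2] at hle
  rw [ent_add_ent_eq hA hB]
  refine ENNReal.div_le_div_right ?_ _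
  have n1 := lintegral_negLog_ne_top hA (B.marginal w)
  have n2 := lintegral_negLog_ne_top hB (A.marginalSnd w)
  have n3 := (hA.prod hB).vol_ne_top
  have n4 := hA.vol_ne_top
  have n5 := hB.vol_ne_top
  -- The integrated negative parts stand on both sides; they are finite because `x log x` is bounded
  -- below, so they cancel.
  have hc : (A.prod B).vol Set.univ + B.vol Set.univ * ∫⁻ x, negLog (B.marginal w x) ∂A.vol
      + A.vol Set.univ * ∫⁻ y, negLog (A.marginalSnd w y) ∂B.vol ≠ ∞ := by finiteness
  refine (ENNReal.add_le_add_iff_right hc).1 ?_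
  refine le_trans (le_of_eq ?_) (hle.trans (le_of_eq ?_)) <;> ring

theorem marginal_prodState (hB : B.IsRegular) (hv : B.IsState 1 v) :
    B.marginal (prodState u v) = u := by
  ext x
  simp only [marginal, prodState]
  rw [lintegral_const_mul'' _ (hv.aemeasurable_vol hB), hv.mass,
    ENNReal.mul_div_cancel_right hB.vol_ne_zero hB.vol_ne_top]

theorem marginalSnd_prodState (hA : A.IsRegular) (hu : A.IsState 1 u) :
    A.marginalSnd (prodState u v) = v := by
  have h : A.marginal (prodState v u) = v := marginal_prodState hA hu
  rw [marginalSnd, ← h]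
  congr 1
  ext x
  simp [prodState, mul_comm, h]

theorem IsState.prodState (hA : A.IsRegular) (hB : B.IsRegular) (hu : A.IsState 1 u)
    (hv : B.IsState 1 v) : (A.prod B).IsState 1 (prodState u v) := by
  refine IsState.mk' (hA.prod hB) ?_ ?_ ?_ ?_
  · exact LowerSemicontinuousOn.mul_ennreal
      (hu.lsc.comp continuousOn_fst fun z hz => hz.1) (hv.lsc.comp continuousOn_snd fun z hz => hz.2)
  · exact fun z hz => ENNReal.mul_pos (hu.pos _ hz.1).ne' (hv.pos _ hz.2).ne'
  · intro x hx y hy t ht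
    simp only [NAHam.prodState]
    rw [ENNReal.mul_rpow_of_nonneg _ _ (by linarith [ht.2]), ENNReal.mul_rpow_of_nonneg _ _ ht.1,
      mul_mul_mul_comm]
    exact mul_le_mul' (hu.logConvex _ hx.1 _ hy.1 t ht) (hv.logConvex _ hx.2 _ hy.2 t ht)
  · rw [prod_vol_univ hB]
    exact lintegral_marginal_mul_marginal hA hB hu hv

theorem en_prodState (hA : A.IsRegular) (hB : B.IsRegular) (hu : A.IsState 1 u)
    (hv : B.IsState 1 v) : (A.prod B).en (prodState u v) = A.en u + B.en v := by
  rw [en_prod hA hB (hu.prodState hA hB hv), marginal_prodState hB hv, marginalSnd_prodState hA hu]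

theorem ent_prodState (hA : A.IsRegular) (hB : B.IsRegular) (hu : A.IsState 1 u)
    (hv : B.IsState 1 v) : (A.prod B).ent (prodState u v) = A.ent u + B.ent v := by
  have hw := hu.prodState hA hB hv
  obtain ⟨e1, e2⟩ := lintegral_gibbs hA hB hw
  rw [marginal_prodState hB hv, marginalSnd_prodState hA hu] at e1 e2
  have heq : ∫⁻ z, (1 + NAHam.prodState u v z * ENNReal.ofReal (Real.log (u z.1).toReal)
        + NAHam.prodState u v z * ENNReal.ofReal (Real.log (v z.2).toReal)) ∂(A.prod B).vol
      = ∫⁻ z, (kl (NAHam.prodState u v z) + u z.1 * v z.2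
        + NAHam.prodState u v z * ENNReal.ofReal (-Real.log (u z.1).toReal)
        + NAHam.prodState u v z * ENNReal.ofReal (-Real.log (v z.2).toReal)) ∂(A.prod B).vol := by
    apply lintegral_congr_ae
    filter_upwards [ae_prod_fst hB (hu.ae_ne_top hA), ae_prod_snd hB (hv.ae_ne_top hB),
      ae_prod_fst hB (hu.ae_ne_zero hA), ae_prod_snd hB (hv.ae_ne_zero hB)] with z h2 h3 h4 h5
      using gibbs_eq h2 h3 h4 h5
  rw [e1, e2] at heq
  rw [ent_add_ent_eq hA hB, ent]
  congr 1
  have n1 := lintegral_negLog_ne_top hA u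
  have n2 := lintegral_negLog_ne_top hB v
  have n3 := (hA.prod hB).vol_ne_top
  have n4 := hA.vol_ne_top
  have n5 := hB.vol_ne_top
  have hc : (A.prod B).vol Set.univ + B.vol Set.univ * ∫⁻ x, negLog (u x) ∂A.vol
      + A.vol Set.univ * ∫⁻ y, negLog (v y) ∂B.vol ≠ ∞ := by finiteness
  refine (ENNReal.add_left_inj hc).1 ?_
  refine Eq.trans ?_ (heq.symm.trans ?_) <;> ring

end Prod

/-! ### Powers -/

section Pow

variable {W : Type*} [NormedAddCommGroup W] [NormedSpace ℝ W] [MeasurableSpace W]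
  [BorelSpace W] [SecondCountableTopology W] {R : Triple W} {v : W → ℝ≥0∞}

theorem map_cons_pi {N : ℕ} (μ : Fin (N + 1) → Measure W) [∀ i, SigmaFinite (μ i)] :
    ((μ 0).prod (Measure.pi fun i => μ i.succ)).map (Fin.consEquivL ℝ fun _ : Fin (N + 1) => W)
      = Measure.pi μ := by
  have h := (measurePreserving_piFinSuccAbove μ 0).symm.map_eq
  simp only [Fin.zero_succAbove] at h
  rw [← h]
  congr 1
  ext z i
  refine Fin.cases ?_ (fun j => ?_) i <;>
  simp [MeasurableEquiv.piFinSuccAbove, Fin.insertNthEquiv]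

/-- Splits off the first copy, the basis of all inductions on the number of copies. The boundary
term of index `0` is the boundary of the first factor; those of successor index form the boundary of
the remaining power. -/
theorem iso_pow_succ (hR : R.IsRegular) (N : ℕ) :
    Iso (R.prod (R.pow N)) (R.pow (N + 1)) (Fin.consEquivL ℝ fun _ : Fin (N + 1) => W) := by
  have := hR.finite_vol
  have := hR.finite_bdry
  refine ⟨fun x => ?_, ?_, ?_⟩
  · simp [Triple.pow, Triple.prod, Fin.forall_fin_succ, Set.mem_pi]
  · exact (map_cons_pi fun _ => R.vol).symm
  · have hm : Measurable (Fin.consEquivL ℝ fun _ : Fin (N + 1) => W) :=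
      (Fin.consEquivL ℝ fun _ : Fin (N + 1) => W).continuous.measurable
    have hfin : ∀ (M : ℕ) (i j : Fin M),
        IsFiniteMeasure (Function.update (fun _ => R.vol) i R.bdry j) := by
      intro M i j
      by_cases h : j = i
      · subst h; simpa
      · simpa [Function.update_of_ne h]
    have h0 := fun i : Fin (N + 1) =>
      have := hfin (N + 1) i
      map_cons_pi (Function.update (fun _ => R.vol) i R.bdry)
    simp only [Triple.pow, Triple.prod]
    rw [Fin.sum_univ_succ, Measure.map_add _ _ hm, ← h0 0]
    simp_rw [← h0 (Fin.succ _)]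
    have hs : R.vol.prod (∑ i : Fin N, Measure.pi (Function.update (fun _ => R.vol) i R.bdry))
        = ∑ i : Fin N, R.vol.prod (Measure.pi (Function.update (fun _ => R.vol) i R.bdry)) := by
      have := hfin N
      rw [← Measure.sum_fintype, ← Measure.sum_fintype, Measure.prod_sum_right]
    rw [hs, Measure.map_finset_sum' hm.aemeasurable]
    congr 1
    refine Finset.sum_congr rfl fun i _ => ?_
    congr 2
    · congr 1
      ext1 j
      by_cases h : j = i
      · subst h; simp
      · rw [Function.update_of_ne h, Function.update_of_ne (by simpa using h)]

theorem IsRegular.pow (hR : R.IsRegular) (N : ℕ) : (R.pow N).IsRegular := by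
  induction N with
  | zero =>
    refine ⟨?_, ?_, ?_, ?_, ?_, ?_⟩ <;> simp only [Triple.pow]
    · simp
    · simp
    · rw [Measure.pi_of_empty]; infer_instance
    · rw [Fin.sum_univ_zero]; infer_instance
    · have h : (Set.univ.pi fun _ : Fin 0 => R.body) = Set.univ := by ext x; simp [Set.mem_pi]
      rw [h, Set.compl_univ, measure_empty]
    · simp
  | succ N ih => exact (iso_pow_succ hR N).isRegular (hR.prod ih)

/-- A state has a power whose energy and entropy are multiples. -/
theorem IsState.exists_pow (hR : R.IsRegular) (hv : R.IsState 1 v) (N : ℕ) :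
    ∃ w, (R.pow N).IsState 1 w ∧ (R.pow N).en w = N * R.en v ∧ (R.pow N).ent w = N * R.ent v := by
  induction N with
  | zero =>
    refine ⟨fun _ => 1, IsState.one (hR.pow 0), ?_, ?_⟩
    · simp [en, Triple.pow]
    · simp [ent_one]
  | succ N ih =>
    obtain ⟨w, hw, h1, h2⟩ := ih
    have hp := hv.prodState hR (hR.pow N) hw
    have hi := (iso_pow_succ hR N).symm
    refine ⟨_, hi.isState hp, ?_, ?_⟩
    · rw [← hi.en, en_prodState hR (hR.pow N) hv hw, h1]
      push_cast
      ring
    · rw [← hi.ent, ent_prodState hR (hR.pow N) hv hw, h2]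
      push_cast
      ring

/-- A state on a power can be replaced by a power without changing the energy or decreasing the
entropy. -/
theorem IsState.exists_of_pow (hR : R.IsRegular) (N : ℕ) {w : (Fin N → W) → ℝ≥0∞}
    (hw : (R.pow N).IsState 1 w) :
    ∃ v, R.IsState 1 v ∧ (R.pow N).en w = N * R.en v ∧ N * R.ent v ≤ (R.pow N).ent w := by
  induction N with
  | zero =>
    refine ⟨fun _ => 1, IsState.one hR, ?_, ?_⟩
    · simp [en, Triple.pow]
    · simp
  | succ N ih =>
    have hi := iso_pow_succ hR N
    have hw' := hi.isState hw
    have hRN := hR.pow N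
    obtain ⟨v, hv, h1, h2⟩ := ih (hw'.marginalSnd hR hRN)
    have hm := hw'.marginal hR hRN
    have hN : (0 : ℝ) < N + 1 := by positivity
    have ht : (N : ℝ) / (N + 1) ∈ Set.Icc (0 : ℝ) 1 :=
      ⟨by positivity, by rw [div_le_one hN]; linarith⟩
    have c1 : ((N + 1 : ℕ) : ℝ≥0∞) * ENNReal.ofReal (1 - N / (N + 1)) = 1 := by
      rw [← ENNReal.ofReal_natCast, ← ENNReal.ofReal_mul (by positivity)]
      push_cast
      rw [← ENNReal.ofReal_one]
      congr 1
      field_simp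
      ring
    have c2 : ((N + 1 : ℕ) : ℝ≥0∞) * ENNReal.ofReal (N / (N + 1)) = N := by
      rw [← ENNReal.ofReal_natCast, ← ENNReal.ofReal_mul (by positivity), ← ENNReal.ofReal_natCast N]
      push_cast
      congr 1
      field_simp
    -- The state `v` already stands for an average over `N` copies, so the new marginal enters with
    -- weight `1 / (N + 1)`; multiplying by `N + 1` restores the coefficients `1` and `N`.
    refine ⟨NAHam.mix (N / (N + 1)) _ v, hm.mix ht hR hv, ?_, ?_⟩
    · rw [hi.en, en_prod hR hRN hw', h1, en_mix hR hm hv, mul_add, ← mul_assoc, ← mul_assoc, c1, c2,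
        one_mul]
    · refine (mul_le_mul_right (ent_mix_le ht hR hm hv) _).trans ?_
      rw [mul_add, ← mul_assoc, ← mul_assoc, c1, c2, one_mul, hi.ent]
      exact (add_le_add_right h2 _).trans (ent_marginal_add_le hR hRN hw')

end Pow

end Triple

/-! ### Polytopes -/

section Polytope

variable {V : Type*} [NormedAddCommGroup V] [NormedSpace ℝ V]

theorem affine_apply_add (ℓ : V →ᵃ[ℝ] ℝ) (x w : V) : ℓ (x + w) = ℓ x + ℓ.linear w := by
  rw [add_comm, ← vadd_eq_add, ℓ.map_vadd, vadd_eq_add, add_comm]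

theorem affine_apply_add_smul (ℓ : V →ᵃ[ℝ] ℝ) (x w : V) (t : ℝ) :
    ℓ (x + t • w) = ℓ x + t * ℓ.linear w := by
  rw [affine_apply_add, map_smul, smul_eq_mul]

variable [FiniteDimensional ℝ V] {P : Set V} {s : Finset (V →ᵃ[ℝ] ℝ)}

theorem affine_continuous (ℓ : V →ᵃ[ℝ] ℝ) : Continuous ℓ := ℓ.continuous_of_finiteDimensional

theorem mem_interior_of_pos (hP : P = {x | ∀ ℓ ∈ s, 0 ≤ ℓ x}) {x : V} (hx : ∀ ℓ ∈ s, 0 < ℓ x) :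
    x ∈ interior P := by
  rw [mem_interior_iff_mem_nhds]
  have : ∀ᶠ y in 𝓝 x, ∀ ℓ ∈ s, 0 < ℓ y :=
    (Finset.eventually_all s).2 fun ℓ hℓ =>
      (affine_continuous ℓ).continuousAt.eventually (lt_mem_nhds (hx ℓ hℓ))
  filter_upwards [this] with y hy
  rw [hP]
  exact fun ℓ hℓ => (hy ℓ hℓ).le

/-- If `ℓ` vanished at an interior point, its linear part would be nonnegative in every direction
and in the opposite one, hence zero. -/
theorem pos_of_mem_interior {ℓ : V →ᵃ[ℝ] ℝ} (hℓ : ℓ.linear ≠ 0) (hP : ∀ x ∈ P, 0 ≤ ℓ x) {x : V}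
    (hx : x ∈ interior P) : 0 < ℓ x := by
  refine (hP x (interior_subset hx)).lt_of_ne' fun h0 => hℓ ?_
  ext w
  have key : ∀ w : V, 0 ≤ ℓ.linear w := by
    intro w
    have hc : Tendsto (fun t : ℝ => x + t • w) (𝓝[>] 0) (𝓝 x) := by
      have : Continuous fun t : ℝ => x + t • w := by fun_prop
      simpa using (this.tendsto 0).mono_left (nhdsWithin_le_nhds (s := Set.Ioi 0))
    obtain ⟨t, ht, ht'⟩ := ((hc.eventually (mem_interior_iff_mem_nhds.1 hx)).and
      self_mem_nhdsWithin).exists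
    have := hP _ ht
    rw [affine_apply_add_smul, h0, zero_add] at this
    exact nonneg_of_mul_nonneg_right this ht'
  have h1 := key w
  have h2 := key (-w)
  rw [map_neg] at h2
  simpa using le_antisymm (by linarith) h1

/-- A line through a point of a compact polytope leaves it through a face that it crosses. -/
theorem exists_exit (hc : IsCompact P) (hP : P = {x | ∀ ℓ ∈ s, 0 ≤ ℓ x}) {x w : V} (hx : x ∈ P)
    (hw : w ≠ 0) :
    ∃ t : ℝ, 0 ≤ t ∧ x + t • w ∈ P ∧ ∃ ℓ ∈ s, ℓ (x + t • w) = 0 ∧ ℓ.linear w < 0 := by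
  set T : Set ℝ := {t | 0 ≤ t ∧ x + t • w ∈ P} with hT
  have hcont : Continuous fun t : ℝ => x + t • w := by fun_prop
  have hclosed : IsClosed T :=
    (isClosed_le continuous_const continuous_id).inter (hc.isClosed.preimage hcont)
  have hne : T.Nonempty := ⟨0, le_rfl, by simpa using hx⟩
  have hbdd : BddAbove T := by
    obtain ⟨M, hM⟩ := hc.isBounded.exists_norm_le
    refine ⟨(M + ‖x‖) / ‖w‖, fun t ht => ?_⟩
    rw [le_div_iff₀ (norm_pos_iff.2 hw)]
    calc t * ‖w‖ = ‖(x + t • w) - x‖ := by rw [add_sub_cancel_left, norm_smul, Real.norm_of_nonneg ht.1]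
      _ ≤ ‖x + t • w‖ + ‖x‖ := norm_sub_le _ _
      _ ≤ M + ‖x‖ := by gcongr; exact hM _ ht.2
  have hmem := hclosed.csSup_mem hne hbdd
  set t := sSup T
  refine ⟨t, hmem.1, hmem.2, ?_⟩
  -- If no constraint active at the last point decreased along `w`, all constraints would survive a
  -- little further, against the maximality of `t`.
  by_contra! hcon
  have hev : ∀ᶠ r in 𝓝[>] t, ∀ ℓ ∈ s, 0 ≤ ℓ (x + r • w) := by
    refine (Finset.eventually_all s).2 fun ℓ hℓ => ?_
    have hge : 0 ≤ ℓ (x + t • w) := by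
      have := hmem.2
      rw [hP] at this
      exact this ℓ hℓ
    rcases hge.eq_or_lt with h0 | hpos
    · filter_upwards [self_mem_nhdsWithin] with r hr
      have h1 := hcon ℓ hℓ h0.symm
      have h2 := mul_le_mul_of_nonneg_right (le_of_lt hr) h1
      rw [affine_apply_add_smul] at h0 ⊢
      linarith
    · have h1 : Continuous fun r : ℝ => ℓ (x + r • w) := (affine_continuous ℓ).comp hcont
      filter_upwards [h1.continuousWithinAt.eventually (lt_mem_nhds hpos)] with r hr using hr.le
  obtain ⟨r, hr, hr'⟩ := (hev.and self_mem_nhdsWithin).exists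
  have : r ∈ T := ⟨hmem.1.trans (le_of_lt hr'), by rw [hP]; exact hr⟩
  exact absurd (le_csSup hbdd this) (not_le.2 hr')

/-- A convex function on a compact polytope is bounded above. -/
theorem exists_forall_le_of_convexOn (hc : IsCompact P) (hP : P = {x | ∀ ℓ ∈ s, 0 ≤ ℓ x})
    {q : V → ℝ} (hq : ConvexOn ℝ P q) : ∃ M, ∀ x ∈ P, q x ≤ M := by
  classical
  -- Induction over faces: `a` is the set of active constraints, and `k` bounds the number of the
  -- others. A point of a face that can move in some direction lies on a segment of the face whose
  -- ends satisfy one more constraint with equality, and there the induction hypothesis applies.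
  have hmain : ∀ k : ℕ, ∀ a : Finset (V →ᵃ[ℝ] ℝ), a ⊆ s → s.card ≤ a.card + k →
      ∃ M, ∀ x ∈ P, (∀ ℓ ∈ a, ℓ x = 0) → q x ≤ M := by
    intro k
    induction k with
    | zero =>
      -- a common zero of all functions is unique, by compactness
      intro a has hk
      obtain rfl : a = s := Finset.eq_of_subset_of_card_le has (by simpa using hk)
      by_cases hex : ∃ x₀ ∈ P, ∀ ℓ ∈ a, ℓ x₀ = 0
      · obtain ⟨x₀, hx₀, hx₀'⟩ := hex
        refine ⟨q x₀, fun x hx hx' => le_of_eq ?_⟩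
        by_contra hne
        have hw : x - x₀ ≠ 0 := fun h => hne (by rw [sub_eq_zero.1 h])
        obtain ⟨t, -, -, ℓ, hℓ, -, hneg⟩ := exists_exit hc hP hx₀ hw
        have h1 := affine_apply_add ℓ x₀ (x - x₀)
        rw [add_sub_cancel, hx' ℓ hℓ, hx₀' ℓ hℓ] at h1
        linarith
      · push Not at hex
        exact ⟨0, fun x hx hx' => by
          obtain ⟨ℓ, hℓ, h⟩ := hex x hx
          exact absurd (hx' ℓ hℓ) h⟩
    | succ k ih =>
      intro a has hk
      by_cases hex : ∃ w : V, w ≠ 0 ∧ ∀ ℓ ∈ a, ℓ.linear w = 0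
      · obtain ⟨w, hw, hw'⟩ := hex
        have hMall : ∀ ℓ : s, ∃ M, ∀ x ∈ P, (∀ ℓ' ∈ a, ℓ' x = 0) → (ℓ : V →ᵃ[ℝ] ℝ) x = 0 →
            ℓ.1 ∉ a → q x ≤ M := by
          intro ℓ
          by_cases hℓa : ℓ.1 ∈ a
          · exact ⟨0, fun x _ _ _ h => absurd hℓa h⟩
          · obtain ⟨M, hM⟩ := ih (insert ℓ.1 a) (Finset.insert_subset ℓ.2 has) (by
              rw [Finset.card_insert_of_notMem hℓa]; omega)
            exact ⟨M, fun x hx h1 h2 _ => hM x hx fun ℓ' hℓ' => by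
              rcases Finset.mem_insert.1 hℓ' with rfl | h
              · exact h2
              · exact h1 _ h⟩
        choose M hM using hMall
        refine ⟨∑ ℓ : s, |M ℓ|, fun x hx hx' => ?_⟩
        have hend : ∀ w' : V, w' ≠ 0 → (∀ ℓ ∈ a, ℓ.linear w' = 0) →
            ∃ t : ℝ, 0 ≤ t ∧ x + t • w' ∈ P ∧ q (x + t • w') ≤ ∑ ℓ : s, |M ℓ| := by
          intro w' hw0 hwa
          obtain ⟨t, ht, htP, ℓ, hℓ, hℓ0, hneg⟩ := exists_exit hc hP hx hw0
          have hna : ℓ ∉ a := fun h => by rw [hwa ℓ h] at hneg; exact lt_irrefl _ hneg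
          refine ⟨t, ht, htP, (hM ⟨ℓ, hℓ⟩ _ htP (fun ℓ' hℓ' => ?_) hℓ0 hna).trans
            ((le_abs_self _).trans ?_)⟩
          · rw [affine_apply_add_smul, hwa ℓ' hℓ', hx' ℓ' hℓ']; simp
          · exact Finset.single_le_sum (f := fun ℓ : s => |M ℓ|) (fun _ _ => abs_nonneg _)
              (Finset.mem_univ _)
        obtain ⟨t₁, ht₁, hP₁, hq₁⟩ := hend w hw hw'
        obtain ⟨t₂, ht₂, hP₂, hq₂⟩ := hend (-w) (neg_ne_zero.2 hw) fun ℓ hℓ => by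
          rw [map_neg, hw' ℓ hℓ, neg_zero]
        rcases (add_nonneg ht₁ ht₂).eq_or_lt with h0 | hpos
        · obtain rfl : t₁ = 0 := by linarith
          simpa using hq₁
        · have hseg : (t₂ / (t₁ + t₂)) • (x + t₁ • w) + (t₁ / (t₁ + t₂)) • (x + t₂ • -w) = x := by
            rw [smul_add, smul_add, smul_smul, smul_neg, smul_neg, smul_smul, add_add_add_comm,
              ← add_smul, ← add_div, add_comm t₂ t₁, div_self hpos.ne', one_smul,
              show t₂ / (t₁ + t₂) * t₁ = t₁ / (t₁ + t₂) * t₂ by ring, add_neg_cancel, add_zero]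
          have h := hq.2 hP₁ hP₂ (div_nonneg ht₂ hpos.le) (div_nonneg ht₁ hpos.le)
            (by rw [← add_div, add_comm, div_self hpos.ne'])
          rw [hseg] at h
          refine h.trans (?_ : _ ≤ ∑ ℓ : s, |M ℓ|)
          have e : t₂ / (t₁ + t₂) + t₁ / (t₁ + t₂) = 1 := by
            rw [← add_div, add_comm, div_self hpos.ne']
          calc _ ≤ (t₂ / (t₁ + t₂)) * ∑ ℓ : s, |M ℓ| + (t₁ / (t₁ + t₂)) * ∑ ℓ : s, |M ℓ| := by
                simp only [smul_eq_mul]; gcongr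
            _ = _ := by rw [← add_mul, e, one_mul]
      · -- the zero set has at most one point
        push Not at hex
        by_cases hex' : ∃ x₀ ∈ P, ∀ ℓ ∈ a, ℓ x₀ = 0
        · obtain ⟨x₀, hx₀, hx₀'⟩ := hex'
          refine ⟨q x₀, fun x hx hx' => le_of_eq ?_⟩
          by_contra hne
          have hw : x - x₀ ≠ 0 := fun h => hne (by rw [sub_eq_zero.1 h])
          obtain ⟨ℓ, hℓ, h⟩ := hex _ hw
          have h1 := affine_apply_add ℓ x₀ (x - x₀)
          rw [add_sub_cancel, hx' ℓ hℓ, hx₀' ℓ hℓ] at h1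
          exact h (by linarith)
        · push Not at hex'
          exact ⟨0, fun x hx hx' => by
            obtain ⟨ℓ, hℓ, h⟩ := hex' x hx
            exact absurd (hx' ℓ hℓ) h⟩
  obtain ⟨M, hM⟩ := hmain s.card ∅ (by simp) (by simp)
  exact ⟨M, fun x hx => hM x hx (by simp)⟩

/-- The direction of the affine span of an irredundant face. -/
theorem direction_affineSpan_face {ℓ : V →ᵃ[ℝ] ℝ} (hP : P = {x | ∀ ℓ ∈ s, 0 ≤ ℓ x}) {w : V}
    (hw : ℓ w = 0) (hw' : ∀ ℓ' ∈ s, ℓ' ≠ ℓ → 0 < ℓ' w) :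
    (affineSpan ℝ {x ∈ P | ℓ x = 0}).direction = LinearMap.ker ℓ.linear := by
  have hwF : w ∈ {x ∈ P | ℓ x = 0} := by
    refine ⟨?_, hw⟩
    rw [hP]
    intro ℓ' hℓ'
    rcases eq_or_ne ℓ' ℓ with rfl | h
    · exact hw.ge
    · exact (hw' ℓ' hℓ' h).le
  rw [direction_affineSpan]
  apply le_antisymm
  · rw [vectorSpan_def, Submodule.span_le]
    rintro _ ⟨x, hx, y, hy, rfl⟩
    have h1 := affine_apply_add ℓ y (x - y)
    rw [add_sub_cancel, hx.2, hy.2] at h1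
    simp only [vsub_eq_sub, SetLike.mem_coe, LinearMap.mem_ker]
    linarith
  -- All constraints other than `ℓ` are strict at `w`, so a small step from `w` along the kernel of
  -- `ℓ.linear` stays in the face.
  · intro k hk
    rw [LinearMap.mem_ker] at hk
    have hev : ∀ᶠ r : ℝ in 𝓝[>] 0, ∀ ℓ' ∈ s, 0 ≤ ℓ' (w + r • k) := by
      refine (Finset.eventually_all s).2 fun ℓ' hℓ' => ?_
      rcases eq_or_ne ℓ' ℓ with rfl | h
      · exact Eventually.of_forall fun r => by rw [affine_apply_add_smul, hw, hk]; simp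
      · have h1 : Continuous fun r : ℝ => ℓ' (w + r • k) :=
          (affine_continuous ℓ').comp (by fun_prop)
        have h2 : 0 < ℓ' (w + (0 : ℝ) • k) := by simpa using hw' ℓ' hℓ' h
        filter_upwards [h1.continuousWithinAt.eventually (lt_mem_nhds h2)] with r hr using hr.le
    obtain ⟨r, hr, hr'⟩ := (hev.and self_mem_nhdsWithin).exists
    have hrF : w + r • k ∈ {x ∈ P | ℓ x = 0} :=
      ⟨by rw [hP]; exact hr, by rw [affine_apply_add_smul, hw, hk]; simp⟩
    have h := vsub_mem_vectorSpan ℝ hrF hwF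
    rw [vsub_eq_sub, add_sub_cancel_left] at h
    have h2 := Submodule.smul_mem _ r⁻¹ h
    rwa [smul_smul, inv_mul_cancel₀ (ne_of_gt hr'), one_smul] at h2

/-- A polytope is cut out by its facets. -/
theorem IsPolytope.exists_facets (h : IsPolytope P) :
    ∃ s : Finset (V →ᵃ[ℝ] ℝ), P = {x | ∀ ℓ ∈ s, 0 ≤ ℓ x} ∧
      ∀ ℓ ∈ s, ℓ.linear ≠ 0 ∧ IsFacet P {x ∈ P | ℓ x = 0} ∧
        (affineSpan ℝ {x ∈ P | ℓ x = 0}).direction = LinearMap.ker ℓ.linear := by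
  classical
  obtain ⟨hc, hint, hs⟩ := h
  -- A description by the least number of half spaces is irredundant, so each of its constraints
  -- cuts out a facet.
  let S : Set ℕ := {n | ∃ s : Finset (V →ᵃ[ℝ] ℝ), s.card = n ∧ (∀ ℓ ∈ s, ℓ.linear ≠ 0) ∧
    P = {x | ∀ ℓ ∈ s, 0 ≤ ℓ x}}
  have hS : S.Nonempty := by
    obtain ⟨s, hs⟩ := hs
    exact ⟨_, s, rfl, hs⟩
  obtain ⟨s, hcard, hlin, hP⟩ := Nat.sInf_mem hS
  refine ⟨s, hP, fun ℓ hℓ => ?_⟩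
  have hnn : ∀ x ∈ P, 0 ≤ ℓ x := fun x hx => by rw [hP] at hx; exact hx ℓ hℓ
  -- By minimality, dropping `ℓ` enlarges the set; `y` violates only `ℓ`.
  obtain ⟨y, hy, hyneg⟩ : ∃ y, (∀ ℓ' ∈ s.erase ℓ, 0 ≤ ℓ' y) ∧ ℓ y < 0 := by
    by_contra! hcon
    have hmem : (s.erase ℓ).card ∈ S := by
      refine ⟨_, rfl, fun ℓ' hℓ' => hlin ℓ' (Finset.mem_of_mem_erase hℓ'), ?_⟩
      rw [hP]
      ext x
      refine ⟨fun hx ℓ' hℓ' => hx ℓ' (Finset.mem_of_mem_erase hℓ'), fun hx ℓ' hℓ' => ?_⟩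
      rcases eq_or_ne ℓ' ℓ with rfl | hne
      · exact hcon x hx
      · exact hx ℓ' (Finset.mem_erase.2 ⟨hne, hℓ'⟩)
    have h1 := Nat.sInf_le hmem
    rw [← hcard] at h1
    exact absurd (Finset.card_erase_lt_of_mem hℓ) (not_lt.2 h1)
  obtain ⟨z, hz⟩ := hint
  have hzpos : ∀ ℓ' ∈ s, 0 < ℓ' z := fun ℓ' hℓ' =>
    pos_of_mem_interior (hlin ℓ' hℓ') (fun x hx => by rw [hP] at hx; exact hx ℓ' hℓ') hz
  have hzℓ := hzpos ℓ hℓ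
  have hd : 0 < ℓ z - ℓ y := by linarith
  -- The parameter at which the segment from the interior point `z` to `y` crosses `ℓ = 0`. All
  -- other constraints are still strict there.
  set θ := ℓ z / (ℓ z - ℓ y) with hθ
  have hθ1 : θ < 1 := by rw [hθ, div_lt_one hd]; linarith
  have hθ0 : 0 ≤ θ := by positivity
  have hval : ∀ ℓ' : V →ᵃ[ℝ] ℝ, ℓ' (z + θ • (y - z)) = (1 - θ) * ℓ' z + θ * ℓ' y := by
    intro ℓ'
    have h1 := affine_apply_add ℓ' z (y - z)
    rw [add_sub_cancel] at h1
    rw [affine_apply_add_smul, h1]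
    ring
  have hw : ℓ (z + θ • (y - z)) = 0 := by
    rw [hval, hθ]
    field_simp
    ring
  have hw' : ∀ ℓ' ∈ s, ℓ' ≠ ℓ → 0 < ℓ' (z + θ • (y - z)) := by
    intro ℓ' hℓ' hne
    rw [hval]
    have h1 := mul_pos (sub_pos.2 hθ1) (hzpos ℓ' hℓ')
    have h2 := mul_nonneg hθ0 (hy ℓ' (Finset.mem_erase.2 ⟨hne, hℓ'⟩))
    linarith
  have hdir := direction_affineSpan_face hP hw hw'
  refine ⟨hlin ℓ hℓ, ⟨⟨ℓ, hlin ℓ hℓ, hnn, rfl⟩, ⟨z + θ • (y - z), ?_, hw⟩, ?_⟩, hdir⟩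
  · rw [hP]
    intro ℓ' hℓ'
    rcases eq_or_ne ℓ' ℓ with rfl | hne
    · exact hw.ge
    · exact (hw' ℓ' hℓ' hne).le
  · rw [hdir]
    exact Module.Dual.finrank_ker_add_one_of_ne_zero (hlin ℓ hℓ)

theorem frontier_subset_iUnion (hc : IsClosed P) (hP : P = {x | ∀ ℓ ∈ s, 0 ≤ ℓ x}) :
    frontier P ⊆ ⋃ ℓ ∈ s, {x ∈ P | ℓ x = 0} := by
  intro x hx
  have hxP : x ∈ P := hc.frontier_subset hx
  simp only [Set.mem_iUnion]
  by_contra! hcon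
  refine hx.2 (mem_interior_of_pos hP fun ℓ hℓ => ?_)
  have h0 : 0 ≤ ℓ x := by
    have := hxP
    rw [hP] at this
    exact this ℓ hℓ
  exact h0.lt_of_ne' fun h => hcon ℓ hℓ ⟨hxP, h⟩

theorem IsPolytope.convex (h : IsPolytope P) : Convex ℝ P := by
  obtain ⟨-, -, s, -, rfl⟩ := h
  intro x hx y hy a b ha hb hab ℓ hℓ
  have h1 : ℓ (a • x + b • y) = a * ℓ x + b * ℓ y := by
    have h2 := affine_apply_add ℓ x (y - x)
    rw [add_sub_cancel] at h2
    obtain rfl : a = 1 - b := by linarith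
    rw [show (1 - b) • x + b • y = x + b • (y - x) by rw [sub_smul, smul_sub, one_smul]; abel,
      affine_apply_add_smul, h2]
    ring
  rw [h1]
  exact add_nonneg (mul_nonneg ha (hx ℓ hℓ)) (mul_nonneg hb (hy ℓ hℓ))

end Polytope

/-! ### Systems -/

section System

variable {V : Type*} [NormedAddCommGroup V] [NormedSpace ℝ V] [FiniteDimensional ℝ V]
  [MeasurableSpace V] [BorelSpace V] {A : Triple V} {P : Set V}

theorem IsSystem.isPolytope (hA : IsSystem A) : IsPolytope A.body := hA.simple.1

theorem IsSystem.isCompact (hA : IsSystem A) : IsCompact A.body := hA.isPolytope.1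

/-- The parametrization of an affine subspace by its direction is a closed embedding. -/
theorem isClosedEmbedding_coe_add (K : Submodule ℝ V) (x : V) :
    IsClosedEmbedding (fun w : K => (w : V) + x) :=
  (Homeomorph.addRight x).isClosedEmbedding.comp K.closed_of_finiteDimensional.isClosedEmbedding_subtypeVal

/-- The direction is a variable `K` with an equation, so that it can be substituted even though the
type of the measure depends on it. -/
theorem IsSystem.lintegral_facet (hA : IsSystem A) {F : Set V} (hF : IsFacet A.body F)
    (hFm : MeasurableSet F) {K : Submodule ℝ V} (hK : (affineSpan ℝ F).direction = K) :
    ∃ x ∈ F, ∃ ν : Measure K, ν.IsAddHaarMeasure ∧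
      ∀ g : V → ℝ≥0∞, ∫⁻ w, F.indicator g (w + x) ∂ν = ∫⁻ y in F, g y ∂A.bdry := by
  subst hK
  obtain ⟨x, hx, ν, hν, h⟩ := hA.flat_bdry F hF
  refine ⟨x, hx, ν, hν, fun g => ?_⟩
  have hemb := (isClosedEmbedding_coe_add (affineSpan ℝ F).direction x).measurableEmbedding
  rw [h, ← lintegral_indicator hFm, hemb.lintegral_map]

/-- Finitely many facets cover the frontier, and each is compact in its affine span, where Haar
measure is finite on compact sets. -/
theorem IsSystem.isFiniteMeasure_bdry (hA : IsSystem A) : IsFiniteMeasure A.bdry := by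
  obtain ⟨s, hP, hs⟩ := hA.isPolytope.exists_facets
  have hF : ∀ ℓ ∈ s, A.bdry {x ∈ A.body | ℓ x = 0} < ∞ := by
    intro ℓ hℓ
    have hFc : IsCompact {x ∈ A.body | ℓ x = 0} :=
      hA.isCompact.inter_right (isClosed_eq (affine_continuous ℓ) continuous_const)
    obtain ⟨x, hx, ν, hν, h⟩ := hA.flat_bdry _ (hs ℓ hℓ).2.1
    have hemb := isClosedEmbedding_coe_add (affineSpan ℝ {x ∈ A.body | ℓ x = 0}).direction x
    rw [← Measure.restrict_apply_self, h, Measure.restrict_apply_self,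
      hemb.measurableEmbedding.map_apply]
    exact (hemb.isCompact_preimage hFc).measure_lt_top
  refine ⟨?_⟩
  calc A.bdry Set.univ ≤ A.bdry (frontier A.body) + A.bdry (frontier A.body)ᶜ := by
        rw [← Set.union_compl_self (frontier A.body)]
        exact measure_union_le _ _
    _ = A.bdry (frontier A.body) := by rw [hA.bdry_support, add_zero]
    _ ≤ A.bdry (⋃ ℓ ∈ s, {x ∈ A.body | ℓ x = 0}) :=
        measure_mono (frontier_subset_iUnion hA.isCompact.isClosed hP)
    _ ≤ ∑ ℓ ∈ s, A.bdry {x ∈ A.body | ℓ x = 0} := measure_biUnion_finset_le _ _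
    _ < ∞ := ENNReal.sum_lt_top.2 hF

theorem IsSystem.isRegular (hA : IsSystem A) : A.IsRegular := by
  obtain ⟨ν, hν, h⟩ := hA.flat_vol
  have hm := hA.isCompact.isClosed.measurableSet
  refine ⟨hA.isCompact.isClosed, ?_, ⟨?_⟩, hA.isFiniteMeasure_bdry, ?_, ?_⟩
  · rw [h, Measure.restrict_apply_univ]
    exact (Measure.measure_pos_of_nonempty_interior ν hA.isPolytope.2.1).ne'
  · rw [h, Measure.restrict_apply_univ]
    exact hA.isCompact.measure_lt_top
  · rw [h, Measure.restrict_apply hm.compl, Set.compl_inter_self, measure_empty]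
  · exact measure_mono_null (Set.compl_subset_compl.2 hA.isCompact.isClosed.frontier_subset)
      hA.bdry_support

theorem IsSystem.vol_frontier (hA : IsSystem A) : ∀ᵐ x ∂A.vol, x ∈ interior A.body := by
  obtain ⟨ν, hν, h⟩ := hA.flat_vol
  have h1 : ν (frontier A.body) = 0 := hA.isPolytope.convex.addHaar_frontier ν
  rw [h, ae_restrict_iff' hA.isCompact.isClosed.measurableSet]
  filter_upwards [measure_eq_zero_iff_ae_notMem.1 h1] with x hx hxP
  by_contra hni
  exact hx ⟨subset_closure hxP, hni⟩

theorem IsSystem.ae_bdry_mem_frontier (hA : IsSystem A) : ∀ᵐ x ∂A.bdry, x ∈ frontier A.body := by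
  rw [ae_iff]; exact hA.bdry_support

/-- Integration over a slab of a function that is constant in a transversal direction. -/
theorem IsSystem.exists_lintegral_slab_le (hA : IsSystem A) {ν : Measure V} [ν.IsAddHaarMeasure]
    {ℓ : V →ᵃ[ℝ] ℝ} (hF : IsFacet A.body {x ∈ A.body | ℓ x = 0})
    (hdir : (affineSpan ℝ {x ∈ A.body | ℓ x = 0}).direction = LinearMap.ker ℓ.linear) {e : V}
    (he : ℓ.linear e ≠ 0) (M : ℝ) :
    ∃ C : ℝ≥0∞, C ≠ ∞ ∧ ∀ g : V → ℝ≥0∞, Measurable g →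
      ∫⁻ y in {y | |ℓ y| ≤ M}, {x ∈ A.body | ℓ x = 0}.indicator g (y - (ℓ y / ℓ.linear e) • e) ∂ν
        ≤ C * ∫⁻ y, g y ∂A.bdry := by
  set F := {x ∈ A.body | ℓ x = 0} with hFdef
  have hFm : MeasurableSet F := (hA.isCompact.isClosed.inter
    (isClosed_eq (affine_continuous ℓ) continuous_const)).measurableSet
  set K := LinearMap.ker ℓ.linear with hK
  obtain ⟨x₀, hx₀, νF, hνF, hint⟩ := hA.lintegral_facet hF hFm hdir
  have hker : ∀ k : K, ℓ.linear k = 0 := fun k => k.2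
  -- the linear isomorphism `K × ℝ ≃ V`
  let Ψ₀ : (K × ℝ) →ₗ[ℝ] V :=
    { toFun := fun z => (z.1 : V) + z.2 • e
      map_add' := fun a b => by simp only [Prod.fst_add, Prod.snd_add, Submodule.coe_add, add_smul]; abel
      map_smul' := fun c a => by simp [smul_add, smul_smul] }
  have hinj : Function.Injective Ψ₀ := by
    rw [← LinearMap.ker_eq_bot, LinearMap.ker_eq_bot']
    rintro ⟨k, t⟩ h
    have h1 : (k : V) + t • e = 0 := h
    have h2 := congrArg ℓ.linear h1
    rw [map_add, hker, map_smul, smul_eq_mul, zero_add, map_zero] at h2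
    obtain rfl : t = 0 := (mul_eq_zero.1 h2).resolve_right he
    rw [zero_smul, add_zero] at h1
    simp only [Prod.mk_eq_zero, and_true]
    exact_mod_cast h1
  have hsurj : Function.Surjective Ψ₀ := by
    intro v
    refine ⟨(⟨v - (ℓ.linear v / ℓ.linear e) • e, ?_⟩, ℓ.linear v / ℓ.linear e), ?_⟩
    · rw [hK, LinearMap.mem_ker, map_sub, map_smul, smul_eq_mul, div_mul_cancel₀ _ he, sub_self]
    · simp [Ψ₀]
  let Ψ : (K × ℝ) ≃L[ℝ] V := (LinearEquiv.ofBijective Ψ₀ ⟨hinj, hsurj⟩).toContinuousLinearEquiv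
  have hΨ : ∀ z : K × ℝ, Ψ z = (z.1 : V) + z.2 • e := fun z => rfl
  set μ' : Measure V := (νF.prod (volume : Measure ℝ)).map Ψ with hμ'
  have : μ'.IsAddHaarMeasure := Ψ.isAddHaarMeasure_map _
  obtain ⟨c, hc, hνc⟩ : ∃ c : ℝ≥0∞, c ≠ ∞ ∧ ν = c • μ' :=
    ⟨_, ENNReal.coe_ne_top, Measure.isAddLeftInvariant_eq_smul ν μ'⟩
  -- The Jacobian constant times the length of the interval of those `t` for which `Ψ (k, t) + x₀`
  -- lies in the slab.
  refine ⟨c * ENNReal.ofReal (2 * (M / |ℓ.linear e|)), by finiteness, fun g hg => ?_⟩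
  have hℓm : Measurable ℓ := (affine_continuous ℓ).measurable
  have hSm : MeasurableSet {y | |ℓ y| ≤ M} :=
    measurableSet_le (by fun_prop) measurable_const
  set h : V → ℝ≥0∞ := fun y => F.indicator g (y - (ℓ y / ℓ.linear e) • e) with hh
  have hhm : Measurable h := (hg.indicator hFm).comp (by fun_prop)
  set f : V → ℝ≥0∞ := {y | |ℓ y| ≤ M}.indicator h with hf
  have hfm : Measurable f := hhm.indicator hSm
  -- In these coordinates projection along `e` forgets `t` and the slab is a condition on `t` alone,
  -- so the integrand is a product and Fubini separates it.
  have hval : ∀ (k : K) (t : ℝ), f (Ψ (k, t) + x₀)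
      = F.indicator g (k + x₀) * (Set.Icc (-(M / |ℓ.linear e|)) (M / |ℓ.linear e|)).indicator 1 t := by
    intro k t
    have hℓ1 : ℓ (Ψ (k, t) + x₀) = t * ℓ.linear e := by
      rw [hΨ, show (k : V) + t • e + x₀ = x₀ + (k : V) + t • e by abel, affine_apply_add_smul,
        affine_apply_add, hker, hx₀.2]
      ring
    have h1 : h (Ψ (k, t) + x₀) = F.indicator g (k + x₀) := by
      simp only [hh]
      rw [hℓ1, mul_div_cancel_right₀ _ he, hΨ]
      congr 1
      abel
    have h2 : Ψ (k, t) + x₀ ∈ {y | |ℓ y| ≤ M}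
        ↔ t ∈ Set.Icc (-(M / |ℓ.linear e|)) (M / |ℓ.linear e|) := by
      rw [Set.mem_ofPred_eq, hℓ1, abs_mul, ← le_div_iff₀ (abs_pos.2 he), abs_le, Set.mem_Icc]
    by_cases ht : Ψ (k, t) + x₀ ∈ {y | |ℓ y| ≤ M}
    · rw [hf, Set.indicator_of_mem ht, h1, Set.indicator_of_mem (h2.1 ht)]; simp
    · rw [hf, Set.indicator_of_notMem ht, Set.indicator_of_notMem (mt h2.2 ht)]; simp
  have hgK : Measurable fun k : K => F.indicator g ((k : V) + x₀) :=
    (hg.indicator hFm).comp (by fun_prop)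
  rw [← lintegral_indicator hSm]
  change ∫⁻ y, f y ∂ν ≤ _
  rw [← lintegral_add_right_eq_self f x₀, hνc, lintegral_smul_measure, hμ',
    Triple.lintegral_map_clequiv, lintegral_prod _ (by fun_prop)]
  simp_rw [hval]
  have hin : ∀ k : K, ∫⁻ t, F.indicator g ((k : V) + x₀)
      * (Set.Icc (-(M / |ℓ.linear e|)) (M / |ℓ.linear e|)).indicator (1 : ℝ → ℝ≥0∞) t
      = F.indicator g ((k : V) + x₀) * ENNReal.ofReal (2 * (M / |ℓ.linear e|)) := by
    intro k
    rw [lintegral_const_mul _ (measurable_one.indicator measurableSet_Icc),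
      lintegral_indicator_one measurableSet_Icc, Real.volume_Icc]
    congr 2
    ring
  simp_rw [hin]
  rw [lintegral_mul_const _ hgK, hint, smul_eq_mul, mul_comm (∫⁻ y in F, g y ∂A.bdry), ← mul_assoc]
  exact mul_le_mul_right (setLIntegral_le_lintegral _ _) _

end System

/-! ### The integrability of states of finite energy -/

section Integrability

variable {V : Type*} [NormedAddCommGroup V] [NormedSpace ℝ V] [FiniteDimensional ℝ V]
  [MeasurableSpace V] [BorelSpace V] {A : Triple V} {P : Set V} {s : Finset (V →ᵃ[ℝ] ℝ)}
  {u : V → ℝ≥0∞}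

/-- The extension of the boundary values of `u` that is constant in the direction of `e`. -/
noncomputable def facetSum (P : Set V) (s : Finset (V →ᵃ[ℝ] ℝ)) (u : V → ℝ≥0∞) (e y : V) :
    ℝ≥0∞ :=
  ∑ ℓ ∈ s with ℓ.linear e ≠ 0,
    {x ∈ P | ℓ x = 0}.indicator u (y - (ℓ y / ℓ.linear e) • e)

theorem facetSum_add_smul (e y : V) (t : ℝ) :
    facetSum P s u e (y + t • e) = facetSum P s u e y := by
  refine Finset.sum_congr rfl fun ℓ hℓ => ?_
  have he := (Finset.mem_filter.1 hℓ).2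
  congr 1
  rw [affine_apply_add_smul, add_div, mul_div_cancel_right₀ _ he, add_smul]
  abel

theorem le_facetSum_of_exit {ℓ : V →ᵃ[ℝ] ℝ} (hℓ : ℓ ∈ s) {e y : V} (he : ℓ.linear e ≠ 0) {t : ℝ}
    (hy : y + t • e ∈ P) (h0 : ℓ (y + t • e) = 0) : u (y + t • e) ≤ facetSum P s u e y := by
  have ht : t = -(ℓ y / ℓ.linear e) := by
    rw [affine_apply_add_smul] at h0
    field_simp
    linarith
  have hproj : y - (ℓ y / ℓ.linear e) • e = y + t • e := by rw [ht, neg_smul, sub_eq_add_neg]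
  have h := Finset.single_le_sum (f := fun ℓ : V →ᵃ[ℝ] ℝ =>
    {x ∈ P | ℓ x = 0}.indicator u (y - (ℓ y / ℓ.linear e) • e)) (s := {ℓ ∈ s | ℓ.linear e ≠ 0})
    (fun _ _ => zero_le) (Finset.mem_filter.2 ⟨hℓ, he⟩)
  refine le_trans (le_of_eq ?_) h
  simp only [hproj]
  rw [Set.indicator_of_mem]
  exact ⟨hy, h0⟩

/-- The line through `y` in direction `e` leaves the polytope at two points, where `u` is at most
the sum `B` on the right. Since `B` is constant along the line, log convexity gives `u y ≤ B ^ (1 -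
τ) * B ^ τ = B`. -/
theorem le_facetSum (hc : IsCompact P) (hP : P = {x | ∀ ℓ ∈ s, 0 ≤ ℓ x})
    (hu : ∀ x ∈ P, ∀ y ∈ P, ∀ t ∈ Set.Icc (0 : ℝ) 1,
      u ((1 - t) • x + t • y) ≤ u x ^ (1 - t) * u y ^ t) {e : V} (he : e ≠ 0) {y : V} (hy : y ∈ P) :
    u y ≤ facetSum P s u e y := by
  obtain ⟨t₁, ht₁, hP₁, ℓ₁, hℓ₁, h₁, hn₁⟩ := exists_exit hc hP hy he
  obtain ⟨t₂, ht₂, hP₂, ℓ₂, hℓ₂, h₂, hn₂⟩ := exists_exit hc hP hy (neg_ne_zero.2 he)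
  rw [map_neg] at hn₂
  rw [smul_neg, ← neg_smul] at hP₂ h₂
  have b₁ := le_facetSum_of_exit (u := u) hℓ₁ hn₁.ne hP₁ h₁
  have b₂ := le_facetSum_of_exit (u := u) hℓ₂ (by linarith : 0 < ℓ₂.linear e).ne' hP₂ h₂
  rcases (add_nonneg ht₁ ht₂).eq_or_lt with h0 | hpos
  · obtain rfl : t₁ = 0 := by linarith
    simpa using b₁
  · have hτ : t₂ / (t₁ + t₂) ∈ Set.Icc (0 : ℝ) 1 :=
      ⟨div_nonneg ht₂ hpos.le, (div_le_one hpos).2 (by linarith)⟩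
    have h := hu _ hP₂ _ hP₁ _ hτ
    have hseg : (1 - t₂ / (t₁ + t₂)) • (y + (-t₂) • e) + (t₂ / (t₁ + t₂)) • (y + t₁ • e) = y := by
      have e1 : (1 - t₂ / (t₁ + t₂)) * -t₂ + t₂ / (t₁ + t₂) * t₁ = 0 := by field_simp; ring
      rw [smul_add, smul_add, add_add_add_comm, ← add_smul, smul_smul, smul_smul, ← add_smul, e1,
        sub_add_cancel, one_smul, zero_smul, add_zero]
    rw [hseg] at h
    refine h.trans ((mul_le_mul' (ENNReal.rpow_le_rpow b₂ (by linarith [hτ.2]))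
      (ENNReal.rpow_le_rpow b₁ hτ.1)).trans (le_of_eq ?_))
    rw [← ENNReal.rpow_add_of_nonneg _ _ (by linarith [hτ.2]) hτ.1, sub_add_cancel,
      ENNReal.rpow_one]

theorem measurable_facetSum (hP : IsClosed P) (hu : Measurable u) (e : V) :
    Measurable (facetSum P s u e) := by
  refine Finset.measurable_sum _ fun ℓ _ => ?_
  have hm : MeasurableSet {x ∈ P | ℓ x = 0} :=
    (hP.inter (isClosed_eq (affine_continuous ℓ) continuous_const)).measurableSet
  have hℓm : Measurable ℓ := (affine_continuous ℓ).measurable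
  exact (hu.indicator hm).comp (by fun_prop)

theorem IsSystem.exists_lintegral_facetSum_le (hA : IsSystem A)
    (hs : ∀ ℓ ∈ s, ℓ.linear ≠ 0 ∧ IsFacet A.body {x ∈ A.body | ℓ x = 0} ∧
        (affineSpan ℝ {x ∈ A.body | ℓ x = 0}).direction = LinearMap.ker ℓ.linear)
    (ν : Measure V) [ν.IsAddHaarMeasure] {Q : Set V} (hQ : IsCompact Q) (e : V) :
    ∃ C : ℝ≥0∞, C ≠ ∞ ∧ ∀ g : V → ℝ≥0∞, Measurable g →
      ∫⁻ y in Q, facetSum A.body s g e y ∂ν ≤ C * ∫⁻ y, g y ∂A.bdry := by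
  have key : ∀ ℓ : {ℓ // ℓ ∈ s.filter fun ℓ => ℓ.linear e ≠ 0}, ∃ C : ℝ≥0∞, C ≠ ∞ ∧
      ∀ g : V → ℝ≥0∞, Measurable g →
        ∫⁻ y in Q, {x ∈ A.body | ℓ.1 x = 0}.indicator g (y - (ℓ.1 y / ℓ.1.linear e) • e) ∂ν
          ≤ C * ∫⁻ y, g y ∂A.bdry := by
    rintro ⟨ℓ, hℓ⟩
    obtain ⟨hℓs, he⟩ := Finset.mem_filter.1 hℓ
    obtain ⟨M, hM⟩ := hQ.exists_bound_of_continuousOn (affine_continuous ℓ).continuousOn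
    obtain ⟨C, hC, h⟩ := hA.exists_lintegral_slab_le (ν := ν) (hs ℓ hℓs).2.1 (hs ℓ hℓs).2.2 he M
    exact ⟨C, hC, fun g hg => (lintegral_mono_set fun y hy => hM y hy).trans (h g hg)⟩
  choose C hC h using key
  refine ⟨∑ ℓ, C ℓ, ENNReal.sum_ne_top.2 fun ℓ _ => hC ℓ, fun g hg => ?_⟩
  have hm : ∀ ℓ : V →ᵃ[ℝ] ℝ, Measurable fun y : V =>
      {x ∈ A.body | ℓ x = 0}.indicator g (y - (ℓ y / ℓ.linear e) • e) := by
    intro ℓ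
    have hm : MeasurableSet {x ∈ A.body | ℓ x = 0} := (hA.isCompact.isClosed.inter
      (isClosed_eq (affine_continuous ℓ) continuous_const)).measurableSet
    have hℓm : Measurable ℓ := (affine_continuous ℓ).measurable
    exact (hg.indicator hm).comp (by fun_prop)
  simp only [facetSum]
  rw [lintegral_finsetSum _ fun ℓ _ => hm ℓ, ← Finset.sum_attach, Finset.sum_mul]
  exact Finset.sum_le_sum fun ℓ _ => h ℓ g hg

/-- The integrability of log convex functions in terms of their boundary values. -/
theorem IsSystem.exists_lintegral_rpow_le (hA : IsSystem A) (hn : 0 < Module.finrank ℝ V) {q : ℝ}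
    (hq : 1 ≤ q) (hqn : q * ((Module.finrank ℝ V : ℝ) - 1) ≤ Module.finrank ℝ V) :
    ∃ C : ℝ≥0∞, C ≠ ∞ ∧ ∀ u : V → ℝ≥0∞, A.IsState 1 u →
      ∫⁻ x, u x ^ q ∂A.vol ≤ C * (∫⁻ x, u x ∂A.bdry) ^ q := by
  obtain ⟨s, hP, hs⟩ := hA.isPolytope.exists_facets
  obtain ⟨ν, hν, hvol⟩ := hA.flat_vol
  set n := Module.finrank ℝ V
  let b : Module.Basis (Fin n) ℝ V := Module.finBasis ℝ V
  let Φ : (Fin n → ℝ) ≃L[ℝ] V := b.equivFun.symm.toContinuousLinearEquiv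
  have hΦ : ∀ (x : Fin n → ℝ) (i : Fin n) (t : ℝ),
      Φ (Function.update x i t) = Φ x + (t - x i) • b i := by
    intro x i t
    have h1 : Function.update x i t = x + (t - x i) • Pi.single i (1 : ℝ) := by
      ext j
      by_cases h : j = i
      · subst h; simp
      · simp [h]
    have h2 : Φ (Pi.single i (1 : ℝ)) = b i := by
      change b.equivFun.symm (Pi.single i 1) = b i
      simp [Module.Basis.equivFun_symm_apply, Pi.single_apply]
    rw [h1, map_add, map_smul, h2]
  set μ : Measure V := (volume : Measure (Fin n → ℝ)).map Φ with hμ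
  have : μ.IsAddHaarMeasure := Φ.isAddHaarMeasure_map _
  obtain ⟨c, hc, hνc⟩ : ∃ c : ℝ≥0∞, c ≠ ∞ ∧ ν = c • μ :=
    ⟨_, ENNReal.coe_ne_top, Measure.isAddLeftInvariant_eq_smul ν μ⟩
  -- The body lies in a coordinate cube with sides of length at least `1`; a function constant along
  -- a side is then at most its integral over that side.
  obtain ⟨M, hM1, hM⟩ : ∃ M : ℝ, 1 ≤ M ∧ ∀ y ∈ A.body, ‖Φ.symm y‖ ≤ M := by
    obtain ⟨M, hM⟩ := hA.isCompact.exists_bound_of_continuousOn Φ.symm.continuous.continuousOn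
    exact ⟨max 1 M, le_max_left _ _, fun y hy => (hM y hy).trans (le_max_right _ _)⟩
  set Q : Set (Fin n → ℝ) := Set.univ.pi fun _ => Set.Icc (-M) M with hQ
  have hQc : IsCompact Q := isCompact_univ_pi fun _ => isCompact_Icc
  have hQm : MeasurableSet Q := hQc.measurableSet
  have hPQ : ∀ x, Φ x ∈ A.body → x ∈ Q := by
    intro x hx i _
    have h1 := (norm_le_pi_norm x i).trans (by simpa using hM _ hx)
    exact abs_le.1 h1
  have hΦQ : IsCompact (Φ '' Q) := hQc.image Φ.continuous
  choose C hC hCle using fun i : Fin n => hA.exists_lintegral_facetSum_le hs μ hΦQ (b i)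
  have hCs : ∑ i, C i ≠ ∞ := ENNReal.sum_ne_top.2 fun i _ => hC i
  refine ⟨c * (∑ i, C i) ^ q, ENNReal.mul_ne_top hc (ENNReal.rpow_ne_top_of_nonneg (by linarith) hCs),
    fun u hu => ?_⟩
  have hreg := hA.isRegular
  -- a measurable modification
  set g : V → ℝ≥0∞ := A.body.indicator u with hg
  have hgm : Measurable g := hu.lsc.measurable_indicator hreg.isClosed
  have hgu : ∀ x ∈ A.body, g x = u x := fun x hx => Set.indicator_of_mem hx u
  have hgconv : ∀ x ∈ A.body, ∀ y ∈ A.body, ∀ t ∈ Set.Icc (0 : ℝ) 1,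
      g ((1 - t) • x + t • y) ≤ g x ^ (1 - t) * g y ^ t := by
    intro x hx y hy t ht
    rw [hgu x hx, hgu y hy, hgu _ (hA.isPolytope.convex hx hy (by linarith [ht.2]) ht.1 (by ring))]
    exact hu.logConvex x hx y hy t ht
  have hgb : ∫⁻ x, g x ∂A.bdry = ∫⁻ x, u x ∂A.bdry := by
    apply lintegral_congr_ae
    filter_upwards [hreg.ae_bdry_mem] with x hx using hgu x hx
  -- One majorant of `u` for each coordinate, constant in that coordinate. Their sum on the cube is
  -- `G`, whose integral is controlled by the boundary integral of `u`.
  set f : Fin n → V → ℝ≥0∞ := fun i => facetSum A.body s g (b i) with hf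
  have hfm : ∀ i, Measurable (f i) := fun i => measurable_facetSum hreg.isClosed hgm (b i)
  set G : (Fin n → ℝ) → ℝ≥0∞ := Q.indicator fun x => ∑ i, f i (Φ x) with hG
  have hΦm : Measurable Φ := Φ.continuous.measurable
  have hfΦ : ∀ i, Measurable fun x => f i (Φ x) := fun i => (hfm i).comp hΦm
  have hGm : Measurable G := by
    refine Measurable.indicator ?_ hQm
    exact Finset.measurable_sum _ fun i _ => hfΦ i
  have hGint : ∫⁻ x, G x ≤ (∑ i, C i) * ∫⁻ x, u x ∂A.bdry := by
    rw [hG, lintegral_indicator hQm, lintegral_finsetSum _ fun i _ => hfΦ i,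
      Finset.sum_mul]
    refine Finset.sum_le_sum fun i _ => ?_
    have h1 := hCle i g hgm
    rw [hgb, hμ, ← lintegral_indicator hΦQ.measurableSet, Triple.lintegral_map_clequiv] at h1
    refine le_trans (le_of_eq ?_) h1
    rw [← lintegral_indicator hQm]
    apply lintegral_congr
    intro x
    by_cases hx : x ∈ Q
    · rw [Set.indicator_of_mem hx, Set.indicator_of_mem (Set.mem_image_of_mem _ hx)]
    · rw [Set.indicator_of_notMem hx, Set.indicator_of_notMem]
      rintro ⟨x', hx', he⟩
      exact hx (Φ.injective he ▸ hx')
  have hle : ∀ x, Φ x ∈ A.body → ∀ i, g (Φ x) ≤ f i (Φ x) := fun x hx i =>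
    le_facetSum hA.isCompact hP hgconv (b.ne_zero i) hx
  have hline : ∀ x, Φ x ∈ A.body → ∀ i, g (Φ x) ≤ ∫⁻ t, G (Function.update x i t) := by
    intro x hx i
    have hxQ := hPQ x hx
    calc g (Φ x) ≤ f i (Φ x) * volume (Set.Icc (-M) M) := by
          rw [Real.volume_Icc]
          refine (hle x hx i).trans (le_mul_of_one_le_right zero_le ?_)
          rw [← ENNReal.ofReal_one]
          exact ENNReal.ofReal_le_ofReal (by linarith)
      _ = ∫⁻ t in Set.Icc (-M) M, f i (Φ x) := by rw [setLIntegral_const]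
      _ ≤ ∫⁻ t in Set.Icc (-M) M, G (Function.update x i t) := by
          refine setLIntegral_mono' measurableSet_Icc fun t ht => ?_
          have hmem : Function.update x i t ∈ Q := by
            intro j _
            by_cases h : j = i
            · subst h; simpa using ht
            · simpa [h] using hxQ j trivial
          rw [hG, Set.indicator_of_mem hmem]
          have hup : f i (Φ x) = f i (Φ (Function.update x i t)) := by
            simp only [hΦ, hf, facetSum_add_smul]
          rw [hup]
          exact Finset.single_le_sum (f := fun i' => f i' (Φ (Function.update x i t)))
            (fun _ _ => zero_le) (Finset.mem_univ i)
      _ ≤ _ := setLIntegral_le_lintegral _ _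
  -- The grid-lines inequality behind the Gagliardo-Nirenberg-Sobolev inequality, with parameter `q
  -- - 1`. Its condition `(n - 1) (q - 1) ≤ 1` is exactly `q (n - 1) ≤ n`.
  have hgrid := lintegral_mul_prod_lintegral_pow_le (fun _ : Fin n => (volume : Measure ℝ))
    (p := q - 1) (by linarith) (by simp only [Fintype.card_fin]; linarith) hGm
  have hn1 : (1 : ℝ) ≤ n := by exact_mod_cast hn
  rw [Fintype.card_fin] at hgrid
  have hexp : 0 ≤ 1 - ((n : ℝ) - 1) * (q - 1) := by linarith
  calc ∫⁻ x, u x ^ q ∂A.vol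
      = c * ∫⁻ x, A.body.indicator (fun y => u y ^ q) (Φ x) := by
        rw [hvol, ← lintegral_indicator hreg.isClosed.measurableSet, hνc, lintegral_smul_measure,
          smul_eq_mul, hμ, Triple.lintegral_map_clequiv]
    _ ≤ c * ∫⁻ x, G x ^ (1 - ((n : ℝ) - 1) * (q - 1))
          * ∏ i, (∫⁻ t, G (Function.update x i t)) ^ (q - 1) := by
        refine mul_le_mul_right (lintegral_mono fun x => ?_) _
        by_cases hx : Φ x ∈ A.body
        · rw [Set.indicator_of_mem hx]
          have hGx : g (Φ x) ≤ G x := by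
            rw [hG, Set.indicator_of_mem (hPQ x hx)]
            exact (hle x hx ⟨0, hn⟩).trans (Finset.single_le_sum (f := fun i => f i (Φ x))
              (fun _ _ => zero_le) (Finset.mem_univ _))
          -- The exponents `1 - (n - 1) (q - 1)` and `n` times `q - 1` add up to `q`: one factor is
          -- bounded by `G`, the others by its line integrals.
          calc u (Φ x) ^ q
              = g (Φ x) ^ (1 - ((n : ℝ) - 1) * (q - 1)) * ∏ _i : Fin n, g (Φ x) ^ (q - 1) := by
                rw [Finset.prod_const, Finset.card_univ, Fintype.card_fin, ← ENNReal.rpow_natCast,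
                  ← ENNReal.rpow_mul, ← ENNReal.rpow_add_of_nonneg _ _ hexp
                  (mul_nonneg (by linarith) (by positivity)), hgu _ hx]
                congr 1
                ring
            _ ≤ _ := by
                refine mul_le_mul' (ENNReal.rpow_le_rpow hGx hexp) ?_
                exact Finset.prod_le_prod' fun i _ =>
                  ENNReal.rpow_le_rpow (hline x hx i) (by linarith)
        · rw [Set.indicator_of_notMem hx]
          exact zero_le
    _ ≤ c * (∫⁻ x, G x) ^ q := by
        refine mul_le_mul_right (hgrid.trans (le_of_eq ?_)) _
        rw [add_sub_cancel]
        rfl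
    _ ≤ c * ((∑ i, C i) * ∫⁻ x, u x ∂A.bdry) ^ q := by gcongr
    _ = _ := by rw [ENNReal.mul_rpow_of_nonneg _ _ (by linarith), mul_assoc]

end Integrability

/-! ### Log convex functions and their closure -/

section LogConvex

variable {V : Type*} [NormedAddCommGroup V] [NormedSpace ℝ V]
  {P S : Set V} {u : V → ℝ≥0∞}

/-- Log convexity of an extended nonnegative function on a set. -/
def LogConvexOn (S : Set V) (u : V → ℝ≥0∞) : Prop :=
  ∀ x ∈ S, ∀ y ∈ S, ∀ t ∈ Set.Icc (0 : ℝ) 1, u ((1 - t) • x + t • y) ≤ u x ^ (1 - t) * u y ^ t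

theorem LogConvexOn.mono {T : Set V} (h : LogConvexOn S u) (hT : T ⊆ S) : LogConvexOn T u :=
  fun x hx y hy => h x (hT hx) y (hT hy)

theorem LogConvexOn.le_add (h : LogConvexOn S u) {x y : V} (hx : x ∈ S) (hy : y ∈ S) {t : ℝ}
    (ht : t ∈ Set.Icc (0 : ℝ) 1) :
    u ((1 - t) • x + t • y) ≤ ENNReal.ofReal (1 - t) * u x + ENNReal.ofReal t * u y :=
  (h x hx y hy t ht).trans (rpow_mul_rpow_le ht _ _)

theorem LogConvexOn.convexOn_toReal (h : LogConvexOn S u) (hS : Convex ℝ S)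
    (hfin : ∀ x ∈ S, u x ≠ ∞) : ConvexOn ℝ S fun x => (u x).toReal := by
  refine ⟨hS, fun x hx y hy a b ha hb hab => ?_⟩
  obtain rfl : a = 1 - b := by linarith
  have hb' : b ∈ Set.Icc (0 : ℝ) 1 := ⟨hb, by linarith⟩
  have := h.le_add hx hy hb'
  simp only [smul_eq_mul]
  rw [← toReal_mix hb' (hfin x hx) (hfin y hy)]
  have hx' := hfin x hx
  have hy' := hfin y hy
  exact ENNReal.toReal_mono (by finiteness) this

theorem LogConvexOn.continuousOn [FiniteDimensional ℝ V] (h : LogConvexOn S u) (hS : Convex ℝ S)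
    (hSo : IsOpen S) (hfin : ∀ x ∈ S, u x ≠ ∞) : ContinuousOn u S := by
  have h1 := ((h.convexOn_toReal hS hfin).continuousOn hSo)
  have h2 : ContinuousOn (fun x => ENNReal.ofReal (u x).toReal) S :=
    ENNReal.continuous_ofReal.comp_continuousOn h1
  exact h2.congr fun x hx => (ENNReal.ofReal_toReal (hfin x hx)).symm

/-- Extend the segment from `y` through `x₀` slightly beyond `x₀`, into a ball on which `u ≤ M`. Log
convexity at `x₀` then bounds `u y` from below uniformly in `y`. -/
theorem LogConvexOn.exists_pos_le [FiniteDimensional ℝ V] (h : LogConvexOn S u)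
    (hS : Convex ℝ S) (hb : Bornology.IsBounded S) {x₀ : V} (hx₀ : x₀ ∈ interior S)
    (hfin : ∀ x ∈ interior S, u x ≠ ∞) (hpos : u x₀ ≠ 0) : ∃ c : ℝ≥0∞, 0 < c ∧ ∀ y ∈ S, c ≤ u y := by
  have hcont := (h.mono interior_subset).continuousOn hS.interior isOpen_interior hfin
  obtain ⟨r, hr, hrS⟩ := Metric.isOpen_iff.1 isOpen_interior x₀ hx₀
  have hrS' : Metric.closedBall x₀ (r / 2) ⊆ interior S :=
    (Metric.closedBall_subset_ball (by linarith)).trans hrS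
  obtain ⟨z₀, hz₀, hM⟩ := (isCompact_closedBall x₀ (r / 2)).exists_isMaxOn
    ⟨x₀, Metric.mem_closedBall_self (by linarith)⟩ (hcont.mono hrS')
  have hMfin := hfin z₀ (hrS' hz₀)
  set M := u z₀
  obtain ⟨D, hD0, hD⟩ : ∃ D : ℝ, 0 < D ∧ ∀ y ∈ S, ‖y - x₀‖ ≤ D := by
    obtain ⟨D, hD⟩ := hb.subset_closedBall x₀
    refine ⟨max D 1, by positivity, fun y hy => ?_⟩
    have := hD hy
    rw [Metric.mem_closedBall, dist_eq_norm] at this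
    exact this.trans (le_max_left _ _)
  -- Scales the reflection of `y` at `x₀` into the ball of radius `r / 2`; with `t = δ / (1 + δ)`
  -- the point `x₀` is the corresponding convex combination.
  set δ : ℝ := r / 2 / D
  have hδ : 0 < δ := by positivity
  set t : ℝ := δ / (1 + δ)
  have ht0 : 0 < t := by positivity
  have ht1 : t < 1 := by rw [div_lt_one (by positivity)]; linarith
  have hkey : ∀ y ∈ S, u x₀ ≤ M ^ (1 - t) * u y ^ t := by
    intro y hy
    have hz : x₀ + δ • (x₀ - y) ∈ Metric.closedBall x₀ (r / 2) := by
      rw [Metric.mem_closedBall, dist_eq_norm, add_sub_cancel_left, norm_smul, Real.norm_of_nonneg hδ.le,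
        norm_sub_rev]
      calc δ * ‖y - x₀‖ ≤ δ * D := by gcongr; exact hD y hy
        _ = r / 2 := by simp only [δ]; field_simp
    have := h _ (interior_subset (hrS' hz)) y hy t ⟨ht0.le, ht1.le⟩
    have he : (1 - t) • (x₀ + δ • (x₀ - y)) + t • y = x₀ := by
      have h1 : (1 - t) * (1 + δ) = 1 := by simp only [t]; field_simp; ring
      have h2 : (1 - t) * δ = t := by simp only [t]; field_simp; ring
      calc _ = ((1 - t) * (1 + δ)) • x₀ - ((1 - t) * δ - t) • y := by module
        _ = x₀ := by rw [h1, h2]; simp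
    rw [he] at this
    refine this.trans ?_
    exact mul_le_mul_left (ENNReal.rpow_le_rpow (hM hz) (by linarith)) _
  have hM0 : M ≠ 0 := fun h0 => hpos <| by
    have := hM (Metric.mem_closedBall_self (x := x₀) (by linarith : 0 ≤ r / 2))
    simpa [h0, M] using this
  have hMp0 : M ^ (1 - t) ≠ 0 := by
    simp [ENNReal.rpow_eq_zero_iff, hM0, hMfin]
  have hMpt : M ^ (1 - t) ≠ ∞ := ENNReal.rpow_ne_top_of_nonneg (by linarith) hMfin
  refine ⟨(u x₀ / M ^ (1 - t)) ^ (1 / t), ?_, fun y hy => ?_⟩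
  · exact ENNReal.rpow_pos (ENNReal.div_pos hpos hMpt)
      (ENNReal.div_ne_top (hfin x₀ hx₀) hMp0)
  · rw [one_div, ENNReal.rpow_inv_le_iff ht0]
    rw [ENNReal.div_le_iff hMp0 hMpt, mul_comm]
    exact hkey y hy

/-- The lower semicontinuous closure of a function given on the interior. -/
noncomputable def lcl (P : Set V) (u : V → ℝ≥0∞) (x : V) : ℝ≥0∞ := liminf u (𝓝[interior P] x)

theorem lcl_eq (hu : ContinuousOn u (interior P)) {x : V} (hx : x ∈ interior P) :
    lcl P u x = u x :=
  haveI : (𝓝[interior P] x).NeBot := mem_closure_iff_nhdsWithin_neBot.1 (subset_closure hx)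
  (hu x hx).liminf_eq

theorem lcl_lowerSemicontinuous (P : Set V) (u : V → ℝ≥0∞) : LowerSemicontinuous (lcl P u) := by
  intro x c hc
  obtain ⟨d, hcd, hd⟩ := exists_between hc
  have h1 : ∀ᶠ y in 𝓝[interior P] x, d < u y := eventually_lt_of_lt_liminf hd
  rw [eventually_nhdsWithin_iff] at h1
  filter_upwards [h1.eventually_nhds] with y hy
  refine hcd.trans_le (le_liminf_of_le (by isBoundedDefault) ?_)
  rw [eventually_nhdsWithin_iff]
  exact hy.mono fun z hz hzI => (hz hzI).le

theorem le_lcl {c : ℝ≥0∞} (h : ∀ y ∈ interior P, c ≤ u y) (x : V) : c ≤ lcl P u x := by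
  refine le_liminf_of_le (by isBoundedDefault) ?_
  filter_upwards [self_mem_nhdsWithin] with y hy using h y hy

theorem nhdsWithin_interior_neBot (hP : Convex ℝ P) (hI : (interior P).Nonempty) {x : V}
    (hx : x ∈ P) : (𝓝[interior P] x).NeBot := by
  rw [← mem_closure_iff_nhdsWithin_neBot, hP.closure_interior_eq_closure_of_nonempty_interior hI]
  exact subset_closure hx

/-- The lower limit over the interior is at most the one along the segment from `x₀` to `x`, and
finiteness of `a` makes the first summand vanish as `t → 1`. -/
theorem lcl_le_of_segment (hP : Convex ℝ P) {x₀ x : V} (hx₀ : x₀ ∈ interior P) (hx : x ∈ P)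
    {a L : ℝ≥0∞} (ha : a ≠ ∞) (h : ∀ t ∈ Set.Ioo (0 : ℝ) 1, u ((1 - t) • x₀ + t • x)
      ≤ ENNReal.ofReal (1 - t) * a + ENNReal.ofReal t * L) : lcl P u x ≤ L := by
  have hmem : Set.Ioo (0 : ℝ) 1 ∈ 𝓝[<] (1 : ℝ) := Ioo_mem_nhdsLT zero_lt_one
  have hlim : Tendsto (fun t : ℝ => (1 - t) • x₀ + t • x) (𝓝[<] 1) (𝓝[interior P] x) := by
    refine tendsto_nhdsWithin_iff.2 ⟨?_, ?_⟩
    · have : Continuous fun t : ℝ => (1 - t) • x₀ + t • x := by fun_prop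
      have h1 := this.tendsto 1
      simp only [sub_self, zero_smul, one_smul, zero_add] at h1
      exact h1.mono_left nhdsWithin_le_nhds
    · filter_upwards [hmem] with t ht
      exact hP.combo_interior_closure_mem_interior hx₀ (subset_closure hx)
        (by linarith [ht.2]) ht.1.le (by ring)
  refine hlim.liminf_le_liminf_comp.trans ?_
  have h2 : Tendsto (fun t : ℝ => ENNReal.ofReal (1 - t) * a + ENNReal.ofReal t * L) (𝓝[<] 1)
      (𝓝 L) := by
    have e1 : Tendsto (fun t : ℝ => ENNReal.ofReal (1 - t)) (𝓝[<] 1) (𝓝 (ENNReal.ofReal (1 - 1))) :=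
      ((ENNReal.continuous_ofReal.comp (continuous_const.sub continuous_id)).tendsto 1).mono_left
        nhdsWithin_le_nhds
    have e2 : Tendsto (fun t : ℝ => ENNReal.ofReal t) (𝓝[<] 1) (𝓝 (ENNReal.ofReal 1)) :=
      (ENNReal.continuous_ofReal.tendsto 1).mono_left nhdsWithin_le_nhds
    have e3 := (ENNReal.Tendsto.mul_const e1 (Or.inr ha)).add
      (ENNReal.Tendsto.mul_const (b := L) e2 (Or.inl (by simp)))
    simpa using e3
  calc liminf (u ∘ fun t : ℝ => (1 - t) • x₀ + t • x) (𝓝[<] 1)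
      ≤ liminf (fun t : ℝ => ENNReal.ofReal (1 - t) * a + ENNReal.ofReal t * L) (𝓝[<] 1) :=
        liminf_le_liminf (by filter_upwards [hmem] with t ht using h t ht)
    _ = L := h2.liminf_eq

/-- Combine sequences realizing the two lower limits. Positivity excludes products `0 * ∞`, so the
right side passes to the limit. -/
theorem lcl_logConvexOn (hP : Convex ℝ P) (hI : (interior P).Nonempty)
    (hu : LogConvexOn (interior P) u) (hpos : ∀ x ∈ P, 0 < lcl P u x) :
    LogConvexOn P (lcl P u) := by
  intro x hx y hy t ht
  rcases ht.1.eq_or_lt with rfl | ht0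
  · simp
  rcases ht.2.eq_or_lt with rfl | ht1
  · simp
  have := nhdsWithin_interior_neBot hP hI hx
  have := nhdsWithin_interior_neBot hP hI hy
  obtain ⟨a, ha, ha'⟩ := exists_seq_tendsto_liminf (f := 𝓝[interior P] x) (u := u)
  obtain ⟨b, hb, hb'⟩ := exists_seq_tendsto_liminf (f := 𝓝[interior P] y) (u := u)
  have haI : ∀ᶠ k in atTop, a k ∈ interior P := ha'.eventually self_mem_nhdsWithin
  have hbI : ∀ᶠ k in atTop, b k ∈ interior P := hb'.eventually self_mem_nhdsWithin
  have hlim : Tendsto (fun k => (1 - t) • a k + t • b k) atTop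
      (𝓝[interior P] ((1 - t) • x + t • y)) := by
    refine tendsto_nhdsWithin_iff.2 ⟨?_, ?_⟩
    · exact ((tendsto_nhdsWithin_iff.1 ha').1.const_smul _).add
        ((tendsto_nhdsWithin_iff.1 hb').1.const_smul _)
    · filter_upwards [haI, hbI] with k h1 h2
      exact hP.interior h1 h2 (by linarith) ht0.le (by ring)
  refine hlim.liminf_le_liminf_comp.trans ?_
  have hpx := hpos x hx
  have hpy := hpos y hy
  have h3 : Tendsto (fun k => u (a k) ^ (1 - t) * u (b k) ^ t) atTop
      (𝓝 (lcl P u x ^ (1 - t) * lcl P u y ^ t)) := by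
    refine ENNReal.Tendsto.mul ((ENNReal.continuous_rpow_const.tendsto _).comp ha) (Or.inl ?_)
      ((ENNReal.continuous_rpow_const.tendsto _).comp hb) (Or.inl ?_)
    · rw [Ne, ENNReal.rpow_eq_zero_iff_of_pos (by linarith)]
      exact hpx.ne'
    · rw [Ne, ENNReal.rpow_eq_zero_iff_of_pos ht0]
      exact hpy.ne'
  rw [← h3.liminf_eq]
  refine liminf_le_liminf ?_
  filter_upwards [haI, hbI] with k h1 h2 using hu _ h1 _ h2 t ht

/-- The closure of a finite positive log convex function on the interior of a convex body. -/
theorem lcl_props [FiniteDimensional ℝ V] (hP : Convex ℝ P) (hb : Bornology.IsBounded P)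
    (hu : LogConvexOn (interior P) u) (hfin : ∀ x ∈ interior P, u x ≠ ∞) {x₀ : V}
    (hx₀ : x₀ ∈ interior P) (hne : u x₀ ≠ 0) :
    LowerSemicontinuous (lcl P u) ∧ (∀ x, 0 < lcl P u x) ∧ LogConvexOn P (lcl P u) ∧
      ∀ x ∈ interior P, lcl P u x = u x := by
  have hpos : ∀ x, 0 < lcl P u x := by
    obtain ⟨c, hc, hcu⟩ := hu.exists_pos_le hP.interior (hb.subset interior_subset) (x₀ := x₀)
      (by rwa [interior_interior]) (by rwa [interior_interior]) hne
    exact fun x => hc.trans_le (le_lcl hcu x)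
  exact ⟨lcl_lowerSemicontinuous P u, hpos,
    lcl_logConvexOn hP ⟨x₀, hx₀⟩ hu fun x _ => hpos x,
    fun x hx => lcl_eq (hu.continuousOn hP.interior isOpen_interior hfin) hx⟩

theorem limsup_rpow {ι : Type*} {l : Filter ι} [l.NeBot] (f : ι → ℝ≥0∞) {s : ℝ} (hs : 0 ≤ s) :
    limsup (fun i => f i ^ s) l = limsup f l ^ s :=
  ((ENNReal.monotone_rpow_of_nonneg hs).map_limsup_of_continuousAt f
    ENNReal.continuous_rpow_const.continuousAt).symm

/-- Upper limits are submultiplicative away from `0 * ∞`; hence upper rather than lower limits of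
states are used in the interior. -/
theorem logConvexOn_limsup {ι : Type*} {l : Filter ι} [l.NeBot] {w : ι → V → ℝ≥0∞}
    (h : ∀ i, LogConvexOn S (w i)) (hfin : ∀ x ∈ S, limsup (fun i => w i x) l ≠ ∞) :
    LogConvexOn S fun x => limsup (fun i => w i x) l := by
  intro x hx y hy t ht
  have h1 : 0 ≤ 1 - t := by linarith [ht.2]
  have ex := limsup_rpow (l := l) (fun i => w i x) h1
  have ey := limsup_rpow (l := l) (fun i => w i y) ht.1
  have fx : limsup (fun i => w i x ^ (1 - t)) l ≠ ∞ := by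
    rw [ex]; exact ENNReal.rpow_ne_top_of_nonneg h1 (hfin x hx)
  have fy : limsup (fun i => w i y ^ t) l ≠ ∞ := by
    rw [ey]; exact ENNReal.rpow_ne_top_of_nonneg ht.1 (hfin y hy)
  refine (limsup_le_limsup (Eventually.of_forall fun i => h i x hx y hy t ht)).trans ?_
  refine (ENNReal.limsup_mul_le' (Or.inr fy) (Or.inl fx)).trans ?_
  rw [ex, ey]

end LogConvex

/-! ### Limits of states -/

theorem enorm_sqrt_sq (a : ℝ≥0∞) (ha : a ≠ ∞) : ‖√a.toReal‖ₑ ^ (2 : ℝ) = a := by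
  rw [Real.enorm_of_nonneg (Real.sqrt_nonneg _), ENNReal.ofReal_rpow_of_nonneg (by positivity)
    (by norm_num), Real.rpow_two, Real.sq_sqrt ENNReal.toReal_nonneg, ENNReal.ofReal_toReal ha]

theorem eLpNorm_two_rpow {X : Type*} [MeasurableSpace X] {μ : Measure X} (f : X → ℝ) :
    eLpNorm f 2 μ = (∫⁻ x, ‖f x‖ₑ ^ (2 : ℝ) ∂μ) ^ (1 / 2 : ℝ) := by
  rw [eLpNorm_eq_lintegral_rpow_enorm_toReal (by norm_num) (by norm_num)]
  simp

theorem liminf_div_const {ι : Type*} {l : Filter ι} [l.NeBot] (f : ι → ℝ≥0∞) {c : ℝ≥0∞}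
    (hc : c ≠ 0) : liminf (fun i => f i / c) l = liminf f l / c :=
  (Monotone.map_liminf_of_continuousAt (f := fun x : ℝ≥0∞ => x / c)
    (fun _ _ h => ENNReal.div_le_div_right h _) f
    (ENNReal.continuous_div_const c hc).continuousAt).symm

namespace Triple

section

variable {V : Type*} [NormedAddCommGroup V] [NormedSpace ℝ V] [MeasurableSpace V] [BorelSpace V]
  {A : Triple V} {u v : V → ℝ≥0∞}

theorem eLpNorm_sqrt (hA : A.IsRegular) (hu : A.IsState 1 u) :
    eLpNorm (fun x => √(u x).toReal) 2 A.vol = A.vol Set.univ ^ (1 / 2 : ℝ) := by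
  rw [eLpNorm_two_rpow, ← hu.mass]
  congr 1
  apply lintegral_congr_ae
  filter_upwards [hu.ae_ne_top hA] with x hx using enorm_sqrt_sq _ hx

theorem memLp_sqrt (hA : A.IsRegular) (hu : A.IsState 1 u) :
    MemLp (fun x => √(u x).toReal) 2 A.vol := by
  have hu' := hu.aemeasurable_vol hA
  refine ⟨(by fun_prop : AEMeasurable (fun x => √(u x).toReal) A.vol).aestronglyMeasurable, ?_⟩
  rw [eLpNorm_sqrt hA hu]
  exact ENNReal.rpow_lt_top_of_nonneg (by norm_num) hA.vol_ne_top

theorem eLpNorm_sqrt_sub (hA : A.IsRegular) :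
    eLpNorm ((fun x => √(u x).toReal) - fun x => √(v x).toReal) 2 A.vol
      = (A.hdist u v * A.vol Set.univ) ^ (1 / 2 : ℝ) := by
  rw [eLpNorm_two_rpow, hdist, ENNReal.div_mul_cancel hA.vol_ne_zero hA.vol_ne_top]
  congr 1
  apply lintegral_congr
  intro x
  simp only [Pi.sub_apply, hell]
  rw [← sq_abs, ← Real.enorm_abs, Real.enorm_of_nonneg (abs_nonneg _),
    ENNReal.ofReal_rpow_of_nonneg (abs_nonneg _) (by norm_num), Real.rpow_two]

/-- A Hellinger-Cauchy sequence of states has a subsequence which converges almost everywhere,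
the limit having the same mass. -/
theorem exists_ae_limit (hA : A.IsRegular) {w : ℕ → V → ℝ≥0∞} (hw : ∀ k, A.IsState 1 (w k))
    (hc : ∀ ε > 0, ∃ K, ∀ m ≥ K, ∀ n ≥ K, A.hdist (w m) (w n) ≤ ε) :
    ∃ φ : ℕ → ℕ, StrictMono φ ∧ ∃ g : V → ℝ≥0∞, ∫⁻ x, g x ∂A.vol = A.vol Set.univ ∧
      (∀ x, g x ≠ ∞) ∧ ∀ᵐ x ∂A.vol, Tendsto (fun k => w (φ k) x) atTop (𝓝 (g x)) := by
  have hm := fun k => memLp_sqrt hA (hw k)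
  -- The square roots of states lie on a sphere of `L²`, on which the Hellinger distance is, up to
  -- normalization, the squared `L²` distance. Completeness gives a limit, and preservation of the
  -- norm is preservation of the mass.
  set F : ℕ → Lp ℝ 2 A.vol := fun k => (hm k).toLp
  have hF : CauchySeq F := by
    rw [EMetric.cauchySeq_iff]
    intro ε hε
    obtain ⟨η, hη, hηε⟩ : ∃ η : ℝ≥0∞, 0 < η ∧ (η * A.vol Set.univ) ^ (1 / 2 : ℝ) < ε := by
      have h1 : Tendsto (fun η : ℝ≥0∞ => (η * A.vol Set.univ) ^ (1 / 2 : ℝ)) (𝓝 0) (𝓝 0) := by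
        have := (ENNReal.continuous_rpow_const (y := 1 / 2)).comp
          (ENNReal.continuous_mul_const hA.vol_ne_top)
        simpa [Function.comp_def] using this.tendsto 0
      have h2 := (h1.mono_left (nhdsWithin_le_nhds (s := Set.Ioi 0))).eventually (gt_mem_nhds hε)
      obtain ⟨η, h3, h4⟩ := (h2.and self_mem_nhdsWithin).exists
      exact ⟨η, h4, h3⟩
    obtain ⟨K, hK⟩ := hc η hη
    refine ⟨K, fun m hm' n hn => ?_⟩
    rw [Lp.edist_toLp_toLp, eLpNorm_sqrt_sub hA]
    refine lt_of_le_of_lt ?_ hηε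
    gcongr
    exact hK m hm' n hn
  obtain ⟨G, hG⟩ := cauchySeq_tendsto_of_complete hF
  have hGn : eLpNorm G 2 A.vol = A.vol Set.univ ^ (1 / 2 : ℝ) := by
    have h1 := hG.enorm
    have h2 : (fun k => ‖F k‖ₑ) = fun _ => A.vol Set.univ ^ (1 / 2 : ℝ) := by
      ext k
      rw [Lp.enorm_toLp, eLpNorm_sqrt hA (hw k)]
    rw [h2] at h1
    rw [← Lp.enorm_def]
    exact tendsto_nhds_unique h1 tendsto_const_nhds
  have hlim := (Lp.tendsto_Lp_iff_tendsto_eLpNorm'' _ hm G (Lp.memLp G)).1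
    (by rw [Lp.toLp_coeFn]; exact hG)
  obtain ⟨φ, hφ, hφ'⟩ := (tendstoInMeasure_of_tendsto_eLpNorm (by norm_num)
    (fun k => (hm k).1) (Lp.memLp G).1 hlim).exists_seq_tendsto_ae
  refine ⟨φ, hφ, fun x => ‖G x‖ₑ ^ (2 : ℝ), ?_, fun x => by finiteness, ?_⟩
  · rw [eLpNorm_two_rpow] at hGn
    exact ENNReal.rpow_left_injective (by norm_num : (1 / 2 : ℝ) ≠ 0) hGn
  · have hfin : ∀ᵐ x ∂A.vol, ∀ k, w k x ≠ ∞ := ae_all_iff.2 fun k => (hw k).ae_ne_top hA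
    filter_upwards [hφ', hfin] with x hx hx'
    have := (ENNReal.continuous_rpow_const (y := 2)).tendsto _ |>.comp hx.enorm
    refine this.congr fun k => ?_
    simp only [Function.comp_apply]
    exact enorm_sqrt_sq _ (hx' _)

end

/-! ### Compactness: limits of states on a system. -/

section System

variable {V : Type*} [NormedAddCommGroup V] [NormedSpace ℝ V] [FiniteDimensional ℝ V]
  [MeasurableSpace V] [BorelSpace V] {A : Triple V} {u v : V → ℝ≥0∞}

/-- Mean value inequality: integrate `2 w(x) ≤ w(x + h) + w(x - h)` over `h` in a small ball and use
that all states have the same mass. -/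
theorem _root_.NAHam.IsSystem.exists_le_at_interior (hA : IsSystem A) {x : V}
    (hx : x ∈ interior A.body) : ∃ K : ℝ≥0∞, K ≠ ∞ ∧ ∀ w, A.IsState 1 w → w x ≤ K := by
  have : ProperSpace V := FiniteDimensional.proper ℝ V
  obtain ⟨r, hr, hrS⟩ := Metric.isOpen_iff.1 isOpen_interior x hx
  obtain ⟨ν, hν, hAν⟩ := hA.flat_vol
  have hB0 : ν (Metric.ball 0 r) ≠ 0 := (Metric.measure_ball_pos ν 0 hr).ne'
  have hBt : ν (Metric.ball 0 r) ≠ ∞ := measure_ball_lt_top.ne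
  refine ⟨A.vol Set.univ / ν (Metric.ball 0 r),
    ENNReal.div_ne_top hA.isRegular.vol_ne_top hB0, fun w hw => ?_⟩
  rw [ENNReal.le_div_iff_mul_le (Or.inl hB0) (Or.inl hBt)]
  set f := A.body.indicator w
  have hf : Measurable f := hw.lsc.measurable_indicator hA.isRegular.isClosed
  have hfm : ∫⁻ y, f y ∂ν = A.vol Set.univ := by
    rw [← hw.mass, hAν, lintegral_indicator hA.isRegular.isClosed.measurableSet]
  have hmem : ∀ h ∈ Metric.ball (0 : V) r, x + h ∈ A.body ∧ x - h ∈ A.body := by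
    intro h hh
    rw [mem_ball_zero_iff] at hh
    refine ⟨interior_subset (hrS ?_), interior_subset (hrS ?_)⟩ <;>
    · rw [mem_ball_iff_norm]
      simpa using hh
  have key : ∀ h ∈ Metric.ball (0 : V) r, 2 * w x ≤ f (x + h) + f (x - h) := by
    intro h hh
    obtain ⟨h1, h2⟩ := hmem h hh
    have := LogConvexOn.le_add hw.logConvex h1 h2 (t := 1 / 2) ⟨by norm_num, by norm_num⟩
    have he : (1 - 1 / 2 : ℝ) • (x + h) + (1 / 2 : ℝ) • (x - h) = x := by module
    rw [he] at this
    simp only [f, Set.indicator_of_mem h1, Set.indicator_of_mem h2]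
    have h3 : ENNReal.ofReal (1 - 1 / 2) = 2⁻¹ := by
      rw [show (1 - 1 / 2 : ℝ) = 2⁻¹ by norm_num, ENNReal.ofReal_inv_of_pos (by norm_num)]
      simp
    have h4 : ENNReal.ofReal (1 / 2) = 2⁻¹ := by rw [← h3]; norm_num
    rw [h3, h4, ← mul_add] at this
    calc 2 * w x ≤ 2 * (2⁻¹ * (w (x + h) + w (x - h))) := by gcongr
      _ = _ := by rw [← mul_assoc, ENNReal.mul_inv_cancel (by norm_num) (by norm_num), one_mul]
  have hint : ∫⁻ _ in Metric.ball (0 : V) r, 2 * w x ∂ν ≤ 2 * A.vol Set.univ := by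
    calc _ ≤ ∫⁻ h in Metric.ball (0 : V) r, (f (x + h) + f (x - h)) ∂ν :=
          setLIntegral_mono (by fun_prop) key
      _ ≤ ∫⁻ h, (f (x + h) + f (x - h)) ∂ν := setLIntegral_le_lintegral _ _
      _ = 2 * A.vol Set.univ := by
          rw [lintegral_add_left (by fun_prop), lintegral_add_left_eq_self,
            lintegral_sub_left_eq_self, hfm, two_mul]
  rw [lintegral_const, Measure.restrict_apply_univ, mul_assoc] at hint
  exact (ENNReal.mul_le_mul_iff_right (by norm_num) (by norm_num)).1 hint

theorem _root_.NAHam.IsSystem.convex (hA : IsSystem A) : Convex ℝ A.body :=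
  hA.isPolytope.convex

theorem _root_.NAHam.IsSystem.interior_nonempty (hA : IsSystem A) : (interior A.body).Nonempty :=
  hA.isPolytope.2.1

theorem _root_.NAHam.IsSystem.eqOn_interior (hA : IsSystem A) {f g : V → ℝ≥0∞}
    (hf : ContinuousOn f (interior A.body)) (hg : ContinuousOn g (interior A.body))
    (h : f =ᵐ[A.vol] g) : Set.EqOn f g (interior A.body) := by
  obtain ⟨ν, hν, hAν⟩ := hA.flat_vol
  rw [hAν] at h
  exact Measure.eqOn_open_of_ae_eq
    (ae_restrict_of_ae_restrict_of_subset interior_subset h) isOpen_interior hf hg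

/-- The limit state is the lower semicontinuous closure of the upper limit of an almost everywhere
convergent subsequence. Fatou's lemma on `P` gives the entropy bound. Almost everywhere convergence
says nothing on `∂P`; there log convexity along segments from an interior point bounds the limit
state by the pointwise lower limit, and Fatou's lemma for `dσ` applies. -/
theorem _root_.NAHam.IsSystem.exists_limit (hA : IsSystem A) {w : ℕ → V → ℝ≥0∞}
    (hw : ∀ k, A.IsState 1 (w k))
    (hc : ∀ ε > 0, ∃ K, ∀ m ≥ K, ∀ n ≥ K, A.hdist (w m) (w n) ≤ ε) :
    ∃ u, A.IsState 1 u ∧ ∃ φ : ℕ → ℕ, StrictMono φ ∧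
      A.ent u ≤ liminf (fun k => A.ent (w (φ k))) atTop ∧
      A.en u ≤ liminf (fun k => A.en (w (φ k))) atTop := by
  have hR := hA.isRegular
  obtain ⟨φ, hφ, g, hgm, hgfin, hg⟩ := exists_ae_limit hR hw hc
  set I := interior A.body
  have hIo : IsOpen I := isOpen_interior
  have hIc : Convex ℝ I := hA.convex.interior
  have hlogI : ∀ k, LogConvexOn I (w k) := fun k =>
    LogConvexOn.mono (S := A.body) (hw k).logConvex interior_subset
  -- upper limits along any sequence
  have hfin : ∀ θ : ℕ → ℕ, ∀ x ∈ I, limsup (fun k => w (θ k) x) atTop ≠ ∞ := by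
    intro θ x hx
    obtain ⟨K, hK, hKw⟩ := hA.exists_le_at_interior hx
    exact ne_top_of_le_ne_top hK (limsup_le_of_le (by isBoundedDefault)
      (Eventually.of_forall fun k => hKw _ (hw _)))
  have hlog : ∀ θ : ℕ → ℕ, LogConvexOn I fun x => limsup (fun k => w (θ k) x) atTop := fun θ =>
    logConvexOn_limsup (fun k => hlogI (θ k)) (hfin θ)
  have hcont : ∀ θ : ℕ → ℕ, ContinuousOn (fun x => limsup (fun k => w (θ k) x) atTop) I :=
    fun θ => (hlog θ).continuousOn hIc hIo (hfin θ)
  have hae : ∀ θ : ℕ → ℕ, Tendsto θ atTop atTop →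
      (fun x => limsup (fun k => w (φ (θ k)) x) atTop) =ᵐ[A.vol] g := by
    intro θ hθ
    filter_upwards [hg] with x hx
    exact (hx.comp hθ).limsup_eq
  set U : V → ℝ≥0∞ := fun x => limsup (fun k => w (φ k) x) atTop
  have hUg : U =ᵐ[A.vol] g := hae id tendsto_id
  -- Upper limits along further subsequences are continuous in the interior and almost everywhere
  -- equal to `g`, hence agree at every interior point.
  have hUθ : ∀ θ : ℕ → ℕ, Tendsto θ atTop atTop → ∀ x ∈ I,
      limsup (fun k => w (φ (θ k)) x) atTop = U x := fun θ hθ =>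
    hA.eqOn_interior (hcont (fun k => φ (θ k))) (hcont φ) ((hae θ hθ).trans hUg.symm)
  obtain ⟨x₀, hx₀, hne⟩ : ∃ x₀ ∈ I, U x₀ ≠ 0 := by
    by_contra! hcon
    have : ∫⁻ x, g x ∂A.vol = 0 := by
      rw [lintegral_congr_ae hUg.symm]
      refine lintegral_eq_zero_of_ae_eq_zero ?_
      filter_upwards [hA.vol_frontier] with x hx using hcon x hx
    exact hR.vol_ne_zero (hgm ▸ this)
  obtain ⟨hlsc, hpos, hlc, hI⟩ := lcl_props hA.convex hA.isCompact.isBounded (hlog φ) (hfin φ)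
    hx₀ hne
  have hug : lcl A.body U =ᵐ[A.vol] g := by
    filter_upwards [hA.vol_frontier, hUg] with x hx hx' using (hI x hx).trans hx'
  have hst : A.IsState 1 (lcl A.body U) :=
    IsState.mk' hR (hlsc.lowerSemicontinuousOn _) (fun x _ => hpos x) hlc
      (by rw [lintegral_congr_ae hug, hgm])
  refine ⟨lcl A.body U, hst, φ, hφ, ?_, ?_⟩
  · simp only [ent]
    rw [liminf_div_const _ hR.vol_ne_zero]
    refine ENNReal.div_le_div_right ?_ _
    have hm : ∀ k, AEMeasurable (fun x => kl (w (φ k) x)) A.vol := fun k => by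
      have := (hw (φ k)).aemeasurable_vol hR
      fun_prop
    refine le_trans ?_ (lintegral_liminf_le' hm)
    refine lintegral_mono_ae ?_
    filter_upwards [hug, hg] with x hx hx'
    rw [hx]
    have : ContinuousAt kl (g x) :=
      (ENNReal.continuous_ofReal.comp InformationTheory.continuous_klFun).continuousAt.comp
        (ENNReal.tendsto_toReal (hgfin x))
    exact (this.tendsto.comp hx').liminf_eq.ge
  · simp only [en]
    rw [liminf_div_const _ hR.vol_ne_zero]
    refine ENNReal.div_le_div_right ?_ _
    refine le_trans ?_ (lintegral_liminf_le' fun k => (hw (φ k)).aemeasurable_bdry hR)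
    refine lintegral_mono_ae ?_
    filter_upwards [hR.ae_bdry_mem] with x hx
    -- A subsequence realizing the lower limit `L` at the boundary point `x`. It depends on `x`, but
    -- its upper limit in the interior is still `U`, so log convexity gives `U ≤ U(x₀) ^ (1 - t) * L
    -- ^ t` on the segment.
    obtain ⟨θ, hθL, hθ⟩ := exists_seq_tendsto_liminf (f := atTop) (u := fun k => w (φ k) x)
    set L := liminf (fun k => w (φ k) x) atTop
    refine lcl_le_of_segment hA.convex hx₀ hx (a := U x₀) (hfin φ x₀ hx₀) fun t ht => ?_
    have hmem : (1 - t) • x₀ + t • x ∈ I :=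
      hA.convex.combo_interior_closure_mem_interior hx₀ (subset_closure hx)
        (by linarith [ht.2]) ht.1.le (by ring)
    have ht' : t ∈ Set.Icc (0 : ℝ) 1 := ⟨ht.1.le, ht.2.le⟩
    have ht1 : 0 < 1 - t := by linarith [ht.2]
    rw [← hUθ θ hθ _ hmem]
    refine le_trans ?_ (rpow_mul_rpow_le ht' _ _)
    refine (limsup_le_limsup (Eventually.of_forall fun k =>
      (hw (φ (θ k))).logConvex x₀ (interior_subset hx₀) x hx t ht')).trans ?_
    have e1 := limsup_rpow (l := atTop) (fun k => w (φ (θ k)) x₀) ht1.le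
    have e2 := limsup_rpow (l := atTop) (fun k => w (φ (θ k)) x) ht.1.le
    rw [hUθ θ hθ _ hx₀] at e1
    rw [show limsup (fun k => w (φ (θ k)) x) atTop = L from hθL.limsup_eq] at e2
    refine (ENNReal.limsup_mul_le' (Or.inl ?_) (Or.inl ?_)).trans (by rw [e1, e2])
    · rw [e1, Ne, ENNReal.rpow_eq_zero_iff_of_pos ht1]
      exact hne
    · rw [e1]
      exact ENNReal.rpow_ne_top_of_nonneg ht1.le (hfin φ x₀ hx₀)

end System

end Triple

/-! ### Entropy bounds and destabilizing states -/

section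

variable {V : Type*} [NormedAddCommGroup V] [NormedSpace ℝ V] [FiniteDimensional ℝ V]
  [MeasurableSpace V] [BorelSpace V] {A : Triple V} {u v : V → ℝ≥0∞}

/-- A convex function is continuous on the interior, and the frontier of a convex set is null. For
`dσ` this is applied inside each facet. -/
theorem aemeasurable_indicator_of_convexOn {ν : Measure V} [ν.IsAddHaarMeasure] {S : Set V}
    {q : V → ℝ} (hq : ConvexOn ℝ S q) (hS : MeasurableSet S) : AEMeasurable (S.indicator q) ν := by
  rw [aemeasurable_indicator_iff hS]
  have h1 : ν (frontier S) = 0 := hq.1.addHaar_frontier ν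
  have h2 : ν.restrict S = ν.restrict (interior S) := by
    refine Measure.restrict_congr_set ?_
    filter_upwards [measure_eq_zero_iff_ae_notMem.1 h1] with x hx
    refine propext ⟨fun h => ?_, fun h => interior_subset h⟩
    by_contra hni
    exact hx ⟨subset_closure h, hni⟩
  rw [h2]
  exact hq.continuousOn_interior.aemeasurable isOpen_interior.measurableSet

theorem IsSystem.aemeasurable_vol_of_convexOn (hA : IsSystem A) {q : V → ℝ}
    (hq : ConvexOn ℝ A.body q) : AEMeasurable q A.vol := by
  obtain ⟨ν, hν, h⟩ := hA.flat_vol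
  have hm := hA.isCompact.isClosed.measurableSet
  rw [h, ← aemeasurable_indicator_iff hm]
  exact aemeasurable_indicator_of_convexOn hq hm

theorem IsSystem.aemeasurable_bdry_of_convexOn (hA : IsSystem A) {q : V → ℝ}
    (hq : ConvexOn ℝ A.body q) : AEMeasurable q A.bdry := by
  classical
  obtain ⟨s, hP, hs⟩ := hA.isPolytope.exists_facets
  have hF : ∀ ℓ ∈ s, AEMeasurable q (A.bdry.restrict {x ∈ A.body | ℓ x = 0}) := by
    intro ℓ hℓ
    obtain ⟨x, hx, ν, hν, h⟩ := hA.flat_bdry _ (hs ℓ hℓ).2.1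
    have hFm : MeasurableSet {x ∈ A.body | ℓ x = 0} :=
      (hA.isCompact.isClosed.inter
        (isClosed_eq (affine_continuous ℓ) continuous_const)).measurableSet
    have hFc : Convex ℝ {x ∈ A.body | ℓ x = 0} := by
      refine hA.convex.inter ?_
      exact (convex_singleton (0 : ℝ)).affine_preimage ℓ
    have hemb := (isClosedEmbedding_coe_add
      (affineSpan ℝ {x ∈ A.body | ℓ x = 0}).direction x)
    rw [h, ← aemeasurable_indicator_iff hFm, hemb.measurableEmbedding.aemeasurable_map_iff]
    let φ : (affineSpan ℝ {x ∈ A.body | ℓ x = 0}).direction →ᵃ[ℝ] V :=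
      (Submodule.subtype _).toAffineMap + AffineMap.const ℝ _ x
    have hφ : (fun w : (affineSpan ℝ {x ∈ A.body | ℓ x = 0}).direction => (w : V) + x) = φ := by
      ext w; simp [φ]
    rw [hφ] at hemb ⊢
    have hq' := (hq.subset (fun _ h => h.1) hFc).comp_affineMap φ
    have := aemeasurable_indicator_of_convexOn (ν := ν) hq' (hemb.continuous.measurable hFm)
    exact this
  have hU : AEMeasurable q (A.bdry.restrict (⋃ ℓ ∈ s, {x ∈ A.body | ℓ x = 0})) := by
    clear hP hs
    induction s using Finset.induction_on with
    | empty => simp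
    | insert a s ha ih =>
      rw [Finset.set_biUnion_insert, aemeasurable_union_iff]
      exact ⟨hF a (by simp), ih fun ℓ hℓ => hF ℓ (by simp [hℓ])⟩
  rwa [Measure.restrict_eq_self_of_ae_mem] at hU
  filter_upwards [hA.ae_bdry_mem_frontier] with x hx
  exact frontier_subset_iUnion hA.isCompact.isClosed hP hx

/-- The lower bound comes from the uniform positivity of the log convex function `exp q`. -/
theorem IsSystem.exists_abs_le_of_convexOn (hA : IsSystem A) {q : V → ℝ}
    (hq : ConvexOn ℝ A.body q) : ∃ M, 0 ≤ M ∧ ∀ x ∈ A.body, |q x| ≤ M := by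
  obtain ⟨s, hP, hs⟩ := hA.isPolytope.exists_facets
  obtain ⟨M, hM⟩ := exists_forall_le_of_convexOn hA.isCompact hP hq
  obtain ⟨x₀, hx₀⟩ := hA.interior_nonempty
  have hlog : LogConvexOn A.body fun x => ENNReal.ofReal (Real.exp (q x)) := by
    intro x hx y hy t ht
    have h1 : 0 ≤ 1 - t := by linarith [ht.2]
    rw [ENNReal.ofReal_rpow_of_pos (Real.exp_pos _), ENNReal.ofReal_rpow_of_pos (Real.exp_pos _),
      ← ENNReal.ofReal_mul (by positivity), ← Real.exp_mul, ← Real.exp_mul, ← Real.exp_add]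
    refine ENNReal.ofReal_le_ofReal (Real.exp_le_exp.2 ?_)
    have := hq.2 hx hy h1 ht.1 (by ring)
    simp only [smul_eq_mul] at this
    linarith
  obtain ⟨c, hc, hcu⟩ := hlog.exists_pos_le hA.convex hA.isCompact.isBounded hx₀
    (fun _ _ => ENNReal.ofReal_ne_top) (by simp [Real.exp_pos])
  have hct : c ≠ ∞ := ne_top_of_le_ne_top ENNReal.ofReal_ne_top (hcu x₀ (interior_subset hx₀))
  refine ⟨max M (-Real.log c.toReal) ⊔ 0, le_max_right _ _, fun x hx => ?_⟩
  have h1 : Real.log c.toReal ≤ q x := by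
    have := ENNReal.toReal_mono ENNReal.ofReal_ne_top (hcu x hx)
    rw [ENNReal.toReal_ofReal (Real.exp_pos _).le] at this
    have h2 := Real.log_le_log (ENNReal.toReal_pos hc.ne' hct) this
    rwa [Real.log_exp] at h2
  refine le_trans ?_ (le_max_left _ _)
  rw [abs_le]
  constructor
  · have := le_max_right M (-Real.log c.toReal)
    linarith
  · exact (hM x hx).trans (le_max_left _ _)

/-- In dimension zero the frontier is empty and the Donaldson-Futaki invariant vanishes. -/
theorem IsSystem.finrank_pos (hA : IsSystem A) (hK : A.IsKUnstable) :
    0 < Module.finrank ℝ V := by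
  by_contra h0
  have : Subsingleton V := Module.finrank_zero_iff.1 (Nat.eq_zero_of_not_pos h0)
  obtain ⟨q, -, hq⟩ := hK
  obtain ⟨x₀, hx₀⟩ := hA.interior_nonempty
  have huniv : A.body = Set.univ := by
    ext x
    simpa [Subsingleton.elim x x₀] using interior_subset hx₀
  have hb : A.bdry = 0 := by
    have := hA.bdry_support
    rw [huniv, frontier_univ, Set.compl_empty] at this
    exact Measure.measure_univ_eq_zero.1 this
  simp [Triple.donaldsonFutaki, hb] at hq

theorem IsSystem.exists_ent_le (hA : IsSystem A) (hK : A.IsKUnstable) {a : ℝ≥0∞} (ha : a ≠ ∞) :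
    ∃ C : ℝ≥0∞, C ≠ ∞ ∧ ∀ u, A.IsState 1 u → A.en u ≤ a → A.ent u ≤ C := by
  have hn := hA.finrank_pos hK
  have hreg := hA.isRegular
  set n := Module.finrank ℝ V
  have hn' : (1 : ℝ) ≤ n := by exact_mod_cast hn
  -- An exponent larger than `1` that is admissible in every dimension: `q (n - 1) = n - 1 / n`.
  set q : ℝ := 1 + 1 / n with hq
  have hq1 : 1 < q := by rw [hq]; linarith [show (0 : ℝ) < 1 / n by positivity]
  have hqn : q * ((n : ℝ) - 1) ≤ n := by
    have h1 : 1 / (n : ℝ) * n = 1 := by field_simp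
    have : (0 : ℝ) < 1 / n := by positivity
    rw [hq]
    nlinarith
  obtain ⟨C, hC, hCu⟩ := hA.exists_lintegral_rpow_le hn hq1.le hqn
  have hat : (a * A.vol Set.univ) ^ q ≠ ∞ :=
    ENNReal.rpow_ne_top_of_nonneg (by linarith) (ENNReal.mul_ne_top ha hreg.vol_ne_top)
  refine ⟨(A.vol Set.univ + ENNReal.ofReal (1 / (q - 1)) * (C * (a * A.vol Set.univ) ^ q))
    / A.vol Set.univ, ENNReal.div_ne_top (ENNReal.add_ne_top.2 ⟨hreg.vol_ne_top,
      ENNReal.mul_ne_top ENNReal.ofReal_ne_top (ENNReal.mul_ne_top hC hat)⟩) hreg.vol_ne_zero,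
    fun u hu hua => ENNReal.div_le_div_right ?_ _⟩
  have hu' := hu.aemeasurable_vol hreg
  have hle : ∫⁻ x, u x ∂A.bdry ≤ a * A.vol Set.univ :=
    (ENNReal.div_le_iff hreg.vol_ne_zero hreg.vol_ne_top).1 hua
  calc ∫⁻ x, kl (u x) ∂A.vol
      ≤ ∫⁻ x, (1 + ENNReal.ofReal (1 / (q - 1)) * u x ^ q) ∂A.vol := by
        refine lintegral_mono_ae ?_
        filter_upwards [hu.ae_ne_top hreg] with x hx using kl_le_of_le hq1 hx
    _ = A.vol Set.univ + ENNReal.ofReal (1 / (q - 1)) * ∫⁻ x, u x ^ q ∂A.vol := by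
        rw [lintegral_add_left measurable_const, lintegral_one,
          lintegral_const_mul' _ _ ENNReal.ofReal_ne_top]
    _ ≤ _ := by
        gcongr
        exact (hCu u hu).trans (by gcongr)

/-- A K-unstable system has a bounded state of smaller energy than the constant state. -/
theorem IsSystem.exists_en_lt (hA : IsSystem A) (hK : A.IsKUnstable) :
    ∃ w, A.IsState 1 w ∧ (∃ M : ℝ≥0∞, M ≠ ∞ ∧ ∀ x ∈ A.body, w x ≤ M) ∧
      A.en w < A.en fun _ => 1 := by
  have hreg := hA.isRegular
  obtain ⟨q, hq, hDF⟩ := hK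
  have := hreg.finite_vol
  have := hreg.finite_bdry
  have hv0 : 0 < A.vol.real Set.univ :=
    ENNReal.toReal_pos hreg.vol_ne_zero hreg.vol_ne_top
  obtain ⟨M, hM0, hM⟩ := hA.exists_abs_le_of_convexOn hq
  set v := A.vol.real Set.univ with hv
  set b := A.bdry.real Set.univ with hb
  have hb0 : 0 ≤ b := measureReal_nonneg
  set Qb := ∫ x, q x ∂A.bdry
  set Qv := ∫ x, q x ∂A.vol
  have hD : 0 < b * Qv - v * Qb := by
    have h1 : Qb - b / v * Qv < 0 := by
      by_contra! h
      exact absurd hDF (not_lt.2 (mul_nonneg (div_nonneg (by positivity) hv0.le) h))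
    have h2 := mul_neg_of_pos_of_neg hv0 h1
    have h3 : v * (Qb - b / v * Qv) = v * Qb - b * Qv := by field_simp
    linarith
  set D := b * Qv - v * Qb
  -- The perturbation `exp (ε q)` changes `v ∫ dσ - b ∫ dμ` by `-ε D` to first order, with error at
  -- most `ε² M² b v`. The bound `ε M ≤ 1` validates the quadratic estimate of the exponential.
  obtain ⟨ε, hε, hεM, hεD⟩ : ∃ ε : ℝ, 0 < ε ∧ ε * M ≤ 1 ∧ ε * (M ^ 2 * b * v) < D := by
    refine ⟨min (1 / (M + 1)) (D / (M ^ 2 * b * v + 1)), by positivity, ?_, ?_⟩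
    · calc _ ≤ 1 / (M + 1) * M := by gcongr; exact min_le_left _ _
        _ ≤ 1 := by rw [div_mul_eq_mul_div, one_mul, div_le_one (by positivity)]; linarith
    · have hX : 0 ≤ M ^ 2 * b * v := by positivity
      calc _ ≤ D / (M ^ 2 * b * v + 1) * (M ^ 2 * b * v) := by gcongr; exact min_le_right _ _
        _ < D := by rw [div_mul_eq_mul_div, div_lt_iff₀ (by positivity)]; nlinarith
  set e : V → ℝ := fun x => Real.exp (ε * q x) with he
  set u₀ : V → ℝ≥0∞ := fun x => ENNReal.ofReal (e x) with hu₀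
  have hlog : LogConvexOn A.body u₀ := by
    intro x hx y hy t ht
    have h1 : 0 ≤ 1 - t := by linarith [ht.2]
    simp only [hu₀, he]
    rw [ENNReal.ofReal_rpow_of_pos (Real.exp_pos _), ENNReal.ofReal_rpow_of_pos (Real.exp_pos _),
      ← ENNReal.ofReal_mul (by positivity), ← Real.exp_mul, ← Real.exp_mul, ← Real.exp_add]
    refine ENNReal.ofReal_le_ofReal (Real.exp_le_exp.2 ?_)
    have := hq.2 hx hy h1 ht.1 (by ring)
    simp only [smul_eq_mul] at this
    nlinarith
  obtain ⟨x₀, hx₀⟩ := hA.interior_nonempty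
  have hfin : ∀ x, u₀ x ≠ ∞ := fun x => ENNReal.ofReal_ne_top
  have hpos0 : ∀ x, u₀ x ≠ 0 := fun x => by simp [hu₀, he, Real.exp_pos]
  obtain ⟨hlsc, hpos, hlc, hI⟩ := lcl_props hA.convex hA.isCompact.isBounded
    (hlog.mono interior_subset) (fun x _ => hfin x) hx₀ (hpos0 x₀)
  set l := lcl A.body u₀
  -- A convex `q` need not be lower semicontinuous. Passing to the closure keeps the volume integral
  -- and can only lower the boundary integral.
  have hle : ∀ x ∈ A.body, l x ≤ u₀ x := fun x hx =>
    lcl_le_of_segment hA.convex hx₀ hx (hfin x₀) fun t ht =>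
      hlog.le_add (interior_subset hx₀) hx ⟨ht.1.le, ht.2.le⟩
  have hupper : ∀ x ∈ A.body, e x ≤ Real.exp 1 := fun x hx => by
    refine Real.exp_le_exp.2 (le_trans ?_ hεM)
    exact mul_le_mul_of_nonneg_left ((le_abs_self _).trans (hM x hx)) hε.le
  have hbody_v := hreg.ae_vol_mem
  have hbody_b := hreg.ae_bdry_mem
  have hqv := hA.aemeasurable_vol_of_convexOn hq
  have hqb := hA.aemeasurable_bdry_of_convexOn hq
  have iqv : Integrable q A.vol := Integrable.of_bound hqv.aestronglyMeasurable M
    (hbody_v.mono fun x hx => hM x hx)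
  have iqb : Integrable q A.bdry := Integrable.of_bound hqb.aestronglyMeasurable M
    (hbody_b.mono fun x hx => hM x hx)
  have iev : Integrable e A.vol := Integrable.of_bound
    (by fun_prop : AEMeasurable e A.vol).aestronglyMeasurable (Real.exp 1)
    (hbody_v.mono fun x hx => by
      rw [Real.norm_of_nonneg (Real.exp_pos _).le]; exact hupper x hx)
  have ieb : Integrable e A.bdry := Integrable.of_bound
    (by fun_prop : AEMeasurable e A.bdry).aestronglyMeasurable (Real.exp 1)
    (hbody_b.mono fun x hx => by
      rw [Real.norm_of_nonneg (Real.exp_pos _).le]; exact hupper x hx)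
  set Zr := ∫ x, e x ∂A.vol with hZr
  have hZ : ∫⁻ x, l x ∂A.vol = ENNReal.ofReal Zr := by
    rw [ofReal_integral_eq_lintegral_ofReal iev (Eventually.of_forall fun x => (Real.exp_pos _).le)]
    refine lintegral_congr_ae ?_
    filter_upwards [hA.vol_frontier] with x hx using hI x hx
  have hB : ∫⁻ x, l x ∂A.bdry ≤ ENNReal.ofReal (∫ x, e x ∂A.bdry) := by
    rw [ofReal_integral_eq_lintegral_ofReal ieb (Eventually.of_forall fun x => (Real.exp_pos _).le)]
    refine lintegral_mono_ae ?_
    filter_upwards [hbody_b] with x hx using hle x hx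
  have hZlow : v + ε * Qv ≤ Zr := by
    have : ∫ x, (1 + ε * q x) ∂A.vol = v + ε * Qv := by
      rw [integral_add (integrable_const _) (iqv.const_mul _), integral_const, integral_const_mul]
      simp [hv, Qv]
    rw [← this]
    refine integral_mono ((integrable_const _).add (iqv.const_mul _)) iev fun x => ?_
    have := Real.add_one_le_exp (ε * q x)
    simp only [he]
    linarith
  have hBup : ∫ x, e x ∂A.bdry ≤ b + ε * Qb + ε ^ 2 * M ^ 2 * b := by
    have : ∫ x, (1 + ε * q x + ε ^ 2 * M ^ 2) ∂A.bdry = b + ε * Qb + ε ^ 2 * M ^ 2 * b := by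
      rw [integral_add (f := fun x => 1 + ε * q x) ((integrable_const _).add (iqb.const_mul _))
        (integrable_const _),
        integral_add (integrable_const _) (iqb.const_mul _), integral_const, integral_const,
        integral_const_mul]
      simp only [hb, Qb, smul_eq_mul]
      ring
    rw [← this]
    refine integral_mono_ae ieb
      (((integrable_const _).add (iqb.const_mul _)).add (integrable_const _)) ?_
    filter_upwards [hbody_b] with x hx
    have h1 : |ε * q x| ≤ ε * M := by
      rw [abs_mul, abs_of_pos hε]
      exact mul_le_mul_of_nonneg_left (hM x hx) hε.le
    have h2 := Real.abs_exp_sub_one_sub_id_le (h1.trans hεM)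
    have h3 := (abs_le.1 h2).2
    have h4 : (ε * q x) ^ 2 ≤ (ε * M) ^ 2 := by
      rw [← sq_abs]
      gcongr
    simp only [he]
    nlinarith
  have : NeZero A.vol := ⟨fun h0 => hreg.vol_ne_zero (by simp [h0])⟩
  have hZpos : 0 < Zr := integral_exp_pos iev
  have hZ0 : ENNReal.ofReal Zr ≠ 0 := by simpa using hZpos
  set c : ℝ≥0∞ := A.vol Set.univ / ENNReal.ofReal Zr
  have hc0 : c ≠ 0 := (ENNReal.div_pos hreg.vol_ne_zero ENNReal.ofReal_ne_top).ne'
  have hct : c ≠ ∞ := ENNReal.div_ne_top hreg.vol_ne_top hZ0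
  have hlm : Measurable l := hlsc.measurable
  have hst : A.IsState 1 fun x => c * l x := by
    refine Triple.IsState.mk' hreg
      ((hlsc.lowerSemicontinuousOn _).const_mul_ennreal hct)
      (fun x _ => ENNReal.mul_pos hc0 (hpos x).ne') ?_ ?_
    · intro x hx y hy t ht
      have h1 : 0 ≤ 1 - t := by linarith [ht.2]
      rw [ENNReal.mul_rpow_of_nonneg _ _ h1, ENNReal.mul_rpow_of_nonneg _ _ ht.1,
        mul_mul_mul_comm, ← ENNReal.rpow_add _ _ hc0 hct, sub_add_cancel, ENNReal.rpow_one]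
      exact mul_le_mul_right (hlc x hx y hy t ht) c
    · rw [lintegral_const_mul _ hlm, hZ, ENNReal.div_mul_cancel hZ0 ENNReal.ofReal_ne_top]
  refine ⟨_, hst, ⟨c * ENNReal.ofReal (Real.exp 1), ENNReal.mul_ne_top hct ENNReal.ofReal_ne_top,
    fun x hx => mul_le_mul_right ((hle x hx).trans (ENNReal.ofReal_le_ofReal (hupper x hx))) c⟩, ?_⟩
  simp only [Triple.en]
  refine ENNReal.div_lt_div_right hreg.vol_ne_zero hreg.vol_ne_top ?_
  rw [lintegral_const_mul _ hlm, lintegral_one]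
  have hfinal : v / Zr * ∫ x, e x ∂A.bdry < b := by
    rw [div_mul_eq_mul_div, div_lt_iff₀ hZpos]
    have h1 := mul_le_mul_of_nonneg_left hBup hv0.le
    have h2 := mul_le_mul_of_nonneg_left hZlow hb0
    have h3 : ε * (ε * (M ^ 2 * b * v)) < ε * D := mul_lt_mul_of_pos_left hεD hε
    simp only [D] at h3
    nlinarith
  calc c * ∫⁻ x, l x ∂A.bdry ≤ c * ENNReal.ofReal (∫ x, e x ∂A.bdry) := by gcongr
    _ = ENNReal.ofReal (v / Zr * ∫ x, e x ∂A.bdry) := by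
        rw [ENNReal.ofReal_mul (by positivity), ENNReal.ofReal_div_of_pos hZpos, hv,
          Measure.real, ENNReal.ofReal_toReal hreg.vol_ne_top]
    _ < ENNReal.ofReal b := by
        refine (ENNReal.ofReal_lt_ofReal_iff_of_nonneg ?_).2 hfinal
        exact mul_nonneg (by positivity) (integral_nonneg fun x => (Real.exp_pos _).le)
    _ = A.bdry Set.univ := by rw [hb, Measure.real, ENNReal.ofReal_toReal (measure_ne_top _ _)]

end

/-! ### Existence of minimizers -/

/-- The standard argument that minimizing sequences of a uniformly convex functional are Cauchy: the
distance is squeezed by `r K - l K`, which tends to zero. -/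
theorem exists_le_of_add_mul_le {h : ℕ → ℕ → ℝ≥0∞} {l r : ℕ → ℝ≥0∞} {c s : ℝ≥0∞} (hc : c ≠ 0)
    (hc' : c ≠ ∞) (hs : s ≠ ∞) (hl : Tendsto l atTop (𝓝 s)) (hr : Tendsto r atTop (𝓝 s))
    (hle : ∀ K, ∀ m ≥ K, ∀ n ≥ K, l K + c * h m n ≤ r K) :
    ∀ ε > 0, ∃ K, ∀ m ≥ K, ∀ n ≥ K, h m n ≤ ε := by
  intro ε hε
  have h1 : Tendsto (fun K => r K - l K) atTop (𝓝 0) := by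
    simpa using ENNReal.Tendsto.sub hr hl (Or.inl hs)
  have h2 : ∀ᶠ K in atTop, r K - l K < c * ε := h1.eventually (gt_mem_nhds (by positivity))
  have h3 : ∀ᶠ K in atTop, l K < ∞ := hl.eventually (gt_mem_nhds hs.lt_top)
  obtain ⟨K, hK, hK'⟩ := (h2.and h3).exists
  refine ⟨K, fun m hm n hn => ?_⟩
  have h4 : c * h m n ≤ r K - l K := ENNReal.le_sub_of_add_le_left hK'.ne (hle K m hm n hn)
  exact (ENNReal.mul_le_mul_iff_right hc hc').1 (h4.trans hK.le)

theorem exists_mix_eq {x y z : ℝ≥0∞} (hxy : x ≤ y) (hyz : y ≤ z) (hz : z ≠ ∞) :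
    ∃ t ∈ Set.Icc (0 : ℝ) 1, y = ENNReal.ofReal (1 - t) * x + ENNReal.ofReal t * z := by
  have hy : y ≠ ∞ := ne_top_of_le_ne_top hz hyz
  have hx : x ≠ ∞ := ne_top_of_le_ne_top hy hxy
  have h1 := ENNReal.toReal_mono hy hxy
  have h2 := ENNReal.toReal_mono hz hyz
  obtain ⟨t, ht, h⟩ : ∃ t ∈ Set.Icc (0 : ℝ) 1, y.toReal = (1 - t) * x.toReal + t * z.toReal := by
    rcases (h1.trans h2).eq_or_lt with h | h
    · exact ⟨0, by simp, by simp; linarith⟩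
    · refine ⟨(y.toReal - x.toReal) / (z.toReal - x.toReal),
        ⟨div_nonneg (by linarith) (by linarith), (div_le_one (by linarith)).2 (by linarith)⟩, ?_⟩
      have : z.toReal - x.toReal ≠ 0 := by linarith
      field_simp
      ring
  refine ⟨t, ht, (ENNReal.toReal_eq_toReal_iff' hy (by finiteness)).1 ?_⟩
  rw [toReal_mix ht hx hz, h]

namespace Triple

/-- The infimum of the negative entropy over all states of energy at most `a`. -/
noncomputable def entInf {V : Type*} [NormedAddCommGroup V] [NormedSpace ℝ V] [MeasurableSpace V]
    (A : Triple V) (a : ℝ≥0∞) : ℝ≥0∞ :=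
  ⨅ (u : V → ℝ≥0∞) (_ : A.IsState 1 u) (_ : A.en u ≤ a), A.ent u

section

variable {V : Type*} [NormedAddCommGroup V] [NormedSpace ℝ V]
  [MeasurableSpace V] {A : Triple V} {u v : V → ℝ≥0∞} {a b : ℝ≥0∞}

theorem entInf_le (hu : A.IsState 1 u) (h : A.en u ≤ a) : A.entInf a ≤ A.ent u :=
  iInf_le_of_le u (iInf_le_of_le hu (iInf_le_of_le h le_rfl))

theorem entInf_antitone (A : Triple V) : Antitone A.entInf := fun _ _ hab =>
  le_iInf fun _ => le_iInf fun hu => le_iInf fun h => entInf_le hu (h.trans hab)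

theorem exists_of_entInf_lt (h : A.entInf a < b) :
    ∃ u, A.IsState 1 u ∧ A.en u ≤ a ∧ A.ent u < b := by
  simp only [entInf, iInf_lt_iff] at h
  obtain ⟨u, hu, h1, h2⟩ := h
  exact ⟨u, hu, h1, h2⟩

end

end Triple

section

open Triple

variable {V : Type*} [NormedAddCommGroup V] [NormedSpace ℝ V] [FiniteDimensional ℝ V]
  [MeasurableSpace V] [BorelSpace V] {A : Triple V} {u v : V → ℝ≥0∞}

theorem half_mul_add_half_mul (x : ℝ≥0∞) :
    ENNReal.ofReal (1 - 1 / 2) * x + ENNReal.ofReal (1 / 2) * x = x := by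
  rw [← add_mul, ← ENNReal.ofReal_add (by norm_num) (by norm_num)]
  norm_num

/-- The infimum of the negative entropy is attained, and continuous from the right in the energy. -/
theorem IsSystem.exists_le_iSup_entInf (hA : IsSystem A) (hK : A.IsKUnstable) {a : ℝ≥0∞}
    (ha : a ≠ ∞) (h : ∀ b, a < b → ∃ u, A.IsState 1 u ∧ A.en u ≤ b) :
    ∃ u, A.IsState 1 u ∧ A.en u ≤ a ∧
      A.ent u ≤ ⨆ k : ℕ, A.entInf (a + ((k : ℝ≥0∞) + 1)⁻¹) := by
  have hreg := hA.isRegular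
  set b : ℕ → ℝ≥0∞ := fun k => a + ((k : ℝ≥0∞) + 1)⁻¹ with hb
  have hbt : ∀ k, b k ≠ ∞ := fun k => by simp [hb, ha]
  have hab : ∀ k, a < b k := fun k => ENNReal.lt_add_right ha (by simp)
  have hbanti : Antitone b := fun i j hij => by
    simp only [hb]
    gcongr
  have hblim : Tendsto b atTop (𝓝 a) := by
    have h1 : Tendsto (fun k : ℕ => ((k : ℝ≥0∞) + 1)⁻¹) atTop (𝓝 0) := by
      have := (tendsto_add_atTop_iff_nat 1).2 ENNReal.tendsto_inv_nat_nhds_zero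
      simpa using this
    simpa using tendsto_const_nhds.add h1
  set s := ⨆ k, A.entInf (b k) with hs
  have hmono : Monotone fun k => A.entInf (b k) := fun i j hij => entInf_antitone A (hbanti hij)
  have hst : s ≠ ∞ := by
    obtain ⟨C, hC, hCu⟩ := hA.exists_ent_le hK (hbt 0)
    refine ne_top_of_le_ne_top hC (iSup_le fun k => ?_)
    obtain ⟨u, hu, hub⟩ := h (b k) (hab k)
    exact (entInf_le hu hub).trans (hCu u hu (hub.trans (hbanti (Nat.zero_le k))))
  have hηt : ∀ k, A.entInf (b k) ≠ ∞ := fun k =>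
    ne_top_of_le_ne_top hst (le_iSup (fun k => A.entInf (b k)) k)
  have hηlim : Tendsto (fun k => A.entInf (b k)) atTop (𝓝 s) := tendsto_atTop_iSup hmono
  have hex : ∀ k : ℕ, ∃ u, A.IsState 1 u ∧ A.en u ≤ b k ∧
      A.ent u < A.entInf (b k) + ((k : ℝ≥0∞) + 1)⁻¹ := fun k =>
    exists_of_entInf_lt (ENNReal.lt_add_right (hηt k) (by simp))
  choose w hw hwb hwe using hex
  have hrlim : Tendsto (fun k : ℕ => s + ((k : ℝ≥0∞) + 1)⁻¹) atTop (𝓝 s) := by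
    have h1 : Tendsto (fun k : ℕ => ((k : ℝ≥0∞) + 1)⁻¹) atTop (𝓝 0) := by
      have := (tendsto_add_atTop_iff_nat 1).2 ENNReal.tendsto_inv_nat_nhds_zero
      simpa using this
    simpa using tendsto_const_nhds.add h1
  -- For `i, j ≥ K` the midpoint has energy at most `b K`, so its negative entropy is at least
  -- `entInf (b K)`, while both ends have at most `s + 1 / (K + 1)`.
  have hcauchy := exists_le_of_add_mul_le (h := fun i j => A.hdist (w i) (w j))
    (c := ENNReal.ofReal (1 / 4)) (by simp) (by simp) hst hηlim hrlim (fun K i hi j hj => by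
      have hwi : ∀ i ≥ K, A.en (w i) ≤ b K ∧ A.ent (w i) ≤ s + ((K : ℝ≥0∞) + 1)⁻¹ := fun i hi =>
        ⟨(hwb i).trans (hbanti hi), (hwe i).le.trans (add_le_add
          (le_iSup (fun k => A.entInf (b k)) i) (by gcongr))⟩
      obtain ⟨i1, i2⟩ := hwi i hi
      obtain ⟨j1, j2⟩ := hwi j hj
      have hm := IsState.mix (t := 1 / 2) ⟨by norm_num, by norm_num⟩ hreg (hw i) (hw j)
      have h1 : A.en (mix (1 / 2) (w i) (w j)) ≤ b K := by
        rw [en_mix hreg (hw i) (hw j)]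
        calc _ ≤ ENNReal.ofReal (1 - 1 / 2) * b K + ENNReal.ofReal (1 / 2) * b K := by gcongr
          _ = _ := half_mul_add_half_mul _
      refine (add_le_add_left (entInf_le hm h1) _).trans
        ((ent_mix_gap hreg (hw i) (hw j)).trans ?_)
      calc _ ≤ ENNReal.ofReal (1 - 1 / 2) * (s + ((K : ℝ≥0∞) + 1)⁻¹)
            + ENNReal.ofReal (1 / 2) * (s + ((K : ℝ≥0∞) + 1)⁻¹) := by gcongr
        _ = _ := half_mul_add_half_mul _)
  obtain ⟨u, hu, φ, hφ, hent, hen⟩ := hA.exists_limit hw hcauchy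
  refine ⟨u, hu, hen.trans ?_, hent.trans ?_⟩
  · rw [← (hblim.comp hφ.tendsto_atTop).liminf_eq]
    exact liminf_le_liminf (Eventually.of_forall fun k => hwb (φ k))
  · rw [← (hrlim.comp hφ.tendsto_atTop).liminf_eq]
    exact liminf_le_liminf (Eventually.of_forall fun k => (hwe (φ k)).le.trans
      (add_le_add_left (le_iSup (fun k => A.entInf (b k)) (φ k)) _))

/-- The states `w k` need not converge. For each `j` the limit `α` is at least the infimum at the
energy level `a + 1 / (j + 1)`, and the supremum of these infima bounds the negative entropy of some
state of energy at most `a`. -/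
theorem IsSystem.exists_of_tendsto (hA : IsSystem A) (hK : A.IsKUnstable) {a α : ℝ≥0∞}
    (ha : a ≠ ∞) {w : ℕ → V → ℝ≥0∞} (hw : ∀ k, A.IsState 1 (w k))
    (hen : Tendsto (fun k => A.en (w k)) atTop (𝓝 a))
    (hent : Tendsto (fun k => A.ent (w k)) atTop (𝓝 α)) :
    ∃ u, A.IsState 1 u ∧ A.en u ≤ a ∧ A.ent u ≤ α := by
  obtain ⟨u, hu, h1, h2⟩ := hA.exists_le_iSup_entInf hK ha fun b hb => by
    obtain ⟨k, hk⟩ := (hen.eventually (gt_mem_nhds hb)).exists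
    exact ⟨w k, hw k, hk.le⟩
  refine ⟨u, hu, h1, h2.trans (iSup_le fun j => ?_)⟩
  have hlt : a < a + ((j : ℝ≥0∞) + 1)⁻¹ := ENNReal.lt_add_right ha (by simp)
  refine ge_of_tendsto hent ?_
  filter_upwards [hen.eventually (gt_mem_nhds hlt)] with k hk
  exact entInf_le (hw k) hk.le

/-- A state of minimal energy, of maximal entropy among these. -/
theorem IsSystem.exists_min_en (hA : IsSystem A) (hK : A.IsKUnstable) :
    ∃ u, A.IsState 1 u ∧ A.en u ≠ ∞ ∧ (∀ v, A.IsState 1 v → A.en u ≤ A.en v) ∧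
      ∀ v, A.IsState 1 v → A.en v ≤ A.en u → A.ent u ≤ A.ent v := by
  have hreg := hA.isRegular
  set m := ⨅ (u : V → ℝ≥0∞) (_ : A.IsState 1 u), A.en u with hm
  have hle : ∀ v, A.IsState 1 v → m ≤ A.en v := fun v hv => iInf_le_of_le v (iInf_le _ hv)
  have hmt : m ≠ ∞ := ne_top_of_le_ne_top (en_one_ne_top hreg) (hle _ (IsState.one hreg))
  obtain ⟨u, hu, h1, h2⟩ := hA.exists_le_iSup_entInf hK hmt fun b hb => by
    simp only [hm, iInf_lt_iff] at hb
    obtain ⟨u, hu, h⟩ := hb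
    exact ⟨u, hu, h.le⟩
  refine ⟨u, hu, ne_top_of_le_ne_top hmt h1, fun v hv => h1.trans (hle v hv), fun v hv hvu =>
    h2.trans (iSup_le fun j => entInf_le hv ((hvu.trans h1).trans le_self_add))⟩

theorem Triple.IsState.ent_mix_one_le (hreg : A.IsRegular) (hu : A.IsState 1 u) {t : ℝ}
    (ht : t ∈ Set.Icc (0 : ℝ) 1) : A.ent (NAHam.mix t u fun _ => 1) ≤ A.ent u := by
  refine (ent_mix_le ht hreg hu (IsState.one hreg)).trans ?_
  rw [ent_one, mul_zero, add_zero]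
  exact mul_le_of_le_one_left' (by simpa using ht.1)

/-- Existence of equilibria. -/
theorem IsSystem.exists_en_eq (hA : IsSystem A) (hK : A.IsKUnstable) {a : ℝ≥0∞}
    (h : ∃ u, A.IsState 1 u ∧ A.en u ≤ a) (ha : a ≤ A.en fun _ => 1) :
    ∃ u, A.IsState 1 u ∧ A.en u = a ∧ A.ent u ≠ ∞ ∧
      ∀ v, A.IsState 1 v → A.en v ≤ a → A.ent u ≤ A.ent v := by
  have hreg := hA.isRegular
  have hat : a ≠ ∞ := ne_top_of_le_ne_top (en_one_ne_top hreg) ha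
  obtain ⟨u, hu, h1, h2⟩ := hA.exists_le_iSup_entInf hK hat fun b hb => by
    obtain ⟨u, hu, h⟩ := h
    exact ⟨u, hu, h.trans hb.le⟩
  have hmin : ∀ v, A.IsState 1 v → A.en v ≤ a → A.ent u ≤ A.ent v := fun v hv hva =>
    h2.trans (iSup_le fun j => entInf_le hv (hva.trans le_self_add))
  -- Mixing with the constant state raises the energy to exactly `a` and does not raise the negative
  -- entropy.
  obtain ⟨t, ht, hta⟩ := exists_mix_eq h1 ha (en_one_ne_top hreg)
  obtain ⟨C, hC, hCu⟩ := hA.exists_ent_le hK hat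
  exact ⟨_, IsState.mix ht hreg hu (IsState.one hreg), by
    rw [en_mix hreg hu (IsState.one hreg), hta],
    ne_top_of_le_ne_top hC ((hu.ent_mix_one_le hreg ht).trans (hCu u hu h1)),
    fun v hv hva => (hu.ent_mix_one_le hreg ht).trans (hmin v hv hva)⟩

/-- Minimizers of the free energy at positive temperature. -/
theorem IsSystem.exists_min_free (hA : IsSystem A) (hK : A.IsKUnstable) {τ : ℝ≥0∞} (hτ : τ ≠ ∞) :
    ∃ u, A.IsState 1 u ∧ A.en u ≠ ∞ ∧
      ∀ v, A.IsState 1 v → A.en u + τ * A.ent u ≤ A.en v + τ * A.ent v := by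
  have hreg := hA.isRegular
  set S : Set ℝ≥0∞ := (fun u => A.en u + τ * A.ent u) '' {u | A.IsState 1 u}
  have h1S : (A.en fun _ => 1) ∈ S := ⟨fun _ => 1, IsState.one hreg, by simp [ent_one]⟩
  obtain ⟨f, -, hf, hfS⟩ := exists_seq_tendsto_sInf ⟨_, h1S⟩ (OrderBot.bddBelow S)
  choose w hw hwf using hfS
  -- Only the values of energy and negative entropy need to converge, and they do along a
  -- subsequence since `[0, ∞]²` is compact.
  obtain ⟨⟨a, α⟩, φ, hφ, hlim⟩ := CompactSpace.tendsto_subseq fun k => (A.en (w k), A.ent (w k))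
  have hen : Tendsto (fun k => A.en (w (φ k))) atTop (𝓝 a) := (continuous_fst.tendsto _).comp hlim
  have hent : Tendsto (fun k => A.ent (w (φ k))) atTop (𝓝 α) :=
    (continuous_snd.tendsto _).comp hlim
  have hsum : a + τ * α = sInf S := by
    refine tendsto_nhds_unique (hen.add (ENNReal.Tendsto.const_mul hent (Or.inr hτ)))
      ((hf.comp hφ.tendsto_atTop).congr fun k => ?_)
    exact (hwf (φ k)).symm
  have hle1 : sInf S ≤ A.en fun _ => 1 := sInf_le h1S
  have ha : a ≠ ∞ := ne_top_of_le_ne_top (en_one_ne_top hreg)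
    (le_self_add.trans (hsum.le.trans hle1))
  obtain ⟨u, hu, h1, h2⟩ := hA.exists_of_tendsto hK ha (fun k => hw (φ k)) hen hent
  refine ⟨u, hu, ne_top_of_le_ne_top ha h1, fun v hv => ?_⟩
  calc A.en u + τ * A.ent u ≤ a + τ * α := by gcongr
    _ = sInf S := hsum
    _ ≤ _ := sInf_le ⟨v, hv, rfl⟩

end

section Pair

open Triple

variable {V W : Type*} [NormedAddCommGroup V] [NormedSpace ℝ V] [FiniteDimensional ℝ V]
  [MeasurableSpace V] [BorelSpace V] [NormedAddCommGroup W] [NormedSpace ℝ W]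
  [FiniteDimensional ℝ W] [MeasurableSpace W] [BorelSpace W] {A : Triple V} {R : Triple W}

/-- Minimizers of the sum of the negative entropies at given total energy. -/
theorem exists_min_pair (hA : IsSystem A) (hR : IsSystem R) (hAK : A.IsKUnstable)
    (hRK : R.IsKUnstable) (N : ℕ) {a b : ℝ≥0∞} (ha : ∃ u, A.IsState 1 u ∧ A.en u ≤ a)
    (hb : ∃ v, R.IsState 1 v ∧ R.en v ≤ b) (ha1 : a ≤ A.en fun _ => 1)
    (hb1 : b ≤ R.en fun _ => 1) :
    ∃ u v, A.IsState 1 u ∧ R.IsState 1 v ∧ A.en u + N * R.en v = a + N * b ∧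
      ∀ u' v', A.IsState 1 u' → R.IsState 1 v' → A.en u' + N * R.en v' = a + N * b →
        A.ent u + N * R.ent v ≤ A.ent u' + N * R.ent v' := by
  have hAreg := hA.isRegular
  have hRreg := hR.isRegular
  rcases Nat.eq_zero_or_pos N with rfl | hN
  · obtain ⟨u, hu, hua, -, hmin⟩ := hA.exists_en_eq hAK ha ha1
    refine ⟨u, fun _ => 1, hu, IsState.one hRreg, by simp [hua], fun u' v' hu' _ h => ?_⟩
    simp only [Nat.cast_zero, zero_mul, add_zero] at h ⊢
    exact hmin u' hu' h.le
  have hat : a ≠ ∞ := ne_top_of_le_ne_top (en_one_ne_top hAreg) ha1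
  have hbt : b ≠ ∞ := ne_top_of_le_ne_top (en_one_ne_top hRreg) hb1
  have hN0 : (N : ℝ≥0∞) ≠ 0 := by exact_mod_cast hN.ne'
  have hNt : (N : ℝ≥0∞) ≠ ∞ := ENNReal.natCast_ne_top N
  set c := a + N * b with hc
  have hct : c ≠ ∞ := ENNReal.add_ne_top.2 ⟨hat, ENNReal.mul_ne_top hNt hbt⟩
  -- The energy constraint is relaxed to an inequality, which survives lower semicontinuous limits.
  -- Equality is restored below by mixing both components with the constant states, with the same
  -- weight.
  set S : Set ℝ≥0∞ := {x | ∃ u v, A.IsState 1 u ∧ R.IsState 1 v ∧ A.en u + N * R.en v ≤ c ∧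
    A.ent u + N * R.ent v = x}
  have hSne : S.Nonempty := by
    obtain ⟨u, hu, hua⟩ := ha
    obtain ⟨v, hv, hvb⟩ := hb
    exact ⟨_, u, v, hu, hv, by rw [hc]; gcongr, rfl⟩
  obtain ⟨f, -, hf, hfS⟩ := exists_seq_tendsto_sInf hSne (OrderBot.bddBelow S)
  choose w z hw hz hwz hwzf using hfS
  obtain ⟨⟨⟨a', α⟩, ⟨b', β⟩⟩, φ, hφ, hlim⟩ := CompactSpace.tendsto_subseq fun k =>
    ((A.en (w k), A.ent (w k)), (R.en (z k), R.ent (z k)))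
  have hwen : Tendsto (fun k => A.en (w (φ k))) atTop (𝓝 a') :=
    ((continuous_fst.comp continuous_fst).tendsto _).comp hlim
  have hwent : Tendsto (fun k => A.ent (w (φ k))) atTop (𝓝 α) :=
    ((continuous_snd.comp continuous_fst).tendsto _).comp hlim
  have hzen : Tendsto (fun k => R.en (z (φ k))) atTop (𝓝 b') :=
    ((continuous_fst.comp continuous_snd).tendsto _).comp hlim
  have hzent : Tendsto (fun k => R.ent (z (φ k))) atTop (𝓝 β) :=
    ((continuous_snd.comp continuous_snd).tendsto _).comp hlim
  have hsum : α + N * β = sInf S := by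
    refine tendsto_nhds_unique (hwent.add (ENNReal.Tendsto.const_mul hzent (Or.inr hNt)))
      ((hf.comp hφ.tendsto_atTop).congr fun k => ?_)
    exact (hwzf (φ k)).symm
  have hsum' : a' + N * b' ≤ c :=
    le_of_tendsto (hwen.add (ENNReal.Tendsto.const_mul hzen (Or.inr hNt)))
      (Eventually.of_forall fun k => hwz (φ k))
  have hat' : a' ≠ ∞ := ne_top_of_le_ne_top hct (le_self_add.trans hsum')
  have hbt' : b' ≠ ∞ := by
    rintro rfl
    rw [ENNReal.mul_top hN0, add_top, top_le_iff] at hsum'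
    exact hct hsum'
  obtain ⟨u, hu, hu1, hu2⟩ := hA.exists_of_tendsto hAK hat' (fun k => hw (φ k)) hwen hwent
  obtain ⟨v, hv, hv1, hv2⟩ := hR.exists_of_tendsto hRK hbt' (fun k => hz (φ k)) hzen hzent
  have hle : A.en u + N * R.en v ≤ c := by
    refine le_trans ?_ hsum'
    gcongr
  have hle1 : c ≤ (A.en fun _ => 1) + N * R.en fun _ => 1 := by rw [hc]; gcongr
  obtain ⟨t, ht, hct'⟩ := exists_mix_eq hle hle1 (ENNReal.add_ne_top.2
    ⟨en_one_ne_top hAreg, ENNReal.mul_ne_top hNt (en_one_ne_top hRreg)⟩)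
  refine ⟨_, _, IsState.mix ht hAreg hu (IsState.one hAreg),
    IsState.mix ht hRreg hv (IsState.one hRreg), ?_, fun u' v' hu' hv' h => ?_⟩
  · rw [en_mix hAreg hu (IsState.one hAreg), en_mix hRreg hv (IsState.one hRreg), hct']
    ring
  · calc _ ≤ A.ent u + N * R.ent v := by
          gcongr
          · exact hu.ent_mix_one_le hAreg ht
          · exact hv.ent_mix_one_le hRreg ht
      _ ≤ α + N * β := by gcongr
      _ = sInf S := hsum
      _ ≤ _ := sInf_le ⟨u', v', hu', hv', h.le, rfl⟩

end Pair

/-! ### Canonical distributions -/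

section Canonical

open Triple

variable {V : Type*} [NormedAddCommGroup V] [NormedSpace ℝ V] [FiniteDimensional ℝ V]
  [MeasurableSpace V] [BorelSpace V] {A : Triple V} {u v : V → ℝ≥0∞} {T : ℝ}

theorem Triple.IsState.entropy_le_iff {X : Type*} [NormedAddCommGroup X] [NormedSpace ℝ X]
    [MeasurableSpace X] [BorelSpace X] {B : Triple X} {u v : X → ℝ≥0∞} (hreg : B.IsRegular)
    (hu : B.IsState 1 u) (hv : B.IsState 1 v) : B.entropy v ≤ B.entropy u ↔ B.ent u ≤ B.ent v := by
  rw [hu.entropy_eq hreg, hv.entropy_eq hreg, EReal.neg_le_neg_iff,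
    EReal.coe_ennreal_le_coe_ennreal_iff]

theorem IsSystem.ent_ne_top (hA : IsSystem A) (hK : A.IsKUnstable) (hu : A.IsState 1 u)
    (h : A.en u ≠ ∞) : A.ent u ≠ ∞ := by
  obtain ⟨C, hC, hCu⟩ := hA.exists_ent_le hK h
  exact ne_top_of_le_ne_top hC (hCu u hu le_rfl)

/-- Infinite negative entropy forces infinite energy, so the sum is `∞` in the exceptional case of
the definition too, even at `T = 0`. -/
theorem IsSystem.freeEnergy_eq (hA : IsSystem A) (hK : A.IsKUnstable) (hT : 0 ≤ T)
    (hu : A.IsState 1 u) :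
    A.freeEnergy T u = ((A.en u + ENNReal.ofReal T * A.ent u : ℝ≥0∞) : EReal) := by
  have hreg := hA.isRegular
  rw [freeEnergy, hu.entropy_eq hreg, energy_eq_en]
  by_cases h : A.ent u = ∞
  · have hen : A.en u = ∞ := by
      by_contra hne
      exact hA.ent_ne_top hK hu hne h
    simp [h, hen]
  · rw [if_neg (by simpa [EReal.neg_eq_bot_iff] using h), EReal.coe_ennreal_add,
      EReal.coe_ennreal_mul, EReal.coe_ennreal_ofReal, max_eq_left hT, mul_neg, sub_eq_add_neg, neg_neg]

theorem IsSystem.isCanonical_iff (hA : IsSystem A) (hK : A.IsKUnstable) (hT : 0 ≤ T) :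
    A.IsCanonical T u ↔ A.IsState 1 u ∧
      (∀ v, A.IsState 1 v → A.en u + ENNReal.ofReal T * A.ent u
        ≤ A.en v + ENNReal.ofReal T * A.ent v) ∧
      (T = 0 → ∀ v, A.IsState 1 v → A.en v ≤ A.en u → A.ent u ≤ A.ent v) := by
  have hreg := hA.isRegular
  have key : ∀ {v w}, A.IsState 1 v → A.IsState 1 w → (A.freeEnergy T v ≤ A.freeEnergy T w ↔
      A.en v + ENNReal.ofReal T * A.ent v ≤ A.en w + ENNReal.ofReal T * A.ent w) := by
    intro v w hv hw
    rw [hA.freeEnergy_eq hK hT hv, hA.freeEnergy_eq hK hT hw,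
      EReal.coe_ennreal_le_coe_ennreal_iff]
  constructor
  · rintro ⟨hu, hmin, hmax⟩
    refine ⟨hu, fun v hv => (key hu hv).1 (hmin v hv), ?_⟩
    rintro rfl v hv hvu
    refine (hu.entropy_le_iff hreg hv).1 (hmax rfl v hv fun w hw => ?_)
    have h1 := (key hu hw).1 (hmin w hw)
    rw [key hv hw]
    simp only [ENNReal.ofReal_zero, zero_mul, add_zero] at h1 ⊢
    exact hvu.trans h1
  · rintro ⟨hu, hmin, hmax⟩
    refine ⟨hu, fun v hv => (key hu hv).2 (hmin v hv), ?_⟩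
    rintro rfl v hv hvmin
    refine (hu.entropy_le_iff hreg hv).2 (hmax rfl v hv ?_)
    simpa using (key hv hu).1 (hvmin u hu)

theorem IsSystem.exists_isCanonical (hA : IsSystem A) (hK : A.IsKUnstable) (hT : 0 ≤ T) :
    ∃ u, A.IsCanonical T u := by
  rcases hT.eq_or_lt with rfl | hT'
  · obtain ⟨u, hu, -, hmin, hmax⟩ := hA.exists_min_en hK
    exact ⟨u, (hA.isCanonical_iff hK hT).2 ⟨hu, fun v hv => by simpa using hmin v hv,
      fun _ => hmax⟩⟩
  · obtain ⟨u, hu, -, hmin⟩ := hA.exists_min_free hK (τ := ENNReal.ofReal T) ENNReal.ofReal_ne_top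
    exact ⟨u, (hA.isCanonical_iff hK hT).2 ⟨hu, hmin, fun h => absurd h hT'.ne'⟩⟩

/-- Then `u = 1` almost everywhere, by continuity everywhere in the interior, and log convexity on a
segment from an interior point forces `u ≥ 1` on the boundary. -/
theorem IsSystem.en_one_le_of_ent_eq_zero (hA : IsSystem A) (hu : A.IsState 1 u)
    (h : A.ent u = 0) : (A.en fun _ => 1) ≤ A.en u := by
  have hreg := hA.isRegular
  have hu' := hu.aemeasurable_vol hreg
  have h0 : ∫⁻ x, kl (u x) ∂A.vol = 0 := by
    have := (ENNReal.div_eq_zero_iff.1 h).resolve_right hreg.vol_ne_top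
    exact this
  rw [lintegral_eq_zero_iff' (by fun_prop)] at h0
  have hae : u =ᵐ[A.vol] fun _ => 1 := by
    filter_upwards [h0, hu.ae_ne_top hreg] with x hx hx'
    have h1 : InformationTheory.klFun (u x).toReal ≤ 0 := by simpa [kl] using hx
    have h2 := (InformationTheory.klFun_eq_zero_iff ENNReal.toReal_nonneg).1
      (le_antisymm h1 (InformationTheory.klFun_nonneg ENNReal.toReal_nonneg))
    rw [← ENNReal.ofReal_toReal hx', h2, ENNReal.ofReal_one]
  have hlog : LogConvexOn A.body u := hu.logConvex
  have hfin : ∀ x ∈ interior A.body, u x ≠ ∞ := fun x hx => by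
    obtain ⟨K, hK, hKu⟩ := hA.exists_le_at_interior hx
    exact ne_top_of_le_ne_top hK (hKu u hu)
  have hone := hA.eqOn_interior ((hlog.mono interior_subset).continuousOn hA.convex.interior
    isOpen_interior hfin) continuousOn_const hae
  obtain ⟨x₀, hx₀⟩ := hA.interior_nonempty
  have hge : ∀ x ∈ A.body, 1 ≤ u x := by
    intro x hx
    have hmem : (1 - 1 / 2 : ℝ) • x₀ + (1 / 2 : ℝ) • x ∈ interior A.body :=
      hA.convex.combo_interior_closure_mem_interior hx₀ (subset_closure hx)
        (by norm_num) (by norm_num) (by norm_num)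
    have h1 := hlog x₀ (interior_subset hx₀) x hx (1 / 2) ⟨by norm_num, by norm_num⟩
    rw [hone hmem, hone hx₀, ENNReal.one_rpow, one_mul] at h1
    by_contra! hlt
    exact absurd h1 (not_le.2 (ENNReal.rpow_lt_one hlt (by norm_num)))
  refine ENNReal.div_le_div_right (lintegral_mono_ae ?_) _
  filter_upwards [hreg.ae_bdry_mem] with x hx using hge x hx

/-- Moving from the constant state towards a bounded state of smaller energy lowers the energy
linearly in `t` but costs entropy only quadratically. -/
theorem IsSystem.exists_free_lt (hA : IsSystem A) (hK : A.IsKUnstable) (hT : 0 ≤ T) :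
    ∃ u, A.IsState 1 u ∧ A.en u + ENNReal.ofReal T * A.ent u < A.en fun _ => 1 := by
  have hreg := hA.isRegular
  obtain ⟨w, hw, ⟨M, hM, hwM⟩, hlt⟩ := hA.exists_en_lt hK
  have h1t := en_one_ne_top hreg
  have hwt : A.en w ≠ ∞ := (hlt.trans h1t.lt_top).ne
  set e₁ := (A.en fun _ => 1).toReal with he₁
  set ew := (A.en w).toReal with hew
  have hlt' : ew < e₁ := (ENNReal.toReal_lt_toReal hwt h1t).2 hlt
  set B := T * (M.toReal + 1) ^ 2 with hB
  have hB0 : 0 ≤ B := by positivity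
  obtain ⟨t, ht0, ht1, htB⟩ : ∃ t : ℝ, 0 < t ∧ t ≤ 1 ∧ t * B < e₁ - ew := by
    refine ⟨min 1 ((e₁ - ew) / (B + 1)), ?_, min_le_left _ _, ?_⟩
    · exact lt_min one_pos (div_pos (by linarith) (by linarith))
    · calc _ ≤ (e₁ - ew) / (B + 1) * B := by gcongr; exact min_le_right _ _
        _ < e₁ - ew := by rw [div_mul_eq_mul_div, div_lt_iff₀ (by linarith)]; nlinarith
  have ht : t ∈ Set.Icc (0 : ℝ) 1 := ⟨ht0.le, ht1⟩
  refine ⟨_, IsState.mix ht hreg (IsState.one hreg) hw, ?_⟩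
  have hent : A.ent (NAHam.mix t (fun _ => 1) w) ≤ ENNReal.ofReal (t ^ 2 * (M.toReal + 1) ^ 2) := by
    rw [ent, ENNReal.div_le_iff hreg.vol_ne_zero hreg.vol_ne_top, ← lintegral_const]
    refine lintegral_mono_ae ?_
    filter_upwards [hreg.ae_vol_mem, hw.ae_ne_top hreg] with x hx hx'
    rw [kl, NAHam.mix, toReal_mix ht ENNReal.one_ne_top hx']
    refine ENNReal.ofReal_le_ofReal ?_
    have hx0 : 0 ≤ (w x).toReal := ENNReal.toReal_nonneg
    have hxM : (w x).toReal ≤ M.toReal := ENNReal.toReal_mono hM (hwM x hx)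
    refine (klFun_le_sq ?_).trans ?_
    · simp only [ENNReal.toReal_one]
      nlinarith
    · rw [← mul_pow, ENNReal.toReal_one]
      apply sq_le_sq'
      · nlinarith
      · nlinarith
  have hen : A.en (NAHam.mix t (fun _ => 1) w) = ENNReal.ofReal ((1 - t) * e₁ + t * ew) := by
    rw [en_mix hreg (IsState.one hreg) hw, ← toReal_mix ht h1t hwt, ENNReal.ofReal_toReal]
    finiteness
  have he₁0 : 0 ≤ e₁ := ENNReal.toReal_nonneg
  have hew0 : 0 ≤ ew := ENNReal.toReal_nonneg
  have h1t' : 0 ≤ 1 - t := by linarith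
  calc _ ≤ ENNReal.ofReal ((1 - t) * e₁ + t * ew)
        + ENNReal.ofReal T * ENNReal.ofReal (t ^ 2 * (M.toReal + 1) ^ 2) := by
        rw [hen]; gcongr
    _ = ENNReal.ofReal ((1 - t) * e₁ + t * ew + T * (t ^ 2 * (M.toReal + 1) ^ 2)) := by
        rw [← ENNReal.ofReal_mul hT, ← ENNReal.ofReal_add (by positivity) (by positivity)]
    _ < ENNReal.ofReal e₁ := by
        refine (ENNReal.ofReal_lt_ofReal_iff_of_nonneg (by positivity)).2 ?_
        have h1 : t * (t * B) < t * (e₁ - ew) := mul_lt_mul_of_pos_left htB ht0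
        have h2 : T * (t ^ 2 * (M.toReal + 1) ^ 2) = t * (t * B) := by rw [hB]; ring
        rw [h2]
        nlinarith
    _ = _ := ENNReal.ofReal_toReal h1t

end Canonical

/-! ### Thermodynamic relations -/

section Thermo

open Triple

variable {V : Type*} [NormedAddCommGroup V] [NormedSpace ℝ V] [FiniteDimensional ℝ V]
  [MeasurableSpace V] [BorelSpace V] {A : Triple V} {u v : V → ℝ≥0∞} {T : ℝ} {e s e' s' E g : ℝ}

/-- Some state has internal energy `e` and entropy `-s`. -/
def Triple.Attains (A : Triple V) (e s : ℝ) : Prop :=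
  0 ≤ e ∧ 0 ≤ s ∧ ∃ u, A.IsState 1 u ∧ A.en u = ENNReal.ofReal e ∧ A.ent u = ENNReal.ofReal s

theorem IsSystem.attains (hA : IsSystem A) (hK : A.IsKUnstable) (hu : A.IsState 1 u)
    (h : A.en u ≠ ∞) : A.Attains (A.en u).toReal (A.ent u).toReal :=
  ⟨ENNReal.toReal_nonneg, ENNReal.toReal_nonneg, u, hu, (ENNReal.ofReal_toReal h).symm,
    (ENNReal.ofReal_toReal (hA.ent_ne_top hK hu h)).symm⟩

theorem coe_eq_coe_ofReal {x : ℝ≥0∞} (h : (x : EReal) = (e : EReal)) :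
    0 ≤ e ∧ x = ENNReal.ofReal e := by
  have h0 : 0 ≤ e := by
    have := EReal.coe_ennreal_nonneg x
    rw [h] at this
    exact_mod_cast this
  refine ⟨h0, ?_⟩
  rw [← EReal.coe_ennreal_eq_coe_ennreal_iff, h, EReal.coe_ennreal_ofReal, max_eq_left h0]

theorem coe_ofReal (h : 0 ≤ e) : ((ENNReal.ofReal e : ℝ≥0∞) : EReal) = (e : EReal) := by
  rw [EReal.coe_ennreal_ofReal, max_eq_left h]

theorem Triple.Attains.mix (hA : IsSystem A) {t : ℝ} (ht : t ∈ Set.Icc (0 : ℝ) 1)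
    (h : A.Attains e s) (h' : A.Attains e' s') :
    ∃ r ≤ (1 - t) * s + t * s', A.Attains ((1 - t) * e + t * e') r := by
  obtain ⟨he, hs, u, hu, hue, hus⟩ := h
  obtain ⟨he', hs', v, hv, hve, hvs⟩ := h'
  have hreg := hA.isRegular
  have h1 : 0 ≤ 1 - t := by linarith [ht.2]
  have h0 := ht.1
  have hle := ent_mix_le ht hreg hu hv
  rw [hus, hvs, ← ENNReal.ofReal_mul h1, ← ENNReal.ofReal_mul h0,
    ← ENNReal.ofReal_add (by positivity) (by positivity)] at hle
  refine ⟨(A.ent (NAHam.mix t u v)).toReal, ENNReal.toReal_le_of_le_ofReal (by positivity) hle,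
    by positivity, ENNReal.toReal_nonneg, _, IsState.mix ht hreg hu hv, ?_, ?_⟩
  · rw [en_mix hreg hu hv, hue, hve, ← ENNReal.ofReal_mul h1, ← ENNReal.ofReal_mul h0,
      ← ENNReal.ofReal_add (by positivity) (by positivity)]
  · rw [ENNReal.ofReal_toReal (ne_top_of_le_ne_top ENNReal.ofReal_ne_top hle)]

theorem Triple.Attains.le_eqEntropy (hA : IsSystem A) (h : A.Attains e s) :
    ((-s : ℝ) : EReal) ≤ A.eqEntropy e := by
  obtain ⟨he, hs, u, hu, hue, hus⟩ := h
  refine le_sSup ⟨u, ⟨hu, ?_⟩, ?_⟩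
  · rw [energy_eq_en, hue, coe_ofReal he]
  · rw [hu.entropy_eq hA.isRegular, hus, coe_ofReal hs, EReal.coe_neg]

theorem IsSystem.exists_attains_of_lt (hA : IsSystem A) {x : ℝ}
    (h : (x : EReal) < A.eqEntropy e) : ∃ s, A.Attains e s ∧ s < -x := by
  obtain ⟨_, ⟨u, ⟨hu, hue⟩, rfl⟩, hx⟩ := lt_sSup_iff.1 h
  rw [energy_eq_en] at hue
  obtain ⟨he, hue⟩ := coe_eq_coe_ofReal hue
  rw [hu.entropy_eq hA.isRegular] at hx
  have hne : A.ent u ≠ ∞ := by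
    intro h
    simp [h] at hx
  refine ⟨(A.ent u).toReal, ⟨he, ENNReal.toReal_nonneg, u, hu, hue,
    (ENNReal.ofReal_toReal hne).symm⟩, ?_⟩
  rw [← EReal.coe_ennreal_toReal hne, ← EReal.coe_neg, EReal.coe_lt_coe_iff] at hx
  linarith

/-- `g` is the minimal negative entropy at internal energy `E`. -/
structure Triple.IsMinAt (A : Triple V) (E g : ℝ) : Prop where
  attains : A.Attains E g
  le : ∀ s, A.Attains E s → g ≤ s

theorem Triple.IsMinAt.eqEntropy_eq (hA : IsSystem A) (h : A.IsMinAt E g) :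
    A.eqEntropy E = ((-g : ℝ) : EReal) := by
  refine le_antisymm ?_ (h.attains.le_eqEntropy hA)
  refine EReal.le_of_forall_lt_iff_le.1 fun z hz => ?_
  by_contra! hlt
  obtain ⟨s, hs, hsz⟩ := hA.exists_attains_of_lt hlt
  have := h.le s hs
  have hz' : -g < z := by exact_mod_cast hz
  linarith

/-- Concavity: for `x` between `E` and `e`, mixing the two states makes the difference quotient at
`x` at least the slope of the chord to `(e, -s)`. -/
theorem Triple.IsMinAt.le_betaRight (hA : IsSystem A) (h : A.IsMinAt E g) (h' : A.Attains e s)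
    (he : E < e) : (((g - s) / (e - E) : ℝ) : EReal) ≤ A.betaRight E := by
  refine le_limsup_of_frequently_le (Eventually.frequently ?_) (by isBoundedDefault)
  filter_upwards [Ioo_mem_nhdsGT he] with x hx
  have hex : 0 < e - E := by linarith
  set t := (x - E) / (e - E) with htdef
  have ht : t ∈ Set.Icc (0 : ℝ) 1 := ⟨div_nonneg (by linarith [hx.1]) hex.le,
    (div_le_one hex).2 (by linarith [hx.2])⟩
  have hte : t * (e - E) = x - E := by rw [htdef]; field_simp
  obtain ⟨r, hr, hat⟩ := h.attains.mix hA ht h'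
  rw [show (1 - t) * E + t * e = x by linarith] at hat
  have hx0 : 0 < x - E := by linarith [hx.1]
  rw [h.eqEntropy_eq hA]
  calc (((g - s) / (e - E) : ℝ) : EReal) = ((t * (g - s) / (x - E) : ℝ) : EReal) := by
        congr 1
        rw [← hte]
        have : t ≠ 0 := by
          rintro h0
          rw [h0] at hte
          linarith
        field_simp
    _ ≤ (((-r - -g) / (x - E) : ℝ) : EReal) := by
        rw [EReal.coe_le_coe_iff]
        gcongr
        linarith
    _ ≤ _ := by
        rw [EReal.coe_div, EReal.coe_sub]
        exact EReal.div_le_div_right_of_nonneg (by exact_mod_cast hx0.le)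
          (EReal.sub_le_sub (hat.le_eqEntropy hA) le_rfl)

/-- The same mixing to the left of `E`, where the negative denominator turns the lower bound on the
entropy into an upper bound on the slope. -/
theorem Triple.IsMinAt.betaLeft_le (hA : IsSystem A) (h : A.IsMinAt E g) (h' : A.Attains e s)
    (he : e < E) : A.betaLeft E ≤ (((s - g) / (E - e) : ℝ) : EReal) := by
  refine limsup_le_of_le (by isBoundedDefault) ?_
  filter_upwards [Ioo_mem_nhdsLT he] with x hx
  have hex : 0 < E - e := by linarith
  set t := (E - x) / (E - e) with htdef
  have ht : t ∈ Set.Icc (0 : ℝ) 1 := ⟨div_nonneg (by linarith [hx.2]) hex.le,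
    (div_le_one hex).2 (by linarith [hx.1])⟩
  have hte : t * (E - e) = E - x := by rw [htdef]; field_simp
  obtain ⟨r, hr, hat⟩ := h.attains.mix hA ht h'
  rw [show (1 - t) * E + t * e = x by linarith] at hat
  have hx0 : x - E < 0 := by linarith [hx.2]
  rw [h.eqEntropy_eq hA]
  calc (A.eqEntropy x - ((-g : ℝ) : EReal)) / ((x - E : ℝ) : EReal)
      ≤ (((-r - -g) / (x - E) : ℝ) : EReal) := by
        rw [EReal.coe_div, EReal.coe_sub (-r)]
        exact EReal.div_le_div_right_of_nonpos (by exact_mod_cast hx0.le)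
          (EReal.sub_le_sub (hat.le_eqEntropy hA) le_rfl)
    _ = (((r - g) / (E - x) : ℝ) : EReal) := by
        congr 1
        rw [← neg_div_neg_eq]
        ring_nf
    _ ≤ ((t * (s - g) / (E - x) : ℝ) : EReal) := by
        rw [EReal.coe_le_coe_iff]
        apply div_le_div_of_nonneg_right _ (by linarith)
        linarith
    _ = _ := by
        congr 1
        rw [← hte]
        have : t ≠ 0 := by
          rintro h0
          rw [h0] at hte
          linarith
        field_simp

/-- The hypothesis says that the line of slope `β` through `(E, -g)` supports the graph of the
entropy. Hence `β` lies between the right and the left derivative, as the next two lemmas state. -/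
theorem Triple.IsMinAt.eqEntropy_le (hA : IsSystem A) {β : ℝ}
    (hβ : ∀ e s, A.Attains e s → g - s ≤ β * (e - E)) (x : ℝ) :
    A.eqEntropy x ≤ ((-g + β * (x - E) : ℝ) : EReal) := by
  refine EReal.le_of_forall_lt_iff_le.1 fun z hz => ?_
  by_contra! hlt
  obtain ⟨s, hs, hsz⟩ := hA.exists_attains_of_lt hlt
  have := hβ x s hs
  have hz' : -g + β * (x - E) < z := by exact_mod_cast hz
  linarith

theorem Triple.IsMinAt.betaRight_le (hA : IsSystem A) (h : A.IsMinAt E g) {β : ℝ}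
    (hβ : ∀ e s, A.Attains e s → g - s ≤ β * (e - E)) : A.betaRight E ≤ (β : EReal) := by
  refine limsup_le_of_le (by isBoundedDefault) ?_
  filter_upwards [self_mem_nhdsWithin] with x hx
  have hx' : 0 < x - E := sub_pos.2 hx
  rw [h.eqEntropy_eq hA]
  calc _ ≤ (((-g + β * (x - E) - -g) / (x - E) : ℝ) : EReal) := by
        rw [EReal.coe_div, EReal.coe_sub]
        exact EReal.div_le_div_right_of_nonneg (by exact_mod_cast hx'.le)
          (EReal.sub_le_sub (eqEntropy_le hA hβ x) le_rfl)
    _ = _ := by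
        congr 1
        field_simp
        ring

theorem Triple.IsMinAt.le_betaLeft (hA : IsSystem A) (h : A.IsMinAt E g) {β : ℝ}
    (hβ : ∀ e s, A.Attains e s → g - s ≤ β * (e - E)) : (β : EReal) ≤ A.betaLeft E := by
  refine le_limsup_of_frequently_le (Eventually.frequently ?_) (by isBoundedDefault)
  filter_upwards [self_mem_nhdsWithin] with x hx
  have hx' : x - E < 0 := sub_neg.2 hx
  rw [h.eqEntropy_eq hA]
  calc (β : EReal) = (((-g + β * (x - E) - -g) / (x - E) : ℝ) : EReal) := by
        congr 1
        have := hx'.ne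
        field_simp
        ring
    _ ≤ _ := by
        rw [EReal.coe_div, EReal.coe_sub]
        exact EReal.div_le_div_right_of_nonpos (by exact_mod_cast hx'.le)
          (EReal.sub_le_sub (eqEntropy_le hA hβ x) le_rfl)

/-- Below the minimal energy the entropy is `-∞`, and `-∞` divided by a negative number is `+∞`. -/
theorem IsSystem.betaLeft_eq_top (hA : IsSystem A)
    (hmin : ∀ e s, A.Attains e s → E ≤ e) : A.betaLeft E = ⊤ := by
  have hev : ∀ᶠ x in 𝓝[<] E, (A.eqEntropy x - A.eqEntropy E) / ((x - E : ℝ) : EReal) = ⊤ := by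
    filter_upwards [self_mem_nhdsWithin] with x hx
    have hx' : x - E < 0 := sub_neg.2 hx
    have hbot : A.eqEntropy x = ⊥ := by
      by_contra hne
      obtain ⟨z, -, hz⟩ := EReal.lt_iff_exists_real_btwn.1 (bot_lt_iff_ne_bot.2 hne)
      obtain ⟨s, hs, -⟩ := hA.exists_attains_of_lt hz
      exact absurd (hmin x s hs) (not_le.2 hx)
    rw [hbot, EReal.bot_sub, EReal.bot_div_of_neg_ne_bot (by exact_mod_cast hx')
      (EReal.coe_ne_bot _)]
  rw [betaLeft, limsup_congr hev, limsup_const]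

theorem Triple.IsMinAt.exists_of_lt_betaRight (hA : IsSystem A) (h : A.IsMinAt E g) {β : ℝ}
    (hβ : (β : EReal) < A.betaRight E) :
    ∃ e s, E < e ∧ A.Attains e s ∧ s < g - β * (e - E) := by
  obtain ⟨x, hx, hxE⟩ := ((frequently_lt_of_lt_limsup (by isBoundedDefault) hβ).and_eventually
    self_mem_nhdsWithin).exists
  have hx' : 0 < x - E := sub_pos.2 hxE
  rw [h.eqEntropy_eq hA, EReal.lt_div_iff (by exact_mod_cast hx') (EReal.coe_ne_top _)] at hx
  have h2 : ((β * (x - E) - g : ℝ) : EReal) < A.eqEntropy x := by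
    have := EReal.lt_sub_iff_add_lt (Or.inl (EReal.coe_ne_bot _)) (Or.inl (EReal.coe_ne_top _)) |>.1 hx
    have h3 : ((β * (x - E) - g : ℝ) : EReal) = (β : EReal) * ((x - E : ℝ) : EReal)
        + ((-g : ℝ) : EReal) := by
      rw [← EReal.coe_mul, ← EReal.coe_add, sub_eq_add_neg]
    rwa [h3]
  obtain ⟨s, hs, hsx⟩ := hA.exists_attains_of_lt h2
  exact ⟨x, s, hxE, hs, by linarith⟩

theorem Triple.IsMinAt.exists_of_betaLeft_lt (hA : IsSystem A) (h : A.IsMinAt E g) {β : ℝ}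
    (hβ : A.betaLeft E < (β : EReal)) :
    ∃ e s, e < E ∧ A.Attains e s ∧ s < g - β * (e - E) := by
  obtain ⟨x, hx, hxE⟩ := ((eventually_lt_of_limsup_lt hβ (by isBoundedDefault)).and
    self_mem_nhdsWithin).exists
  have hx' : x - E < 0 := sub_neg.2 hxE
  have h2 : ((β * (x - E) - g : ℝ) : EReal) < A.eqEntropy x := by
    by_contra! hle
    refine absurd hx (not_lt.2 ?_)
    rw [h.eqEntropy_eq hA]
    calc (β : EReal) = (((β * (x - E) - g - -g) / (x - E) : ℝ) : EReal) := by
          congr 1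
          have := hx'.ne
          field_simp
          ring
      _ ≤ _ := by
          rw [EReal.coe_div, EReal.coe_sub]
          exact EReal.div_le_div_right_of_nonpos (by exact_mod_cast hx'.le)
            (EReal.sub_le_sub hle le_rfl)
  obtain ⟨s, hs, hsx⟩ := hA.exists_attains_of_lt h2
  exact ⟨x, s, hxE, hs, by linarith⟩

end Thermo

/-! ### Reservoirs -/

section Reservoir

open Triple

variable {V : Type*} [NormedAddCommGroup V] [NormedSpace ℝ V] [FiniteDimensional ℝ V]
  [MeasurableSpace V] [BorelSpace V] {A : Triple V} {u v : V → ℝ≥0∞} {T : ℝ} {e s e' s' E g : ℝ}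

theorem IsSystem.attains_one (hA : IsSystem A) : A.Attains (A.en fun _ => 1).toReal 0 :=
  ⟨ENNReal.toReal_nonneg, le_rfl, _, IsState.one hA.isRegular,
    (ENNReal.ofReal_toReal (en_one_ne_top hA.isRegular)).symm, by simp [ent_one]⟩

theorem IsSystem.energy_one (hA : IsSystem A) :
    A.energy (fun _ => 1) = ((A.en fun _ => 1).toReal : EReal) := by
  rw [energy_eq_en, EReal.coe_ennreal_toReal (en_one_ne_top hA.isRegular)]

theorem Triple.IsState.isMinAt_of_min (hu : A.IsState 1 u)
    (hE : 0 ≤ E) (hen : A.en u = ENNReal.ofReal E) (hne : A.ent u ≠ ∞)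
    (hmin : ∀ v, A.IsState 1 v → A.en v ≤ ENNReal.ofReal E → A.ent u ≤ A.ent v) :
    A.IsMinAt E (A.ent u).toReal := by
  refine ⟨⟨hE, ENNReal.toReal_nonneg, u, hu, hen, (ENNReal.ofReal_toReal hne).symm⟩, ?_⟩
  rintro s ⟨-, hs, v, hv, hve, hvs⟩
  have := hmin v hv hve.le
  rw [hvs] at this
  exact ENNReal.toReal_le_of_le_ofReal hs this

theorem IsSystem.exists_of_mem_energyRange (hA : IsSystem A) (hK : A.IsKUnstable)
    (hE : E ∈ A.energyRange) : 0 ≤ E ∧ ENNReal.ofReal E ≤ (A.en fun _ => 1) ∧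
      ∃ u, A.IsState 1 u ∧ A.en u ≤ ENNReal.ofReal E := by
  obtain ⟨u, hu, -, hmin, -⟩ := hA.exists_min_en hK
  obtain ⟨h1, h2⟩ := hE
  have h3 : (A.en u : EReal) ≤ (E : EReal) := by
    refine le_trans (le_sInf ?_) h1
    rintro _ ⟨v, hv, rfl⟩
    rw [energy_eq_en, EReal.coe_ennreal_le_coe_ennreal_iff]
    exact hmin v hv
  have h0 : 0 ≤ E := by
    have := (EReal.coe_ennreal_nonneg (A.en u)).trans h3
    exact_mod_cast this
  rw [← coe_ofReal h0] at h3
  rw [← coe_ofReal h0, energy_eq_en] at h2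
  exact ⟨h0, EReal.coe_ennreal_le_coe_ennreal_iff.1 h2.le, u, hu,
    EReal.coe_ennreal_le_coe_ennreal_iff.1 h3⟩

/-- Below the energy of the constant state the entropy is strictly negative, so the chord to the
constant state has positive slope. This is what permits inverting slopes into temperatures. -/
theorem Triple.IsMinAt.betaRight_pos (hA : IsSystem A) (h : A.IsMinAt E g)
    (hE : (E : EReal) < A.energy fun _ => 1) : 0 < A.betaRight E := by
  rw [hA.energy_one, EReal.coe_lt_coe_iff] at hE
  refine lt_of_lt_of_le ?_ (h.le_betaRight hA hA.attains_one hE)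
  have hg : 0 < g := by
    obtain ⟨hE0, hg0, u, hu, hue, hug⟩ := h.attains
    refine lt_of_le_of_ne hg0 fun h0 => ?_
    rw [← h0, ENNReal.ofReal_zero] at hug
    have := hA.en_one_le_of_ent_eq_zero hu hug
    rw [hue] at this
    exact absurd (ENNReal.toReal_le_of_le_ofReal hE0 this) (not_le.2 hE)
  have : 0 < (g - 0) / ((A.en fun _ => 1).toReal - E) := div_pos (by linarith) (by linarith)
  exact_mod_cast this

/-- The energy of a canonical distribution works: minimality of the free energy means that the line
of slope `1 / T` supports the entropy there. -/
theorem IsSystem.exists_canEnergy (hA : IsSystem A) (hK : A.IsKUnstable) (hT : 0 ≤ T) :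
    ∃ E : ℝ, E ∈ A.energyRange ∧ (T : EReal) ∈ A.eqTemperatures E := by
  have hreg := hA.isRegular
  have h1t := en_one_ne_top hreg
  obtain ⟨u, hu⟩ := hA.exists_isCanonical hK hT
  obtain ⟨hu, hmin, hmax⟩ := (hA.isCanonical_iff hK hT).1 hu
  obtain ⟨w, hw, hw1⟩ := hA.exists_free_lt hK hT
  have hlt : A.en u < A.en fun _ => 1 := (le_self_add.trans (hmin w hw)).trans_lt hw1
  have hue : A.en u ≠ ∞ := hlt.ne_top
  have hus := hA.ent_ne_top hK hu hue
  set E := (A.en u).toReal with hE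
  set g := (A.ent u).toReal with hg
  have hEu : A.en u = ENNReal.ofReal E := (ENNReal.ofReal_toReal hue).symm
  have hgu : A.ent u = ENNReal.ofReal g := (ENNReal.ofReal_toReal hus).symm
  have hE0 : 0 ≤ E := ENNReal.toReal_nonneg
  have hg0 : 0 ≤ g := ENNReal.toReal_nonneg
  have hfree : ∀ e s, A.Attains e s → E + T * g ≤ e + T * s := by
    rintro e s ⟨he, hs, v, hv, hve, hvs⟩
    have := hmin v hv
    rw [hEu, hgu, hve, hvs, ← ENNReal.ofReal_mul hT, ← ENNReal.ofReal_mul hT,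
      ← ENNReal.ofReal_add hE0 (by positivity), ← ENNReal.ofReal_add he (by positivity)] at this
    exact (ENNReal.ofReal_le_ofReal_iff (by positivity)).1 this
  have hat : A.Attains E g := hA.attains hK hu hue
  have hminat : A.IsMinAt E g := by
    refine ⟨hat, fun s hs => ?_⟩
    rcases hT.eq_or_lt with h0 | h0
    · obtain ⟨-, hs0, v, hv, hve, hvs⟩ := hs
      have := hmax h0.symm v hv (by rw [hve, hEu])
      rw [hgu, hvs] at this
      exact (ENNReal.ofReal_le_ofReal_iff hs0).1 this
    · have := hfree E s hs
      exact le_of_mul_le_mul_left (by linarith) h0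
  have hE1 : (E : EReal) < A.energy fun _ => 1 := by
    rw [hA.energy_one, EReal.coe_lt_coe_iff]
    exact (ENNReal.toReal_lt_toReal hue h1t).2 hlt
  have hRpos := hminat.betaRight_pos hA hE1
  refine ⟨E, ⟨sInf_le ⟨u, hu, ?_⟩, hE1⟩, ?_⟩
  · rw [energy_eq_en, hEu, coe_ofReal hE0]
  -- At zero temperature `E` is the minimal energy, so the left slope is infinite and its inverse is
  -- `0`.
  rcases hT.eq_or_lt with rfl | h0
  · have hL : A.betaLeft E = ⊤ := hA.betaLeft_eq_top fun e s h => by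
      have := hfree e s h
      linarith
    exact ⟨by rw [hL, EReal.inv_top]; simp,
      by simpa using EReal.inv_nonneg_of_nonneg hRpos.le⟩
  · have hβ : ∀ e s, A.Attains e s → g - s ≤ T⁻¹ * (e - E) := fun e s h => by
      have := hfree e s h
      rw [inv_mul_eq_div, le_div_iff₀ h0]
      linarith
    have hTpos : (0 : EReal) < ((T⁻¹ : ℝ) : EReal) := by exact_mod_cast inv_pos.2 h0
    have hTinv : (((T⁻¹ : ℝ) : EReal))⁻¹ = (T : EReal) := by rw [← EReal.coe_inv, inv_inv]
    have h1 := hminat.betaRight_le hA hβ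
    have h2 := hminat.le_betaLeft hA hβ
    refine ⟨?_, ?_⟩
    · rw [← hTinv]
      exact EReal.inv_strictAntiOn.antitoneOn hTpos (hTpos.trans_le h2) h2
    · rw [← hTinv]
      exact EReal.inv_strictAntiOn.antitoneOn hRpos hTpos h1

theorem IsSystem.canEnergy_mem (hA : IsSystem A) (hK : A.IsKUnstable) (hT : 0 ≤ T) :
    A.canEnergy T ∈ A.energyRange ∧ (T : EReal) ∈ A.eqTemperatures (A.canEnergy T) := by
  rw [canEnergy, if_pos hK]
  exact Classical.epsilon_spec (hA.exists_canEnergy hK hT)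

theorem IsSystem.exists_isMinAt (hA : IsSystem A) (hK : A.IsKUnstable) (hE : E ∈ A.energyRange) :
    ∃ g, A.IsMinAt E g ∧
      ∀ v, A.IsState 1 v → A.en v ≤ ENNReal.ofReal E → ENNReal.ofReal g ≤ A.ent v := by
  obtain ⟨hE0, hE1, hex⟩ := hA.exists_of_mem_energyRange hK hE
  obtain ⟨u, hu, hue, hut, hmin⟩ := hA.exists_en_eq hK hex hE1
  exact ⟨_, hu.isMinAt_of_min hE0 hue hut hmin, fun v hv hve => by
    rw [ENNReal.ofReal_toReal hut]; exact hmin v hv hve⟩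

theorem Triple.IsMild.inv_beta (hM : A.IsMild) (hE : E ∈ A.energyRange)
    (hT : (T : EReal) ∈ A.eqTemperatures E) :
    (A.betaLeft E)⁻¹ = (T : EReal) ∧ (A.betaRight E)⁻¹ = (T : EReal) := by
  obtain ⟨x, hx⟩ := Set.encard_eq_one.1 (hM E hE)
  have hle := hT.1.trans hT.2
  have h1 : (A.betaLeft E)⁻¹ ∈ A.eqTemperatures E := ⟨le_rfl, hle⟩
  have h2 : (A.betaRight E)⁻¹ ∈ A.eqTemperatures E := ⟨hle, le_rfl⟩
  rw [hx, Set.mem_singleton_iff] at hT h1 h2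
  exact ⟨h1.trans hT.symm, h2.trans hT.symm⟩

theorem EReal_eq_of_inv_eq (hT : 0 < T) {x : EReal} (h : x⁻¹ = (T : EReal)) :
    x = ((T⁻¹ : ℝ) : EReal) := by
  have hT' : (T : EReal) ≠ 0 := by exact_mod_cast hT.ne'
  have h1 : x ≠ ⊥ := by rintro rfl; exact hT' (by rw [← h, EReal.inv_bot])
  have h2 : x ≠ ⊤ := by rintro rfl; exact hT' (by rw [← h, EReal.inv_top])
  rw [EReal.coe_inv, ← h, EReal.inv_inv h1 h2]

theorem EReal_eq_top_of_inv_eq_zero {x : EReal} (hx : 0 < x) (h : x⁻¹ = 0) : x = ⊤ := by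
  by_contra hne
  exact (EReal.inv_pos_of_pos_ne_top hx hne).ne' h

/-- A mild system at positive temperature: the minimal negative entropy lies above its tangent. -/
theorem Triple.IsMild.sub_le (hA : IsSystem A) (hM : A.IsMild)
    (hE : E ∈ A.energyRange) (hT : (T : EReal) ∈ A.eqTemperatures E) (hT0 : 0 < T)
    (h : A.IsMinAt E g) (h' : A.Attains e s) : g - s ≤ T⁻¹ * (e - E) := by
  obtain ⟨hL, hR⟩ := hM.inv_beta hE hT
  have hL := EReal_eq_of_inv_eq hT0 hL
  have hR := EReal_eq_of_inv_eq hT0 hR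
  rcases lt_trichotomy e E with he | rfl | he
  · have := h.betaLeft_le hA h' he
    rw [hL, EReal.coe_le_coe_iff, le_div_iff₀ (by linarith)] at this
    linarith
  · have := h.le s h'
    simpa using this
  · have := h.le_betaRight hA h' he
    rwa [hR, EReal.coe_le_coe_iff, div_le_iff₀ (by linarith)] at this

/-- Each of `N` copies moves by `d / N` when it is mixed with weight `d / ((e - E) N)` towards `(e,
s)`. The chord slope beats `β`, so the total entropy gain is at least `β d`. -/
theorem Triple.IsMinAt.eventually_exists (hA : IsSystem A) (h : A.IsMinAt E g) {β d : ℝ}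
    (h' : A.Attains e s) (hs : s < g - β * (e - E)) (hd : 0 < d / (e - E)) :
    ∀ᶠ N : ℕ in atTop, ∃ r, A.Attains (E + d / N) r ∧ N * r ≤ N * g - β * d := by
  obtain ⟨M, hM⟩ := exists_nat_gt (d / (e - E))
  have hne : e - E ≠ 0 := by
    intro h0
    simp [h0] at hd
  filter_upwards [eventually_ge_atTop M] with N hN
  have hN' : d / (e - E) < N := hM.trans_le (by exact_mod_cast hN)
  have hN0 : (0 : ℝ) < N := hd.trans hN'
  set t := d / (e - E) / N with ht
  have htI : t ∈ Set.Icc (0 : ℝ) 1 := ⟨by positivity, (div_le_one hN0).2 hN'.le⟩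
  have hte : t * (e - E) = d / N := by rw [ht]; field_simp
  obtain ⟨r, hr, hat⟩ := h.attains.mix hA htI h'
  rw [show (1 - t) * E + t * e = E + d / N by linarith] at hat
  refine ⟨r, hat, ?_⟩
  have h1 : r ≤ g - β * (d / N) := by
    have := mul_le_mul_of_nonneg_left hs.le htI.1
    rw [← hte]
    linarith
  calc (N : ℝ) * r ≤ N * (g - β * (d / N)) := by gcongr
    _ = N * g - β * d := by field_simp

/-- For either sign of `d` the slope `T⁻¹ - ε / d` lies on the side of `T⁻¹` at which the one-sided
derivative supplies a chord, and multiplied by `d` it loses only `ε`. -/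
theorem Triple.IsMild.eventually_exists (hA : IsSystem A) (hM : A.IsMild)
    (hE : E ∈ A.energyRange) (hT : (T : EReal) ∈ A.eqTemperatures E) (hT0 : 0 < T)
    (h : A.IsMinAt E g) (d : ℝ) {ε : ℝ} (hε : 0 < ε) :
    ∀ᶠ N : ℕ in atTop, ∃ r, A.Attains (E + d / N) r ∧ N * r ≤ N * g - T⁻¹ * d + ε := by
  obtain ⟨hL, hR⟩ := hM.inv_beta hE hT
  have hL := EReal_eq_of_inv_eq hT0 hL
  have hR := EReal_eq_of_inv_eq hT0 hR
  have hβd : d ≠ 0 → (T⁻¹ - ε / d) * d = T⁻¹ * d - ε := fun h => by field_simp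
  rcases lt_trichotomy d 0 with hd | rfl | hd
  · obtain ⟨e, s, he, hat, hs⟩ := h.exists_of_betaLeft_lt hA (β := T⁻¹ - ε / d) (by
      rw [hL, EReal.coe_lt_coe_iff]
      linarith [div_neg_of_pos_of_neg hε hd])
    filter_upwards [h.eventually_exists hA hat hs (div_pos_of_neg_of_neg hd (by linarith))]
      with N ⟨r, hr, hrN⟩
    rw [hβd hd.ne] at hrN
    exact ⟨r, hr, by linarith⟩
  · exact Eventually.of_forall fun N => ⟨g, by simpa using h.attains, by simpa using hε.le⟩
  · obtain ⟨e, s, he, hat, hs⟩ := h.exists_of_lt_betaRight hA (β := T⁻¹ - ε / d) (by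
      rw [hR, EReal.coe_lt_coe_iff]
      linarith [div_pos hε hd])
    filter_upwards [h.eventually_exists hA hat hs (div_pos hd (by linarith))]
      with N ⟨r, hr, hrN⟩
    rw [hβd hd.ne'] at hrN
    exact ⟨r, hr, by linarith⟩

/-- A mild system at zero temperature: the entropy has infinite slope at the minimal energy. -/
theorem Triple.IsMild.exists_of_zero (hA : IsSystem A) (hM : A.IsMild)
    (hE : E ∈ A.energyRange) (hT : ((0 : ℝ) : EReal) ∈ A.eqTemperatures E)
    (h : A.IsMinAt E g) (K : ℝ) : ∃ e s, E < e ∧ A.Attains e s ∧ s < g - K * (e - E) := by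
  refine h.exists_of_lt_betaRight hA ?_
  rw [EReal_eq_top_of_inv_eq_zero (h.betaRight_pos hA hE.2) (by simpa using (hM.inv_beta hE hT).2)]
  exact EReal.coe_lt_top K

/-- A state of lower energy, mixed to energy `E` with one at the end of a sufficiently steep chord
to the right, would have more entropy than the maximum at `E`. -/
theorem Triple.IsMild.le_of_zero (hA : IsSystem A) (hM : A.IsMild)
    (hE : E ∈ A.energyRange) (hT : ((0 : ℝ) : EReal) ∈ A.eqTemperatures E)
    (h : A.IsMinAt E g) (h' : A.Attains e s) : E ≤ e := by
  by_contra! he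
  have hEe : 0 < E - e := by linarith
  obtain ⟨e₁, s₁, he₁, hat, hs₁⟩ := hM.exists_of_zero hA hE hT h ((s - g) / (E - e))
  have hE₁ : 0 < e₁ - E := by linarith
  have hee : 0 < e₁ - e := by linarith
  set t := (E - e) / (e₁ - e) with ht
  have ht0 : 0 < t := by positivity
  have ht1 : t ≤ 1 := (div_le_one hee).2 (by linarith)
  have hte : t * (e₁ - e) = E - e := by rw [ht]; field_simp
  obtain ⟨r, hr, hatr⟩ := h'.mix hA ⟨ht0.le, ht1⟩ hat
  rw [show (1 - t) * e + t * e₁ = E by linarith] at hatr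
  have h1 := h.le r hatr
  have h2 := mul_lt_mul_of_pos_left hs₁ ht0
  have h3 : t * ((s - g) / (E - e) * (e₁ - E)) = (1 - t) * (s - g) := by
    have : (1 - t) * (E - e) = t * (e₁ - E) := by linarith
    field_simp
    linear_combination -(s - g) * this
  linarith

/-- Continuity from the right of the minimal negative entropy. -/
theorem IsSystem.exists_forall_le_ent (hA : IsSystem A) (hK : A.IsKUnstable)
    (hex : ∃ u, A.IsState 1 u ∧ A.en u ≤ ENNReal.ofReal E)
    (hmin : ∀ v, A.IsState 1 v → A.en v ≤ ENNReal.ofReal E → ENNReal.ofReal g ≤ A.ent v)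
    {δ : ℝ} (hδ : 0 < δ) : ∃ η : ℝ, 0 < η ∧
      ∀ v, A.IsState 1 v → A.en v ≤ ENNReal.ofReal (E + η) → ENNReal.ofReal (g - δ) ≤ A.ent v := by
  obtain ⟨u, hu, hue, hsup⟩ := hA.exists_le_iSup_entInf hK (a := ENNReal.ofReal E)
    ENNReal.ofReal_ne_top fun b hb => by
      obtain ⟨u, hu, hue⟩ := hex
      exact ⟨u, hu, hue.trans hb.le⟩
  rcases le_or_gt g 0 with hg | hg
  · refine ⟨1, one_pos, fun v _ _ => ?_⟩
    rw [ENNReal.ofReal_of_nonpos (by linarith)]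
    exact zero_le
  have hlt : ENNReal.ofReal (g - δ) < ⨆ k : ℕ, A.entInf (ENNReal.ofReal E + ((k : ℝ≥0∞) + 1)⁻¹) :=
    ((ENNReal.ofReal_lt_ofReal_iff hg).2 (by linarith)).trans_le ((hmin u hu hue).trans hsup)
  obtain ⟨k, hk⟩ := lt_iSup_iff.1 hlt
  refine ⟨((k : ℝ) + 1)⁻¹, by positivity, fun v hv hve => hk.le.trans (entInf_le hv (hve.trans ?_))⟩
  refine ENNReal.ofReal_add_le.trans (add_le_add_right (le_of_eq ?_) _)
  rw [ENNReal.ofReal_inv_of_pos (by positivity), ENNReal.ofReal_add (by positivity) zero_le_one]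
  simp

end Reservoir

/-! ### Equilibria of composites -/

section Composite

open Triple

theorem secondCountable_of_finiteDimensional (V : Type*) [NormedAddCommGroup V] [NormedSpace ℝ V]
    [FiniteDimensional ℝ V] : SecondCountableTopology V :=
  have := FiniteDimensional.proper ℝ V
  inferInstance

variable {V W : Type*} [NormedAddCommGroup V] [NormedSpace ℝ V] [FiniteDimensional ℝ V]
  [MeasurableSpace V] [BorelSpace V] [NormedAddCommGroup W] [NormedSpace ℝ W]
  [FiniteDimensional ℝ W] [MeasurableSpace W] [BorelSpace W] {A : Triple V} {R : Triple W}
  {U E g : ℝ} {N : ℕ}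

theorem isEquilibrium_iff {X : Type*} [NormedAddCommGroup X] [NormedSpace ℝ X]
    [MeasurableSpace X] [BorelSpace X] {B : Triple X} (hB : B.IsRegular) {w : X → ℝ≥0∞}
    (hE : 0 ≤ E) : B.IsEquilibrium E w ↔ B.IsState 1 w ∧ B.en w = ENNReal.ofReal E ∧
      ∀ v, B.IsState 1 v → B.en v = ENNReal.ofReal E → B.ent w ≤ B.ent v := by
  have key : ∀ v, B.energy v = (E : EReal) ↔ B.en v = ENNReal.ofReal E := fun v => by
    rw [energy_eq_en, ← coe_ofReal hE, EReal.coe_ennreal_eq_coe_ennreal_iff]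
  constructor
  · rintro ⟨h1, h2, h3⟩
    exact ⟨h1, (key w).1 h2, fun v hv hve =>
      (h1.entropy_le_iff hB hv).1 (h3 v hv ((key v).2 hve))⟩
  · rintro ⟨h1, h2, h3⟩
    exact ⟨h1, (key w).2 h2, fun v hv hve =>
      (h1.entropy_le_iff hB hv).2 (h3 v hv ((key v).1 hve))⟩

theorem ofReal_add_natCast_mul (hU : 0 ≤ U) (hE : 0 ≤ E) (N : ℕ) :
    ENNReal.ofReal (U + N * E) = ENNReal.ofReal U + N * ENNReal.ofReal E := by
  rw [ENNReal.ofReal_add hU (by positivity), ENNReal.ofReal_mul (by positivity),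
    ENNReal.ofReal_natCast]

/-- A pair of states minimizing the sum of the negative entropies at the given total energy. -/
structure IsMinPair (A : Triple V) (R : Triple W) (N : ℕ) (c : ℝ≥0∞) (u : V → ℝ≥0∞)
    (v : W → ℝ≥0∞) : Prop where
  fst : A.IsState 1 u
  snd : R.IsState 1 v
  en_eq : A.en u + N * R.en v = c
  le : ∀ u' v', A.IsState 1 u' → R.IsState 1 v' → A.en u' + N * R.en v' = c →
    A.ent u + N * R.ent v ≤ A.ent u' + N * R.ent v'

theorem exists_prod_pow (hA : A.IsRegular) (hR : R.IsRegular) {u : V → ℝ≥0∞} {v : W → ℝ≥0∞}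
    (hu : A.IsState 1 u) (hv : R.IsState 1 v) (N : ℕ) :
    ∃ w, (A.prod (R.pow N)).IsState 1 w ∧ (A.prod (R.pow N)).en w = A.en u + N * R.en v ∧
      (A.prod (R.pow N)).ent w = A.ent u + N * R.ent v := by
  have := secondCountable_of_finiteDimensional V
  have := secondCountable_of_finiteDimensional W
  obtain ⟨z, hz, hze, hzs⟩ := hv.exists_pow hR N
  have hRN := Triple.IsRegular.pow hR N
  exact ⟨_, hu.prodState hA hRN hz, by rw [en_prodState hA hRN hu hz, hze],
    by rw [ent_prodState hA hRN hu hz, hzs]⟩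

/-- With `exists_prod_pow` this replaces optimization over the composite by optimization over pairs.
-/
theorem exists_of_prod_pow (hA : A.IsRegular) (hR : R.IsRegular) {w : V × (Fin N → W) → ℝ≥0∞}
    (hw : (A.prod (R.pow N)).IsState 1 w) :
    A.IsState 1 ((R.pow N).marginal w) ∧ ∃ v, R.IsState 1 v ∧
      (A.prod (R.pow N)).en w = A.en ((R.pow N).marginal w) + N * R.en v ∧
      A.ent ((R.pow N).marginal w) + N * R.ent v ≤ (A.prod (R.pow N)).ent w := by
  have := secondCountable_of_finiteDimensional V
  have := secondCountable_of_finiteDimensional W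
  have hRN := Triple.IsRegular.pow hR N
  obtain ⟨v, hv, hve, hvs⟩ := IsState.exists_of_pow hR N (hw.marginalSnd hA hRN)
  refine ⟨hw.marginal hA hRN, v, hv, by rw [en_prod hA hRN hw, hve], ?_⟩
  exact (add_le_add_right hvs _).trans (ent_marginal_add_le hA hRN hw)

theorem Triple.IsRegular.prod_pow (hA : A.IsRegular) (hR : R.IsRegular) (N : ℕ) :
    (A.prod (R.pow N)).IsRegular := by
  have := secondCountable_of_finiteDimensional V
  have := secondCountable_of_finiteDimensional W
  exact Triple.IsRegular.prod hA (Triple.IsRegular.pow hR N)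

/-- The marginals of an equilibrium of a composite form a minimizing pair. -/
theorem Triple.IsEquilibrium.exists_isMinPair (hA : A.IsRegular) (hR : R.IsRegular)
    (hU : 0 ≤ U) (hE : 0 ≤ E) {w : V × (Fin N → W) → ℝ≥0∞}
    (hw : (A.prod (R.pow N)).IsEquilibrium (U + N * E) w) :
    ∃ v, IsMinPair A R N (ENNReal.ofReal U + N * ENNReal.ofReal E) ((R.pow N).marginal w) v ∧
      (A.prod (R.pow N)).ent w = A.ent ((R.pow N).marginal w) + N * R.ent v := by
  have := secondCountable_of_finiteDimensional V
  have := secondCountable_of_finiteDimensional W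
  obtain ⟨hws, hwe, hwm⟩ := (isEquilibrium_iff (hA.prod_pow hR N) (by positivity)).1 hw
  rw [ofReal_add_natCast_mul hU hE] at hwe hwm
  obtain ⟨hm, v, hv, hve, hvs⟩ := exists_of_prod_pow hA hR hws
  have hle : ∀ u' v', A.IsState 1 u' → R.IsState 1 v' →
      A.en u' + N * R.en v' = ENNReal.ofReal U + N * ENNReal.ofReal E →
      (A.prod (R.pow N)).ent w ≤ A.ent u' + N * R.ent v' := by
    intro u' v' hu' hv' h
    obtain ⟨z, hz, hze, hzs⟩ := exists_prod_pow hA hR hu' hv' N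
    rw [← hzs]
    exact hwm z hz (hze.trans h)
  refine ⟨v, ⟨hm, hv, hve.symm.trans hwe, fun u' v' hu' hv' h => hvs.trans (hle u' v' hu' hv' h)⟩,
    le_antisymm (hle _ _ hm hv (hve.symm.trans hwe)) hvs⟩

theorem exists_isEquilibrium_prod_pow (hA : IsSystem A) (hR : IsSystem R) (hAK : A.IsKUnstable)
    (hRK : R.IsKUnstable) (hU : U ∈ A.energyRange) (hE : E ∈ R.energyRange) (N : ℕ) :
    ∃ w, (A.prod (R.pow N)).IsEquilibrium (U + N * E) w := by
  have := secondCountable_of_finiteDimensional V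
  have := secondCountable_of_finiteDimensional W
  obtain ⟨hU0, hU1, hUex⟩ := hA.exists_of_mem_energyRange hAK hU
  obtain ⟨hE0, hE1, hEex⟩ := hR.exists_of_mem_energyRange hRK hE
  have hAr := hA.isRegular
  have hRr := hR.isRegular
  obtain ⟨u, v, hu, hv, huv, hmin⟩ := exists_min_pair hA hR hAK hRK N hUex hEex hU1 hE1
  obtain ⟨w, hw, hwe, hws⟩ := exists_prod_pow hAr hRr hu hv N
  refine ⟨w, (isEquilibrium_iff (hAr.prod_pow hRr N) (by positivity)).2 ⟨hw, ?_, fun z hz hze => ?_⟩⟩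
  · rw [hwe, huv, ofReal_add_natCast_mul hU0 hE0]
  · rw [ofReal_add_natCast_mul hU0 hE0] at hze
    obtain ⟨hm, v', hv', hve', hvs'⟩ := exists_of_prod_pow hAr hRr hz
    rw [hws]
    exact (hmin _ _ hm hv' (hve'.symm.trans hze)).trans hvs'

theorem Triple.IsMinAt.le_ent_pow (hR : R.IsRegular) (hg : R.IsMinAt E g)
    {w : (Fin N → W) → ℝ≥0∞} (hw : (R.pow N).IsState 1 w)
    (hwe : (R.pow N).en w = N * ENNReal.ofReal E) : N * ENNReal.ofReal g ≤ (R.pow N).ent w := by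
  have := secondCountable_of_finiteDimensional W
  rcases Nat.eq_zero_or_pos N with rfl | hN
  · simp
  obtain ⟨v, hv, hve, hvs⟩ := IsState.exists_of_pow hR N hw
  have hN0 : (N : ℝ≥0∞) ≠ 0 := by exact_mod_cast hN.ne'
  rw [hwe, ENNReal.mul_right_inj hN0 (ENNReal.natCast_ne_top N)] at hve
  refine le_trans ?_ hvs
  gcongr
  by_cases h : R.ent v = ∞
  · simp [h]
  · have := hg.le (R.ent v).toReal ⟨hg.attains.1, ENNReal.toReal_nonneg, v, hv, hve.symm,
      (ENNReal.ofReal_toReal h).symm⟩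
    rw [← ENNReal.ofReal_toReal h]
    exact ENNReal.ofReal_le_ofReal this

theorem Triple.IsMinAt.exists_pow (hR : R.IsRegular) (hg : R.IsMinAt E g) (N : ℕ) :
    ∃ w, (R.pow N).IsState 1 w ∧ (R.pow N).en w = N * ENNReal.ofReal E ∧
      (R.pow N).ent w = N * ENNReal.ofReal g := by
  have := secondCountable_of_finiteDimensional W
  obtain ⟨hE0, hg0, v, hv, hve, hvs⟩ := hg.attains
  obtain ⟨w, hw, hwe, hws⟩ := hv.exists_pow hR N
  exact ⟨w, hw, by rw [hwe, hve], by rw [hws, hvs]⟩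

theorem Triple.IsMinAt.exists_isEquilibrium_pow (hR : R.IsRegular) (hg : R.IsMinAt E g) (N : ℕ) :
    ∃ w, (R.pow N).IsEquilibrium (N * E) w := by
  have := secondCountable_of_finiteDimensional W
  have hE0 := hg.attains.1
  obtain ⟨w, hw, hwe, hws⟩ := hg.exists_pow hR N
  have h := ofReal_add_natCast_mul le_rfl hE0 N
  simp only [zero_add, ENNReal.ofReal_zero] at h
  refine ⟨w, (isEquilibrium_iff (Triple.IsRegular.pow hR N) (by positivity)).2
    ⟨hw, by rw [hwe, h], fun z hz hze => ?_⟩⟩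
  rw [hws]
  exact hg.le_ent_pow hR hz (by rw [hze, h])

theorem Triple.IsMinAt.ent_eq_of_isEquilibrium (hR : R.IsRegular) (hg : R.IsMinAt E g)
    {w : (Fin N → W) → ℝ≥0∞} (hw : (R.pow N).IsEquilibrium (N * E) w) :
    (R.pow N).ent w = N * ENNReal.ofReal g := by
  have := secondCountable_of_finiteDimensional W
  have hE0 := hg.attains.1
  have h := ofReal_add_natCast_mul le_rfl hE0 N
  simp only [zero_add, ENNReal.ofReal_zero] at h
  obtain ⟨hws, hwe, hwm⟩ := (isEquilibrium_iff (Triple.IsRegular.pow hR N) (by positivity)).1 hw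
  rw [h] at hwe hwm
  obtain ⟨z, hz, hze, hzs⟩ := hg.exists_pow hR N
  exact le_antisymm (hzs ▸ hwm z hz hze) (hg.le_ent_pow hR hws hwe)

/-- The first component of a minimizing pair is an equilibrium. -/
theorem IsMinPair.isEquilibrium_fst (hA : IsSystem A) (hR : IsSystem R)
    (hRK : R.IsKUnstable) {c : ℝ≥0∞} (hc : c ≠ ∞) {u : V → ℝ≥0∞} {v : W → ℝ≥0∞}
    (h : IsMinPair A R N c u v) : A.IsEquilibrium (A.en u).toReal u := by
  have hut : A.en u ≠ ∞ := ne_top_of_le_ne_top hc (le_self_add.trans h.en_eq.le)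
  rw [isEquilibrium_iff hA.isRegular ENNReal.toReal_nonneg, ENNReal.ofReal_toReal hut]
  refine ⟨h.fst, rfl, fun z hz hze => ?_⟩
  have hle := h.le z v hz h.snd (by rw [hze, h.en_eq])
  have hNt : (N : ℝ≥0∞) * R.ent v ≠ ∞ := by
    rcases Nat.eq_zero_or_pos N with rfl | hN
    · simp
    have hN0 : (N : ℝ≥0∞) ≠ 0 := by exact_mod_cast hN.ne'
    have hvt : R.en v ≠ ∞ := by
      intro htop
      have h1 := h.en_eq
      rw [htop, ENNReal.mul_top hN0, add_top] at h1
      exact hc h1.symm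
    exact ENNReal.mul_ne_top (ENNReal.natCast_ne_top N) (hR.ent_ne_top hRK h.snd hvt)
  exact (ENNReal.add_le_add_iff_right hNt).1 hle

end Composite

/-! ### Asymptotics of minimizing pairs -/

section Asymptotics

open Triple

variable {V W : Type*} [NormedAddCommGroup V] [NormedSpace ℝ V] [FiniteDimensional ℝ V]
  [MeasurableSpace V] [BorelSpace V] [NormedAddCommGroup W] [NormedSpace ℝ W]
  [FiniteDimensional ℝ W] [MeasurableSpace W] [BorelSpace W] {A : Triple V} {R : Triple W}
  {U E g T : ℝ} {N : ℕ}

/-- Passage to real numbers. A positive number of copies makes the reservoir energy finite, hence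
its entropy too. -/
theorem IsMinPair.exists_real (hA : IsSystem A) (hR : IsSystem R) (hAK : A.IsKUnstable)
    (hRK : R.IsKUnstable) (hN : 0 < N) (hU : 0 ≤ U) (hE : 0 ≤ E) {u : V → ℝ≥0∞} {v : W → ℝ≥0∞}
    (h : IsMinPair A R N (ENNReal.ofReal U + N * ENNReal.ofReal E) u v) :
    A.en u ≠ ∞ ∧ R.ent v ≠ ∞ ∧ ∃ b r, (R.ent v).toReal = r ∧ R.Attains b r ∧
      (A.en u).toReal + N * b = U + N * E ∧
      ∀ e s e' r', A.Attains e s → R.Attains e' r' → e + N * e' = U + N * E →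
        (A.ent u).toReal + N * r ≤ s + N * r' := by
  have hN0 : (N : ℝ≥0∞) ≠ 0 := by exact_mod_cast hN.ne'
  have hsum := h.en_eq
  rw [← ofReal_add_natCast_mul hU hE] at hsum
  have hut : A.en u ≠ ∞ := ne_top_of_le_ne_top ENNReal.ofReal_ne_top (le_self_add.trans hsum.le)
  have hvt : R.en v ≠ ∞ := by
    intro htop
    rw [htop, ENNReal.mul_top hN0, add_top] at hsum
    exact ENNReal.ofReal_ne_top hsum.symm
  have hus := hA.ent_ne_top hAK h.fst hut
  have hvs := hR.ent_ne_top hRK h.snd hvt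
  have hNt := ENNReal.natCast_ne_top N
  refine ⟨hut, hvs, (R.en v).toReal, _, rfl, hR.attains hRK h.snd hvt, ?_, ?_⟩
  · have := congrArg ENNReal.toReal hsum
    rwa [ENNReal.toReal_add hut (ENNReal.mul_ne_top hNt hvt), ENNReal.toReal_mul,
      ENNReal.toReal_natCast, ENNReal.toReal_ofReal (by positivity)] at this
  · rintro e s e' r' ⟨he, hs, u', hu', hue, hus'⟩ ⟨he', hr', v', hv', hve, hvs'⟩ heq
    have := h.le u' v' hu' hv' (by
      rw [hue, hve, ← ofReal_add_natCast_mul he he', heq, ofReal_add_natCast_mul hU hE])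
    rw [hus', hvs', ← ofReal_add_natCast_mul hs hr'] at this
    have := ENNReal.toReal_le_of_le_ofReal (by positivity) this
    rwa [ENNReal.toReal_add hus (ENNReal.mul_ne_top hNt hvs), ENNReal.toReal_mul,
      ENNReal.toReal_natCast] at this

/-- The midpoint gap solved for the Hellinger distance; any lower bound on the midpoint's negative
entropy now controls the distance. -/
theorem IsSystem.exists_attains_half (hA : IsSystem A) (hK : A.IsKUnstable) {u v : V → ℝ≥0∞}
    (hu : A.IsState 1 u) (hv : A.IsState 1 v) (hut : A.en u ≠ ∞) (hvt : A.en v ≠ ∞) :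
    ∃ r, A.Attains (((A.en u).toReal + (A.en v).toReal) / 2) r ∧
      A.hdist u v ≤ ENNReal.ofReal (2 * (A.ent u).toReal + 2 * (A.ent v).toReal - 4 * r) := by
  have hreg := hA.isRegular
  have hus := hA.ent_ne_top hK hu hut
  have hvs := hA.ent_ne_top hK hv hvt
  have ht : (1 / 2 : ℝ) ∈ Set.Icc (0 : ℝ) 1 := ⟨by norm_num, by norm_num⟩
  have hgap := ent_mix_gap hreg hu hv
  have hmix := IsState.mix ht hreg hu hv
  have hen : A.en (NAHam.mix (1 / 2) u v) ≠ ∞ := by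
    rw [en_mix hreg hu hv]; finiteness
  have hent := hA.ent_ne_top hK hmix hen
  have hdt : A.hdist u v ≠ ∞ := by
    intro htop
    rw [htop, ENNReal.mul_top (by simp), add_top, top_le_iff] at hgap
    exact absurd hgap (by finiteness)
  refine ⟨(A.ent (NAHam.mix (1 / 2) u v)).toReal, ?_, ?_⟩
  · have := hA.attains hK hmix hen
    rwa [en_mix hreg hu hv, toReal_mix ht hut hvt,
      show (1 - 1 / 2) * (A.en u).toReal + 1 / 2 * (A.en v).toReal
        = ((A.en u).toReal + (A.en v).toReal) / 2 by ring] at this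
  · have h1 := ENNReal.toReal_mono (by finiteness) hgap
    rw [toReal_mix ht hus hvs, ENNReal.toReal_add hent (by finiteness), ENNReal.toReal_mul,
      ENNReal.toReal_ofReal (by norm_num)] at h1
    rw [← ENNReal.ofReal_toReal hdt]
    exact ENNReal.ofReal_le_ofReal (by linarith)

theorem tendsto_zero_of_eventually_le {f : ℕ → ℝ≥0∞}
    (h : ∀ ε : ℝ, 0 < ε → ∀ᶠ n in atTop, f n ≤ ENNReal.ofReal ε) : Tendsto f atTop (𝓝 0) := by
  rw [ENNReal.tendsto_nhds_zero]
  intro ε hε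
  obtain ⟨r, -, hr, hrε⟩ := ENNReal.lt_iff_exists_real_btwn.1 hε
  filter_upwards [h r (by simpa using hr)] with n hn using hn.trans hrε.le

variable {u : ℕ → V → ℝ≥0∞} {v : ℕ → W → ℝ≥0∞}

/-! ### Reservoirs at positive temperature. -/

section Positive

variable (hA : IsSystem A) (hR : IsSystem R) (hAK : A.IsKUnstable)
    (hRK : R.IsKUnstable) (hM : R.IsMild) (hU : 0 ≤ U) (hE : E ∈ R.energyRange)
    (hT : (T : EReal) ∈ R.eqTemperatures E) (hT0 : 0 < T) (hg : R.IsMinAt E g)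
    (h : ∀ N, IsMinPair A R N (ENNReal.ofReal U + N * ENNReal.ofReal E) (u N) (v N))

include hA hR hAK hRK hM hU hE hT hT0 hg h

/-- Competitor: a state of energy `e` on `P`, with the remaining `U - e` distributed evenly over the
reservoir. -/
theorem eventually_ent_add_le {e s : ℝ} (hes : A.Attains e s) {ε : ℝ} (hε : 0 < ε) :
    ∀ᶠ N : ℕ in atTop, (A.ent (u N)).toReal + N * (R.ent (v N)).toReal
      ≤ s + N * g - T⁻¹ * (U - e) + ε := by
  filter_upwards [hM.eventually_exists hR hE hT hT0 hg (U - e) hε, eventually_gt_atTop 0]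
    with N ⟨r, hr, hrN⟩ hN
  obtain ⟨-, -, b, r', rfl, -, -, hle⟩ := (h N).exists_real hA hR hAK hRK hN hU hg.attains.1
  have hN' : (0 : ℝ) < N := by exact_mod_cast hN
  have := hle e s _ r hes hr (by field_simp; ring)
  linarith

/-- The tangent inequality for one copy, multiplied by `N`; energy conservation identifies the total
energy gained by the reservoir. -/
theorem le_mul_ent (hN : 0 < N) :
    N * g - T⁻¹ * (U - (A.en (u N)).toReal) ≤ N * (R.ent (v N)).toReal := by
  obtain ⟨-, -, b, r', rfl, hb, hsum, -⟩ := (h N).exists_real hA hR hAK hRK hN hU hg.attains.1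
  have h1 := hM.sub_le hR hE hT hT0 hg hb
  have hN' : (0 : ℝ) ≤ N := by positivity
  have h2 := mul_le_mul_of_nonneg_left h1 hN'
  have h3 : (N : ℝ) * (T⁻¹ * (b - E)) = T⁻¹ * (U - (A.en (u N)).toReal) := by
    linear_combination T⁻¹ * hsum
  linarith

theorem eventually_free_le {e s : ℝ} (hes : A.Attains e s) {ε : ℝ} (hε : 0 < ε) :
    ∀ᶠ N : ℕ in atTop, (A.en (u N)).toReal + T * (A.ent (u N)).toReal ≤ e + T * s + ε := by
  filter_upwards [eventually_ent_add_le hA hR hAK hRK hM hU hE hT hT0 hg h hes (div_pos hε hT0),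
    eventually_gt_atTop 0] with N hN hN0
  have h1 := le_mul_ent hA hR hAK hRK hM hU hE hT hT0 hg h hN0
  have h2 : (A.ent (u N)).toReal + T⁻¹ * (A.en (u N)).toReal ≤ s + T⁻¹ * e + ε / T := by linarith
  have h3 := mul_le_mul_of_nonneg_left h2 hT0.le
  have h4 : T * ((A.ent (u N)).toReal + T⁻¹ * (A.en (u N)).toReal)
      = (A.en (u N)).toReal + T * (A.ent (u N)).toReal := by field_simp; ring
  have h5 : T * (s + T⁻¹ * e + ε / T) = e + T * s + ε := by field_simp; ring
  linarith

/-- The midpoint of `u N` and `w` has free energy at least that of `w`, so the Hellinger distance is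
at most `2 / T` times the excess free energy of `u N`, which tends to zero. -/
theorem tendsto_hdist_of_pos {w : V → ℝ≥0∞} (hw : A.IsState 1 w) (hwt : A.en w ≠ ∞)
    (hmin : ∀ e s, A.Attains e s → (A.en w).toReal + T * (A.ent w).toReal ≤ e + T * s) :
    (∃ B : ℝ, ∀ᶠ N in atTop, A.en (u N) ≤ ENNReal.ofReal B) ∧
      Tendsto (fun N => A.hdist (u N) w) atTop (𝓝 0) := by
  have hat := hA.attains hAK hw hwt
  refine ⟨⟨(A.en w).toReal + T * (A.ent w).toReal + 1, ?_⟩,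
    tendsto_zero_of_eventually_le fun ε hε => ?_⟩
  · filter_upwards [eventually_free_le hA hR hAK hRK hM hU hE hT hT0 hg h hat one_pos,
      eventually_gt_atTop 0] with N hN hN0
    obtain ⟨hut, -⟩ := (h N).exists_real hA hR hAK hRK hN0 hU hg.attains.1
    rw [← ENNReal.ofReal_toReal hut]
    refine ENNReal.ofReal_le_ofReal ?_
    have : 0 ≤ T * (A.ent (u N)).toReal := mul_nonneg hT0.le ENNReal.toReal_nonneg
    linarith
  · filter_upwards [eventually_free_le hA hR hAK hRK hM hU hE hT hT0 hg h hat
      (show 0 < T * ε / 2 by positivity), eventually_gt_atTop 0] with N hN hN0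
    obtain ⟨hut, -⟩ := (h N).exists_real hA hR hAK hRK hN0 hU hg.attains.1
    obtain ⟨r, hr, hd⟩ := hA.exists_attains_half hAK (h N).fst hw hut hwt
    refine hd.trans (ENNReal.ofReal_le_ofReal ?_)
    have h1 := hmin _ _ hr
    exact le_of_mul_le_mul_left (by linarith) hT0

/-- The limit of the composite entropy. -/
theorem tendsto_ent_add {w : V → ℝ≥0∞} (hw : A.IsState 1 w) (hwt : A.en w ≠ ∞)
    (hmin : ∀ e s, A.Attains e s → (A.en w).toReal + T * (A.ent w).toReal ≤ e + T * s) :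
    Tendsto (fun N : ℕ => (A.ent (u N)).toReal + N * (R.ent (v N)).toReal - N * g) atTop
      (𝓝 (T⁻¹ * ((A.en w).toReal + T * (A.ent w).toReal - U))) := by
  have hat := hA.attains hAK hw hwt
  have hTT : T⁻¹ * (T * (A.ent w).toReal) = (A.ent w).toReal := by field_simp
  rw [Metric.tendsto_atTop']
  intro ε hε
  obtain ⟨N₀, hN₀⟩ := ((eventually_ent_add_le hA hR hAK hRK hM hU hE hT hT0 hg h hat
    (half_pos hε)).and (eventually_gt_atTop 0)).exists_forall_of_atTop
  refine ⟨N₀, fun N hN => ?_⟩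
  obtain ⟨h1, hN0⟩ := hN₀ N hN.le
  have h2 := le_mul_ent hA hR hAK hRK hM hU hE hT hT0 hg h hN0
  obtain ⟨hut, -⟩ := (h N).exists_real hA hR hAK hRK hN0 hU hg.attains.1
  have h3 := mul_le_mul_of_nonneg_left (hmin _ _ (hA.attains hAK (h N).fst hut))
    (inv_pos.2 hT0).le
  have h4 : T⁻¹ * (T * (A.ent (u N)).toReal) = (A.ent (u N)).toReal := by field_simp
  rw [Real.dist_eq, abs_lt]
  constructor <;> nlinarith

end Positive

/-! ### Reservoirs at zero temperature. -/

section Zero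

theorem IsSystem.exists_forall_attains_le (hA : IsSystem A) (hK : A.IsKUnstable)
    (hex : ∃ u, A.IsState 1 u ∧ A.en u ≤ ENNReal.ofReal E)
    (hmin : ∀ v, A.IsState 1 v → A.en v ≤ ENNReal.ofReal E → ENNReal.ofReal g ≤ A.ent v)
    {δ : ℝ} (hδ : 0 < δ) : ∃ η : ℝ, 0 < η ∧ ∀ e s, A.Attains e s → e ≤ E + η → g - δ ≤ s := by
  obtain ⟨η, hη, h⟩ := hA.exists_forall_le_ent hK hex hmin hδ
  refine ⟨η, hη, ?_⟩
  rintro e s ⟨he, hs, v, hv, hve, hvs⟩ hle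
  have := h v hv (by rw [hve]; exact ENNReal.ofReal_le_ofReal hle)
  rw [hvs] at this
  exact (ENNReal.ofReal_le_ofReal_iff hs).1 this

variable (hA : IsSystem A) (hR : IsSystem R) (hAK : A.IsKUnstable)
    (hRK : R.IsKUnstable) (hM : R.IsMild) (hU : 0 ≤ U) (hE : E ∈ R.energyRange)
    (hT : ((0 : ℝ) : EReal) ∈ R.eqTemperatures E) (hg : R.IsMinAt E g)
    (hg' : ∀ v, R.IsState 1 v → R.en v ≤ ENNReal.ofReal E → ENNReal.ofReal g ≤ R.ent v)
    (h : ∀ N, IsMinPair A R N (ENNReal.ofReal U + N * ENNReal.ofReal E) (u N) (v N))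

include hA hR hAK hRK hM hU hE hT hg hg' h

/-- Compare with the pair in which `P` has the minimal energy `e` and the reservoir receives the
excess `a - e`. The reservoir entropy is so steep that this transfer gains at least `K / 2` per unit
of energy; optimality of the pair then gives `ent (u N) + K / 2 * (a - e) ≤ s`, which bounds the
excess and the negative entropy at once. -/
theorem eventually_le_of_zero {e s : ℝ} (hes : A.Attains e s)
    (hmin : ∀ e' s', A.Attains e' s' → e ≤ e') {δ : ℝ} (hδ : 0 < δ) :
    ∀ᶠ N in atTop, (A.en (u N)).toReal ≤ U ∧ (A.en (u N)).toReal ≤ e + δ ∧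
      (A.ent (u N)).toReal ≤ s := by
  have hs0 : 0 ≤ s := hes.2.1
  -- Chosen so that an excess of `δ` would gain `K / 2 * δ = s + 1`, more than is available.
  set K : ℝ := 2 * (s + 1) / δ with hK
  have hK0 : 0 < K := by positivity
  obtain ⟨e₁, s₁, he₁, hat₁, hs₁⟩ := hM.exists_of_zero hR hE hT hg K
  have hx0 : 0 < e₁ - E := by linarith
  obtain ⟨hE0, -, hex⟩ := hR.exists_of_mem_energyRange hRK hE
  -- The reservoir energy `b` is only close to `E`. Right continuity gives `r ≥ g - K / 2 * (e₁ -
  -- E)` there, so half of the slope `K` of the chord from `E` to `e₁` is left.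
  obtain ⟨η, hη, hηle⟩ := hR.exists_forall_attains_le hRK hex hg'
    (show 0 < K / 2 * (e₁ - E) by positivity)
  obtain ⟨M, hMη⟩ := exists_nat_gt (U / η)
  -- For such `N` the reservoir energy lies in the lower half of `[E, e₁]`, which leaves room for
  -- the excess and makes the weight `t` below at most `1`.
  obtain ⟨M', hMx⟩ := exists_nat_gt (2 * U / (e₁ - E))
  filter_upwards [eventually_gt_atTop 0, eventually_ge_atTop M, eventually_ge_atTop M']
    with N hN hNM hNM'
  obtain ⟨hut, -, b, r, hr, hb, hsum, hle⟩ := (h N).exists_real hA hR hAK hRK hN hU hE0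
  have hNp : (0 : ℝ) < N := by exact_mod_cast hN
  have h1 : U < N * η := (div_lt_iff₀ hη).1 (hMη.trans_le (by exact_mod_cast hNM))
  have h2 : 2 * U < N * (e₁ - E) := (div_lt_iff₀ hx0).1 (hMx.trans_le (by exact_mod_cast hNM'))
  set a := (A.en (u N)).toReal
  set σ := (A.ent (u N)).toReal
  have hσ0 : 0 ≤ σ := ENNReal.toReal_nonneg
  have ha0 : 0 ≤ a := ENNReal.toReal_nonneg
  have hea : e ≤ a := hmin _ _ (hA.attains hAK (h N).fst hut)
  have hEb : E ≤ b := hM.le_of_zero hR hE hT hg hb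
  have haU : a ≤ U := by nlinarith
  have hbη : b ≤ E + η := by
    have : N * b ≤ N * (E + η) := by linarith
    exact le_of_mul_le_mul_left this hNp
  have hrlow := hηle b r hb hbη
  have hbx : 2 * (b - E) ≤ e₁ - E := by
    have : N * (2 * (b - E)) ≤ N * (e₁ - E) := by linarith
    exact le_of_mul_le_mul_left this hNp
  set x := e₁ - b with hx
  have hxp : 0 < x := by linarith
  set t := (a - e) / (N * x) with ht
  have hNx : 0 < N * x := mul_pos hNp hxp
  have htx : N * (t * x) = a - e := by rw [ht]; field_simp
  have htI : t ∈ Set.Icc (0 : ℝ) 1 := by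
    refine ⟨div_nonneg (by linarith) hNx.le, (div_le_one hNx).2 ?_⟩
    have : N * (e₁ - E) ≤ N * (2 * x) := by gcongr; linarith
    have he0 : 0 ≤ e := hes.1
    linarith
  obtain ⟨r', hr', hatr⟩ := hb.mix hR htI hat₁
  have hopt := hle e s _ r' hes hatr (by
    have : e + N * ((1 - t) * b + t * e₁) = e + N * b + N * (t * x) := by rw [hx]; ring
    rw [this, htx]
    linarith)
  have hNr : N * r' ≤ N * ((1 - t) * r + t * s₁) := by gcongr
  have hdiff : s₁ - r ≤ -(K / 2 * (e₁ - E)) := by linarith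
  have hkey : N * t * (s₁ - r) ≤ -(K / 2 * (a - e)) := by
    have hNt : 0 ≤ N * t := mul_nonneg hNp.le htI.1
    have h3 := mul_le_mul_of_nonneg_left hdiff hNt
    have h4 : a - e ≤ N * t * (e₁ - E) := by
      rw [← htx, ← mul_assoc]
      gcongr
      linarith
    have h5 := mul_le_mul_of_nonneg_left h4 (show 0 ≤ K / 2 by positivity)
    linarith
  have hfin : σ + K / 2 * (a - e) ≤ s := by linarith
  have hKδ : K / 2 * δ = s + 1 := by rw [hK]; field_simp
  refine ⟨haU, ?_, ?_⟩
  · by_contra! hlt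
    have : K / 2 * δ ≤ K / 2 * (a - e) := by gcongr; linarith
    linarith
  · have : 0 ≤ K / 2 * (a - e) := mul_nonneg (by positivity) (by linarith)
    linarith

/-- The midpoint of `u N` and `w` has nearly minimal energy, so by right continuity its negative
entropy is at least `ent w - ε / 4`; with `ent (u N) ≤ ent w` the gap is at most `ε`. -/
theorem tendsto_hdist_of_zero {w : V → ℝ≥0∞} (hw : A.IsState 1 w) (hwt : A.en w ≠ ∞)
    (hmin : ∀ z, A.IsState 1 z → A.en w ≤ A.en z)
    (hmax : ∀ z, A.IsState 1 z → A.en z ≤ A.en w → A.ent w ≤ A.ent z) :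
    (∃ B : ℝ, ∀ᶠ N in atTop, A.en (u N) ≤ ENNReal.ofReal B) ∧
      Tendsto (fun N => A.hdist (u N) w) atTop (𝓝 0) := by
  have hat := hA.attains hAK hw hwt
  have hE0 := hg.attains.1
  have hmin' : ∀ e' s', A.Attains e' s' → (A.en w).toReal ≤ e' := by
    rintro e' s' ⟨he, -, z, hz, hze, -⟩
    exact ENNReal.toReal_le_of_le_ofReal he ((hmin z hz).trans hze.le)
  refine ⟨⟨U, ?_⟩, tendsto_zero_of_eventually_le fun ε hε => ?_⟩
  · filter_upwards [eventually_le_of_zero hA hR hAK hRK hM hU hE hT hg hg' h hat hmin' one_pos,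
      eventually_gt_atTop 0] with N hN hN0
    obtain ⟨hut, -⟩ := (h N).exists_real hA hR hAK hRK hN0 hU hE0
    rw [← ENNReal.ofReal_toReal hut]
    exact ENNReal.ofReal_le_ofReal hN.1
  · obtain ⟨η, hη, hηle⟩ := hA.exists_forall_attains_le hAK (E := (A.en w).toReal)
      (g := (A.ent w).toReal) ⟨w, hw, by rw [ENNReal.ofReal_toReal hwt]⟩ (fun z hz hze => by
        rw [ENNReal.ofReal_toReal hwt] at hze
        rw [ENNReal.ofReal_toReal (hA.ent_ne_top hAK hw hwt)]
        exact hmax z hz hze) (show 0 < ε / 4 by positivity)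
    filter_upwards [eventually_le_of_zero hA hR hAK hRK hM hU hE hT hg hg' h hat hmin' hη,
      eventually_gt_atTop 0] with N hN hN0
    obtain ⟨hut, -⟩ := (h N).exists_real hA hR hAK hRK hN0 hU hE0
    obtain ⟨r, hr, hd⟩ := hA.exists_attains_half hAK (h N).fst hw hut hwt
    refine hd.trans (ENNReal.ofReal_le_ofReal ?_)
    have := hηle _ r hr (by linarith [hN.2.1])
    linarith [hN.2.2]

end Zero

end Asymptotics

/-! ### Convergence in `L^p` -/

section Lp

open Triple

/-- From `a - b = (√a - √b) (√a + √b)` and `(√a + √b)² ≤ 2 (a + b)`. -/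
theorem enorm_sub_le_hell {a b : ℝ≥0∞} (ha : a ≠ ∞) (hb : b ≠ ∞) :
    ‖a.toReal - b.toReal‖ₑ ≤ hell a b ^ (1 / 2 : ℝ) * (2 * (a + b)) ^ (1 / 2 : ℝ) := by
  lift a to NNReal using ha
  lift b to NNReal using hb
  have h2 : (2 * ((a : ℝ≥0∞) + b)) = ENNReal.ofReal (2 * ((a : ℝ) + b)) := by
    rw [ENNReal.ofReal_mul zero_le_two, ENNReal.ofReal_add a.coe_nonneg b.coe_nonneg]
    simp
  rw [h2, hell, ENNReal.ofReal_rpow_of_nonneg (by positivity) (by norm_num),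
    ENNReal.ofReal_rpow_of_nonneg (by positivity) (by norm_num), ← Real.sqrt_eq_rpow,
    ← Real.sqrt_eq_rpow, ← ENNReal.ofReal_mul (Real.sqrt_nonneg _), ← Real.sqrt_mul (sq_nonneg _),
    Real.enorm_eq_ofReal_abs]
  refine ENNReal.ofReal_le_ofReal (Real.abs_le_sqrt ?_)
  simp only [ENNReal.coe_toReal]
  have e1 : √(a : ℝ) ^ 2 = a := Real.sq_sqrt a.coe_nonneg
  have e2 : √(b : ℝ) ^ 2 = b := Real.sq_sqrt b.coe_nonneg
  have e3 : (a : ℝ) - b = (√(a : ℝ) - √(b : ℝ)) * (√(a : ℝ) + √(b : ℝ)) := by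
    linear_combination e2 - e1
  rw [e3, mul_pow]
  gcongr
  nlinarith [sq_nonneg (√(a : ℝ) - √(b : ℝ))]

theorem enorm_sub_rpow_le {a b : ℝ≥0∞} (ha : a ≠ ∞) (hb : b ≠ ∞) {q : ℝ} (hq : 0 ≤ q) :
    ‖a.toReal - b.toReal‖ₑ ^ q ≤ a ^ q + b ^ q := by
  have h1 : ‖a.toReal - b.toReal‖ₑ ≤ max a b := by
    rw [Real.enorm_eq_ofReal_abs, ← ENNReal.ofReal_toReal (show max a b ≠ ∞ by simp [ha, hb])]
    refine ENNReal.ofReal_le_ofReal ?_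
    rw [ENNReal.toReal_max ha hb]
    have hab : a.toReal - b.toReal ≤ max a.toReal b.toReal :=
      (sub_le_self _ ENNReal.toReal_nonneg).trans (le_max_left _ _)
    have hba : b.toReal - a.toReal ≤ max a.toReal b.toReal :=
      (sub_le_self _ ENNReal.toReal_nonneg).trans (le_max_right _ _)
    exact abs_le.2 ⟨by linarith, hab⟩
  refine (ENNReal.rpow_le_rpow h1 hq).trans ?_
  rcases le_total a b with h | h
  · rw [max_eq_right h]; exact le_add_self
  · rw [max_eq_left h]; exact le_self_add

variable {V : Type*} [NormedAddCommGroup V] [NormedSpace ℝ V]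
  [MeasurableSpace V] [BorelSpace V] {A : Triple V} {u v : V → ℝ≥0∞} {p q : ℝ}

/-- Interpolation of `L^p` between `L¹` and `L^q`. The `L¹` distance is controlled by the Hellinger
distance through the Cauchy-Schwarz inequality. -/
theorem lintegral_sub_rpow_le (hA : A.IsRegular) (hu : A.IsState 1 u) (hv : A.IsState 1 v)
    (hp : 1 ≤ p) (hpq : p < q) :
    ∫⁻ x, ‖(u x).toReal - (v x).toReal‖ₑ ^ p ∂A.vol
      ≤ ((A.hdist u v * A.vol Set.univ) ^ (1 / 2 : ℝ)
          * (4 * A.vol Set.univ) ^ (1 / 2 : ℝ)) ^ ((q - p) / (q - 1))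
        * (∫⁻ x, u x ^ q ∂A.vol + ∫⁻ x, v x ^ q ∂A.vol) ^ ((p - 1) / (q - 1)) := by
  have hq1 : 0 < q - 1 := by linarith
  have hu' := hu.aemeasurable_vol hA
  have hv' := hv.aemeasurable_vol hA
  set f : V → ℝ≥0∞ := fun x => ‖(u x).toReal - (v x).toReal‖ₑ with hf
  have hfm : AEMeasurable f A.vol := by fun_prop
  have hfin : ∀ᵐ x ∂A.vol, u x ≠ ∞ ∧ v x ≠ ∞ := (hu.ae_ne_top hA).and (hv.ae_ne_top hA)
  have hhell : AEMeasurable (fun x => hell (u x) (v x)) A.vol := by unfold hell; fun_prop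
  have h0 : 0 ≤ (q - p) / (q - 1) := div_nonneg (by linarith) hq1.le
  have h1 : 0 ≤ (p - 1) / (q - 1) := div_nonneg (by linarith) hq1.le
  have hsum : (q - p) / (q - 1) + (p - 1) / (q - 1) = 1 := by field_simp; ring
  have hexp : (q - p) / (q - 1) + q * ((p - 1) / (q - 1)) = p := by field_simp; ring
  calc ∫⁻ x, f x ^ p ∂A.vol
      = ∫⁻ x, f x ^ ((q - p) / (q - 1)) * (f x ^ q) ^ ((p - 1) / (q - 1)) ∂A.vol := by
        refine lintegral_congr fun x => ?_
        rw [← ENNReal.rpow_mul, ← ENNReal.rpow_add_of_nonneg _ _ h0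
          (mul_nonneg (by linarith) h1), hexp]
    _ ≤ (∫⁻ x, f x ∂A.vol) ^ ((q - p) / (q - 1))
        * (∫⁻ x, f x ^ q ∂A.vol) ^ ((p - 1) / (q - 1)) :=
        ENNReal.lintegral_mul_norm_pow_le hfm (hfm.pow_const _) h0 h1 hsum
    _ ≤ _ := by
        refine mul_le_mul' (ENNReal.rpow_le_rpow ?_ h0) (ENNReal.rpow_le_rpow ?_ h1)
        · calc ∫⁻ x, f x ∂A.vol
              ≤ ∫⁻ x, hell (u x) (v x) ^ (1 / 2 : ℝ) * (2 * (u x + v x)) ^ (1 / 2 : ℝ) ∂A.vol := by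
                refine lintegral_mono_ae ?_
                filter_upwards [hfin] with x hx using enorm_sub_le_hell hx.1 hx.2
            _ ≤ (∫⁻ x, hell (u x) (v x) ∂A.vol) ^ (1 / 2 : ℝ)
                * (∫⁻ x, 2 * (u x + v x) ∂A.vol) ^ (1 / 2 : ℝ) :=
                ENNReal.lintegral_mul_norm_pow_le hhell (by fun_prop) (by norm_num)
                  (by norm_num) (by norm_num)
            _ = _ := by
                rw [hdist, ENNReal.div_mul_cancel hA.vol_ne_zero hA.vol_ne_top,
                  lintegral_const_mul'' _ (by fun_prop), lintegral_add_left' hu', hu.mass, hv.mass,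
                  ← two_mul, ← mul_assoc]
                norm_num
        · rw [← lintegral_add_left' (by fun_prop)]
          refine lintegral_mono_ae ?_
          filter_upwards [hfin] with x hx using enorm_sub_rpow_le hx.1 hx.2 (by linarith)

theorem tendsto_eLpNorm_sub (hA : A.IsRegular) {w : ℕ → V → ℝ≥0∞} (hw : ∀ N, A.IsState 1 (w N))
    (hu : A.IsState 1 u) (hp : 1 ≤ p) (hpq : p < q) {K : ℝ≥0∞} (hK : K ≠ ∞)
    (hwK : ∀ᶠ N in atTop, ∫⁻ x, w N x ^ q ∂A.vol ≤ K) (huK : ∫⁻ x, u x ^ q ∂A.vol ≤ K)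
    (hlim : Tendsto (fun N => A.hdist (w N) u) atTop (𝓝 0)) :
    Tendsto (fun N => eLpNorm (fun x => (w N x).toReal - (u x).toReal) (ENNReal.ofReal p) A.vol)
      atTop (𝓝 0) := by
  have hq1 : 0 < q - 1 := by linarith
  have hp0 : 0 < p := by linarith
  have h0 : 0 < (q - p) / (q - 1) := div_pos (by linarith) hq1
  have h1 : 0 ≤ (p - 1) / (q - 1) := div_nonneg (by linarith) hq1.le
  have hb : Tendsto (fun N => ((A.hdist (w N) u * A.vol Set.univ) ^ (1 / 2 : ℝ)
          * (4 * A.vol Set.univ) ^ (1 / 2 : ℝ)) ^ ((q - p) / (q - 1))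
        * (K + K) ^ ((p - 1) / (q - 1))) atTop (𝓝 0) := by
    have e1 : Tendsto (fun N => A.hdist (w N) u * A.vol Set.univ) atTop (𝓝 0) := by
      simpa using ENNReal.Tendsto.mul_const hlim (Or.inr hA.vol_ne_top)
    have e2 : Tendsto (fun N => (A.hdist (w N) u * A.vol Set.univ) ^ (1 / 2 : ℝ)) atTop (𝓝 0) := by
      simpa [Function.comp_def] using
        (ENNReal.continuous_rpow_const (y := 1 / 2)).tendsto 0 |>.comp e1
    have hvt : (4 * A.vol Set.univ) ^ (1 / 2 : ℝ) ≠ ∞ := ENNReal.rpow_ne_top_of_nonneg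
      (by norm_num) (ENNReal.mul_ne_top (by norm_num) hA.vol_ne_top)
    have e3 := ENNReal.Tendsto.mul_const e2 (Or.inr hvt)
    rw [zero_mul] at e3
    have e4 := (ENNReal.continuous_rpow_const (y := (q - p) / (q - 1))).tendsto 0 |>.comp e3
    rw [ENNReal.zero_rpow_of_pos h0] at e4
    have hKt : (K + K) ^ ((p - 1) / (q - 1)) ≠ ∞ :=
      ENNReal.rpow_ne_top_of_nonneg h1 (by finiteness)
    have e5 := ENNReal.Tendsto.mul_const e4 (Or.inr hKt)
    rwa [zero_mul] at e5
  have hint : Tendsto (fun N => ∫⁻ x, ‖(w N x).toReal - (u x).toReal‖ₑ ^ p ∂A.vol) atTop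
      (𝓝 0) := by
    refine tendsto_of_tendsto_of_tendsto_of_le_of_le' tendsto_const_nhds hb
      (Eventually.of_forall fun _ => zero_le) ?_
    filter_upwards [hwK] with N hN
    refine (lintegral_sub_rpow_le hA (hw N) hu hp hpq).trans ?_
    gcongr
  have e6 := (ENNReal.continuous_rpow_const (y := 1 / p)).tendsto 0 |>.comp hint
  rw [ENNReal.zero_rpow_of_pos (by positivity)] at e6
  refine e6.congr fun N => ?_
  rw [eLpNorm_eq_lintegral_rpow_enorm_toReal (by simpa using hp0) ENNReal.ofReal_ne_top,
    ENNReal.toReal_ofReal hp0.le]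
  rfl

end Lp

/-! ### Finite energy, integrability and the free energy of canonical distributions. -/

section Final

open Triple

variable {V : Type*} [NormedAddCommGroup V] [NormedSpace ℝ V] [FiniteDimensional ℝ V]
  [MeasurableSpace V] [BorelSpace V] {A : Triple V} {u v : V → ℝ≥0∞} {p q T : ℝ}

theorem IsSystem.isState_of_en_ne_top (hA : IsSystem A) (hn : 0 < Module.finrank ℝ V)
    (hp : 1 ≤ p) (hpn : p * ((Module.finrank ℝ V : ℝ) - 1) ≤ Module.finrank ℝ V)
    (hu : A.IsState 1 u) (hut : A.en u ≠ ∞) : A.IsState p u := by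
  obtain ⟨C, hC, hCu⟩ := hA.exists_lintegral_rpow_le hn hp hpn
  refine ⟨hu.lsc, hu.pos, hu.logConvex, hu.mass, (hCu u hu).trans_lt ?_⟩
  have hb : ∫⁻ x, u x ∂A.bdry ≠ ∞ := by
    intro htop
    rw [en, htop, ENNReal.top_div_of_ne_top hA.isRegular.vol_ne_top] at hut
    exact hut rfl
  exact ENNReal.mul_lt_top hC.lt_top (ENNReal.rpow_lt_top_of_nonneg (by linarith) hb)

theorem IsSystem.tendsto_eLpNorm (hA : IsSystem A) (hn : 0 < Module.finrank ℝ V)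
    (hp : 1 ≤ p) (hpn : p * ((Module.finrank ℝ V : ℝ) - 1) < Module.finrank ℝ V)
    {w : ℕ → V → ℝ≥0∞} (hw : ∀ N, A.IsState 1 (w N)) (hu : A.IsState 1 u) (hut : A.en u ≠ ∞)
    {B : ℝ} (hB : ∀ᶠ N in atTop, A.en (w N) ≤ ENNReal.ofReal B)
    (hlim : Tendsto (fun N => A.hdist (w N) u) atTop (𝓝 0)) :
    Tendsto (fun N => eLpNorm (fun x => (w N x).toReal - (u x).toReal) (ENNReal.ofReal p) A.vol)
      atTop (𝓝 0) := by
  have hreg := hA.isRegular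
  have hn1 : (1 : ℝ) ≤ (Module.finrank ℝ V : ℝ) := by exact_mod_cast hn
  set n : ℝ := (Module.finrank ℝ V : ℝ)
  -- The strict inequality on `p` leaves room for a larger exponent: `δ n` is the slack, so `p + δ`
  -- is still admissible and its uniform bound feeds the interpolation.
  set δ : ℝ := (n - p * (n - 1)) / n with hδ
  have hδ0 : 0 < δ := div_pos (by linarith) (by linarith)
  have hδn : δ * (n - 1) ≤ n - p * (n - 1) := by
    have : δ * n = n - p * (n - 1) := by rw [hδ]; field_simp
    linarith
  obtain ⟨C, hC, hCu⟩ := hA.exists_lintegral_rpow_le hn (q := p + δ) (by linarith)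
    (by rw [add_mul]; linarith)
  set b : ℝ≥0∞ := max (ENNReal.ofReal B) (A.en u) with hb
  have hbt : b ≠ ∞ := by simp [hb, hut]
  have hbound : ∀ z, A.IsState 1 z → A.en z ≤ b →
      ∫⁻ x, z x ^ (p + δ) ∂A.vol ≤ C * (b * A.vol Set.univ) ^ (p + δ) := fun z hz hzb => by
    refine (hCu z hz).trans ?_
    gcongr
    exact (ENNReal.div_le_iff hreg.vol_ne_zero hreg.vol_ne_top).1 hzb
  refine tendsto_eLpNorm_sub hreg hw hu hp (q := p + δ) (by linarith)
    (K := C * (b * A.vol Set.univ) ^ (p + δ))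
    (ENNReal.mul_ne_top hC (ENNReal.rpow_ne_top_of_nonneg (by linarith)
      (ENNReal.mul_ne_top hbt hreg.vol_ne_top))) ?_ (hbound u hu (le_max_right _ _)) hlim
  filter_upwards [hB] with N hN using hbound _ (hw N) (hN.trans (le_max_left _ _))

theorem IsSystem.en_ne_top_of_isCanonical (hA : IsSystem A) (hK : A.IsKUnstable) (hT : 0 ≤ T)
    (hu : A.IsCanonical T u) : A.en u ≠ ∞ := by
  obtain ⟨-, hmin, -⟩ := (hA.isCanonical_iff hK hT).1 hu
  obtain ⟨w, hw, hlt⟩ := hA.exists_free_lt hK hT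
  exact ((le_self_add.trans (hmin w hw)).trans_lt hlt).ne_top

theorem IsSystem.freeEnergy_eq_coe (hA : IsSystem A) (hK : A.IsKUnstable) (hT : 0 ≤ T)
    (hu : A.IsState 1 u) (hut : A.en u ≠ ∞) :
    A.freeEnergy T u = (((A.en u).toReal + T * (A.ent u).toReal : ℝ) : EReal) := by
  have hus := hA.ent_ne_top hK hu hut
  rw [hA.freeEnergy_eq hK hT hu, ← EReal.coe_ennreal_toReal (by finiteness),
    ENNReal.toReal_add hut (by finiteness), ENNReal.toReal_mul, ENNReal.toReal_ofReal hT]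

theorem IsSystem.free_le_of_isCanonical (hA : IsSystem A) (hK : A.IsKUnstable) (hT : 0 ≤ T)
    (hu : A.IsCanonical T u) {e s : ℝ} (h : A.Attains e s) :
    (A.en u).toReal + T * (A.ent u).toReal ≤ e + T * s := by
  have hut := hA.en_ne_top_of_isCanonical hK hT hu
  obtain ⟨he, hs, v, hv, hve, hvs⟩ := h
  have hvt : A.en v ≠ ∞ := hve ▸ ENNReal.ofReal_ne_top
  have := hu.minimizes v hv
  rwa [hA.freeEnergy_eq_coe hK hT hu.state hut, hA.freeEnergy_eq_coe hK hT hv hvt,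
    EReal.coe_le_coe_iff, hve, hvs, ENNReal.toReal_ofReal he, ENNReal.toReal_ofReal hs] at this

end Final

end NAHam

/-! ### The main theorem. -/

theorem mainTheorem11
    {V W : Type*}
    [NormedAddCommGroup V] [NormedSpace ℝ V] [FiniteDimensional ℝ V]
    [MeasurableSpace V] [BorelSpace V]
    [NormedAddCommGroup W] [NormedSpace ℝ W] [FiniteDimensional ℝ W]
    [MeasurableSpace W] [BorelSpace W]
    (A : NAHam.Triple V) (R : NAHam.Triple W)
    (hA : NAHam.IsSystem A) (hR : NAHam.IsSystem R)
    (hAK : A.IsKUnstable) (hRK : R.IsKUnstable) (hRmild : R.IsMild)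
    (U : ℝ) (hU : U ∈ A.energyRange) (T : ℝ) (hT : 0 ≤ T) :
    (∃ uInf, A.IsCanonical T uInf) ∧
    (∀ N : ℕ, ∃ uT, (A.prod (R.pow N)).IsEquilibrium (U + N * R.canEnergy T) uT) ∧
    (∀ N : ℕ, ∃ uR, (R.pow N).IsEquilibrium (N * R.canEnergy T) uR) ∧
    ∀ uInf : V → ℝ≥0∞, A.IsCanonical T uInf →
    ∀ uT : (N : ℕ) → V × (Fin N → W) → ℝ≥0∞,
      (∀ N, (A.prod (R.pow N)).IsEquilibrium (U + N * R.canEnergy T) (uT N)) →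
      -- the marginals on `P` are equilibria of `A`
      (∀ N, ∃ U' : ℝ, A.IsEquilibrium U' ((R.pow N).marginal (uT N))) ∧
      -- they converge in `L^p`, for `1 ≤ p < n / (n - 1)`
      (∀ p : ℝ, 1 ≤ p → p * ((Module.finrank ℝ V : ℝ) - 1) < (Module.finrank ℝ V : ℝ) →
        (∀ N, A.IsState p ((R.pow N).marginal (uT N))) ∧ A.IsState p uInf ∧
        Tendsto (fun N : ℕ =>
            eLpNorm (fun x => ((R.pow N).marginal (uT N) x).toReal - (uInf x).toReal)
              (ENNReal.ofReal p) A.vol)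
          atTop (𝓝 0)) ∧
      -- the composite entropy gain, under positive heat capacity of the reservoir
      (0 < T → DifferentiableAt ℝ R.canEntropy T → 0 < deriv R.canEntropy T →
        ∀ uR : (N : ℕ) → (Fin N → W) → ℝ≥0∞,
          (∀ N, (R.pow N).IsEquilibrium (N * R.canEnergy T) (uR N)) →
        ∀ u : V → ℝ≥0∞, A.IsState 1 u → A.energy u = (U : EReal) →
        ∃ fInf f : ℝ, A.freeEnergy T uInf = (fInf : EReal) ∧ A.freeEnergy T u = (f : EReal) ∧
          Tendsto (fun N : ℕ =>
              (A.prod (R.pow N)).entropy (uT N)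
                - (A.prod (R.pow N)).entropy (NAHam.prodState u (uR N)))
            atTop (𝓝 ((-(1 / T) * (fInf - f) : ℝ) : EReal))) := by
  have hAr := hA.isRegular
  have hRr := hR.isRegular
  have := NAHam.secondCountable_of_finiteDimensional V
  have := NAHam.secondCountable_of_finiteDimensional W
  obtain ⟨hE, hTE⟩ := hR.canEnergy_mem hRK hT
  set E := R.canEnergy T
  obtain ⟨g, hg, hg'⟩ := hR.exists_isMinAt hRK hE
  obtain ⟨hU0, -, -⟩ := hA.exists_of_mem_energyRange hAK hU
  have hE0 := hg.attains.1
  refine ⟨hA.exists_isCanonical hAK hT,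
    NAHam.exists_isEquilibrium_prod_pow hA hR hAK hRK hU hE,
    hg.exists_isEquilibrium_pow hRr, fun uInf huInf uT huT => ?_⟩
  choose v hv hent using fun N => (huT N).exists_isMinPair hAr hRr hU0 hE0
  have hct : ∀ N : ℕ, ENNReal.ofReal U + N * ENNReal.ofReal E ≠ ∞ := fun N => by finiteness
  have hut : ∀ N, A.en ((R.pow N).marginal (uT N)) ≠ ∞ := fun N =>
    ne_top_of_le_ne_top (hct N) (le_self_add.trans (hv N).en_eq.le)
  have hst : ∀ N, A.IsState 1 ((R.pow N).marginal (uT N)) := fun N => (hv N).fst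
  have hInft := hA.en_ne_top_of_isCanonical hAK hT huInf
  have hn := hA.finrank_pos hAK
  refine ⟨fun N => ⟨_, (hv N).isEquilibrium_fst hA hR hRK (hct N)⟩, fun p hp hpn => ?_,
    fun hT0 _ _ uR huR u hu hue => ?_⟩
  · obtain ⟨⟨B, hB⟩, hlim⟩ : (∃ B : ℝ, ∀ᶠ N in atTop,
        A.en ((R.pow N).marginal (uT N)) ≤ ENNReal.ofReal B) ∧
        Tendsto (fun N => A.hdist ((R.pow N).marginal (uT N)) uInf) atTop (𝓝 0) := by
      rcases hT.eq_or_lt with rfl | hT0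
      · obtain ⟨h1, h2, h3⟩ := (hA.isCanonical_iff hAK le_rfl).1 huInf
        exact NAHam.tendsto_hdist_of_zero hA hR hAK hRK hRmild hU0 hE hTE hg hg' hv h1 hInft
          (fun z hz => by simpa using h2 z hz) (h3 rfl)
      · exact NAHam.tendsto_hdist_of_pos hA hR hAK hRK hRmild hU0 hE hTE hT0 hg hv huInf.state
          hInft fun e s h => hA.free_le_of_isCanonical hAK hT huInf h
    exact ⟨fun N => hA.isState_of_en_ne_top hn hp hpn.le (hst N) (hut N),
      hA.isState_of_en_ne_top hn hp hpn.le huInf.state hInft,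
      hA.tendsto_eLpNorm hn hp hpn hst huInf.state hInft hB hlim⟩
  · obtain ⟨-, hue⟩ := NAHam.coe_eq_coe_ofReal ((A.energy_eq_en u).symm.trans hue)
    have huet : A.en u ≠ ∞ := hue ▸ ENNReal.ofReal_ne_top
    have hus := hA.ent_ne_top hAK hu huet
    refine ⟨_, _, hA.freeEnergy_eq_coe hAK hT huInf.state hInft,
      hA.freeEnergy_eq_coe hAK hT hu huet, ?_⟩
    -- The entropy difference equals `ent u` minus `ent u_N + N * ent v_N - N * g`, because the
    -- entropy is additive on `u × u_R^N`. Since `u` has energy `U`, the limit becomes a difference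
    -- of free energies.
    have hlim := NAHam.tendsto_ent_add hA hR hAK hRK hRmild hU0 hE hTE hT0 hg hv huInf.state
      hInft fun e s h => hA.free_le_of_isCanonical hAK hT huInf h
    have hlim' := (continuous_coe_real_ereal.tendsto _).comp
      ((tendsto_const_nhds (x := (A.ent u).toReal)).sub hlim)
    have hval : (A.ent u).toReal - T⁻¹ * ((A.en uInf).toReal + T * (A.ent uInf).toReal - U)
        = -(1 / T) * ((A.en uInf).toReal + T * (A.ent uInf).toReal
          - ((A.en u).toReal + T * (A.ent u).toReal)) := by
      rw [hue, ENNReal.toReal_ofReal hU0]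
      field_simp
      ring
    rw [hval] at hlim'
    refine hlim'.congr' ?_
    -- For `N = 0` the reservoir component of the pair is unconstrained and its entropy need not be
    -- finite.
    filter_upwards [eventually_gt_atTop 0] with N hN
    obtain ⟨-, hvs, -⟩ := (hv N).exists_real hA hR hAK hRK hN hU0 hE0
    have huNs := hA.ent_ne_top hAK (hst N) (hut N)
    have hRN := NAHam.Triple.IsRegular.pow hRr N
    rw [(huT N).state.entropy_eq (hAr.prod_pow hRr N),
      (hu.prodState hAr hRN (huR N).state).entropy_eq (hAr.prod_pow hRr N), hent N,
      NAHam.Triple.ent_prodState hAr hRN hu (huR N).state, hg.ent_eq_of_isEquilibrium hRr (huR N),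
      ← EReal.coe_ennreal_toReal (by finiteness), ← EReal.coe_ennreal_toReal (by finiteness),
      ← EReal.coe_neg, ← EReal.coe_neg, ← EReal.coe_sub,
      ENNReal.toReal_add huNs (by finiteness), ENNReal.toReal_add hus (by finiteness),
      ENNReal.toReal_mul, ENNReal.toReal_mul, ENNReal.toReal_natCast,
      ENNReal.toReal_ofReal hg.attains.2.1]
    simp only [Function.comp_apply]
    congr 1
    ring
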